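/- An almost Kähler structure on a smooth manifold (possibly with boundary) consists of a Riemannian metric $h$, an almost complex structure $J$ and a symplectic form $\omega$, all smooth up to the boundary, with $\omega(X,Y)=h(JX,Y)$ and $h(JX,JY)=h(X,Y)$. For a smooth map $\varphi:N\to M$ between almost Kähler manifolds let $\partial\varphi:T^{1,0}N\to T^{1,0}M$ and $\overline\partial\varphi:T^{0,1}N\to T^{1,0}M$ be the $T^{1,0}M$-components of the restrictions of the complexified differential $d\varphi:TN\otimes\mathbb C\to TM\otimes\mathbb C$ to $T^{1,0}N$ and $T^{0,1}N$. With Hilbert–Schmidt norms for the Hermitian inner products induced by the metrics, put $e'(\varphi)=|\partial\varphi|^2$, $e''(\varphi)=|\overline\partial\varphi|^2$, $e(\varphi)=e'(\varphi)+e''(\varphi)$, and let $$E'(\varphi)=\int_N e'(\varphi)\,dv_g,\qquad E''(\varphi)=\int_N e''(\varphi)\,dv_g,\qquad E(\varphi)=\int_N e(\varphi)\,dv_g ,$$ where $dv_g$ is the Riemannian volume measure of $N$. Lemma. Let $N$ be a compact almost Kähler manifold of real dimension $2n\ge 2$ with (possibly empty) boundary $\partial N$. Let $M$ be an almost Kähler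 manifold without boundary, of real dimension $2m$ and with symplectic form $\omega_M$, and let $L\subset M$ be a Lagrangian submanifold, i.e. an embedded submanifold of dimension $m$ on which $\omega_M$ vanishes. Let $\varphi_t:(N,\partial N)\to(M,L)$, $t\in[0,1]$, be a smooth family of maps, that is, $(t,x)\mapsto\varphi_t(x)$ is smooth on $[0,1]\times N$ and $\varphi_t(\partial N)\subset L$ for all $t$. (i) $E'(\varphi_t)-E''(\varphi_t)$ does not depend on $t$, and it depends only on the (smooth, relative) homotopy class of $\varphi_0$: if $\psi:N\to M$ can be joined to $\varphi_0$ by a smooth family of maps $(N,\partial N)\to(M,L)$, then $E'(\psi)-E''(\psi)=E'(\varphi_0)-E''(\varphi_0)$. (ii) If $\omega_M=d\lambda$ for a smooth $1$-form $\lambda$ on $M$ whose restriction to $L$ is exact, i.e. $\lambda|_L=df$ for a smooth function $f:L\to\mathbb R$, then $E'(\varphi_t)=E''(\varphi_t)=\tfrac12E(\varphi_t)$ for all $t\in[0,1]$. -/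

import Mathlib

open Set MeasureTheory Manifold Bundle
open scoped ContDiff Topology TensorProduct

noncomputable section

/-! ### Linear algebra of complexified tangent spaces -/

namespace Complexified

variable {V W : Type*} [AddCommGroup V] [Module ℝ V] [AddCommGroup W] [Module ℝ W]

/-- The projection `U ↦ (U - i J U) / 2` of `V ⊗ ℂ` onto its `(1,0)`-part
`V^{1,0} = {X - i J X}` (the `i`-eigenspace of `J`), along `V^{0,1}`. -/
def proj10 (J : V →ₗ[ℝ] V) : (ℂ ⊗[ℝ] V) →ₗ[ℂ] (ℂ ⊗[ℝ] V) :=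
  (1 / 2 : ℂ) • (LinearMap.id - Complex.I • J.baseChange ℂ)

/-- The projection `U ↦ (U + i J U) / 2` of `V ⊗ ℂ` onto its `(0,1)`-part
`V^{0,1} = {X + i J X}` (the `-i`-eigenspace of `J`), along `V^{1,0}`. -/
def proj01 (J : V →ₗ[ℝ] V) : (ℂ ⊗[ℝ] V) →ₗ[ℂ] (ℂ ⊗[ℝ] V) :=
  (1 / 2 : ℂ) • (LinearMap.id + Complex.I • J.baseChange ℂ)

/-- The partial differential `∂A : V^{1,0} → W^{1,0}` of a real linear map `A : V → W`: the
`W^{1,0}`-component of the restriction of `A ⊗ ℂ` to `V^{1,0}`, extended by `0` on `V^{0,1}`. -/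
def del (J : V →ₗ[ℝ] V) (J' : W →ₗ[ℝ] W) (A : V →ₗ[ℝ] W) : (ℂ ⊗[ℝ] V) →ₗ[ℂ] (ℂ ⊗[ℝ] W) :=
  proj10 J' ∘ₗ A.baseChange ℂ ∘ₗ proj10 J

/-- The partial differential `∂̄A : V^{0,1} → W^{1,0}` of a real linear map `A : V → W`: the
`W^{1,0}`-component of the restriction of `A ⊗ ℂ` to `V^{0,1}`, extended by `0` on `V^{1,0}`. -/
def delBar (J : V →ₗ[ℝ] V) (J' : W →ₗ[ℝ] W) (A : V →ₗ[ℝ] W) : (ℂ ⊗[ℝ] V) →ₗ[ℂ] (ℂ ⊗[ℝ] W) :=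
  proj10 J' ∘ₗ A.baseChange ℂ ∘ₗ proj01 J

/-- Complex conjugation on `V ⊗ ℂ`. -/
def conj : (ℂ ⊗[ℝ] V) →ₗ[ℝ] (ℂ ⊗[ℝ] V) :=
  Complex.conjAe.toLinearMap.rTensor V

/-- The Hermitian inner product `⟪U, U'⟫ = ⟨U, conj U'⟩` on `V ⊗ ℂ`, where `⟨·,·⟩` is the complex
bilinear extension of the real inner product `g` on `V`. -/
def herm (g : LinearMap.BilinForm ℝ V) (U U' : ℂ ⊗[ℝ] V) : ℂ :=
  LinearMap.BilinForm.baseChange ℂ g U (conj U')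

/-- The squared (Hilbert--Schmidt) norm of a complex linear map `T : V ⊗ ℂ → W ⊗ ℂ`, for the
Hermitian inner products induced by the inner products `g` on `V` and `h` on `W`. In a real basis
`b` of `V` with Gram matrix `G` it is `∑ i j, (G⁻¹) i j * ⟪T bᵢ, T bⱼ⟫`; this does not depend on
`b`, and it is `∑ i, ⟪T eᵢ, T eᵢ⟫` if `e` is `g`-orthonormal. If `T` vanishes on `V^{0,1}` or on
`V^{1,0}`, it is the squared norm of the restriction of `T` to the other summand. -/
def normSq [Module.Finite ℝ V] (g : LinearMap.BilinForm ℝ V) (h : LinearMap.BilinForm ℝ W)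
    (T : (ℂ ⊗[ℝ] V) →ₗ[ℂ] (ℂ ⊗[ℝ] W)) : ℝ :=
  (∑ i, ∑ j, (((LinearMap.BilinForm.toMatrix (Module.finBasis ℝ V) g)⁻¹ i j : ℝ) : ℂ) *
    herm h (T (1 ⊗ₜ[ℝ] Module.finBasis ℝ V i)) (T (1 ⊗ₜ[ℝ] Module.finBasis ℝ V j))).re

end Complexified

/-! ### Differential forms on manifolds (possibly with boundary) -/

section Forms

variable {E : Type*} [NormedAddCommGroup E] [NormedSpace ℝ E]
  {H : Type*} [TopologicalSpace H] (I : ModelWithCorners ℝ E H)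
  (M : Type*) [TopologicalSpace M] [ChartedSpace H M]

variable {M} in
/-- The derivative of the inverse of the chart at `x₀`, at the coordinate point `y`: it maps the
standard basis vectors to the coordinate vector fields. -/
def chartSymmDeriv (x₀ : M) (y : E) : E →L[ℝ] TangentSpace I ((extChartAt I x₀).symm y) :=
  mfderivWithin 𝓘(ℝ, E) I (extChartAt I x₀).symm (range I) y

/-- A differential `k`-form on `M`, not necessarily smooth. -/
def DiffForm (k : ℕ) : Type _ := ∀ x : M, TangentSpace I x [⋀^Fin k]→L[ℝ] ℝ

variable {I M}

namespace DiffForm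

/-- The expression of a form in the chart at `x₀`: its pullback under the inverse chart. -/
def inChart {k : ℕ} (α : DiffForm I M k) (x₀ : M) (y : E) : E [⋀^Fin k]→L[ℝ] ℝ :=
  (α ((extChartAt I x₀).symm y)).compContinuousLinearMap (chartSymmDeriv I x₀ y)

/-- A form is smooth if all its chart expressions are. -/
def IsSmooth {k : ℕ} (α : DiffForm I M k) : Prop :=
  ∀ x₀ : M, ContDiffOn ℝ ∞ (α.inChart x₀) (extChartAt I x₀).target

/-- `α.HasExtDeriv β` says `dα = β`: in every chart, the chart expression of `β` is the exterior
derivative of the chart expression of `α`. -/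
def HasExtDeriv {k : ℕ} (α : DiffForm I M k) (β : DiffForm I M (k + 1)) : Prop :=
  ∀ x₀ : M, ∀ y ∈ (extChartAt I x₀).target,
    extDerivWithin (α.inChart x₀) (range I) y = β.inChart x₀ y

/-- `dα = 0`. -/
def IsClosedForm {k : ℕ} (α : DiffForm I M k) : Prop := α.HasExtDeriv (fun _ => 0)

end DiffForm

end Forms

/-! ### Almost Kähler structures -/

section AlmostKahler

variable {E : Type*} [NormedAddCommGroup E] [NormedSpace ℝ E]
  {H : Type*} [TopologicalSpace H] (I : ModelWithCorners ℝ E H)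
  (M : Type*) [TopologicalSpace M] [ChartedSpace H M] [IsManifold I ∞ M]

/-- An almost Kähler structure on a smooth manifold (possibly with boundary): a Riemannian metric
`h`, an almost complex structure `J` and a symplectic form `ω`, all smooth (up to the boundary),
such that `ω(X, Y) = h(JX, Y)` and `h(JX, JY) = h(X, Y)`. -/
structure AlmostKahler where
  /-- the Riemannian metric -/
  metric : ContMDiffRiemannianMetric I ∞ E (fun x : M => TangentSpace I x)
  /-- the almost complex structure -/
  J : ∀ x : M, TangentSpace I x →L[ℝ] TangentSpace I x
  J_smooth : ContMDiff I (I.prod 𝓘(ℝ, E →L[ℝ] E)) ∞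
    (fun x : M => TotalSpace.mk' (E →L[ℝ] E)
      (E := fun x : M => TangentSpace I x →L[ℝ] TangentSpace I x) x (J x))
  J_sq : ∀ (x : M) (v : TangentSpace I x), J x (J x v) = -v
  /-- the symplectic form -/
  omega : DiffForm I M 2
  omega_smooth : omega.IsSmooth
  omega_closed : omega.IsClosedForm
  omega_nondegenerate : ∀ (x : M) (v : TangentSpace I x),
    (∀ w : TangentSpace I x, omega x ![v, w] = 0) → v = 0
  omega_eq : ∀ (x : M) (v w : TangentSpace I x), omega x ![v, w] = metric.inner x (J x v) w
  J_isometry : ∀ (x : M) (v w : TangentSpace I x),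
    metric.inner x (J x v) (J x w) = metric.inner x v w

variable {I M}

/-- The metric at `x` as a bilinear form. -/
def AlmostKahler.bilin (K : AlmostKahler I M) (x : M) :
    LinearMap.BilinForm ℝ (TangentSpace I x) :=
  LinearMap.mk₂ ℝ (fun v w => K.metric.inner x v w)
    (by simp) (by simp) (by simp) (by simp)

end AlmostKahler

/-! ### The Riemannian volume measure -/

section Volume

variable {d : ℕ} {H : Type*} [TopologicalSpace H]
  {I : ModelWithCorners ℝ (EuclideanSpace ℝ (Fin d)) H}
  {N : Type*} [TopologicalSpace N] [ChartedSpace H N] [IsManifold I ∞ N]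

/-- The coefficients `g_ij` of the metric in the chart at `x₀`, at the coordinate point `y`. -/
def gramInChart (g : ContMDiffRiemannianMetric I ∞ (EuclideanSpace ℝ (Fin d))
      (fun x : N => TangentSpace I x)) (x₀ : N) (y : EuclideanSpace ℝ (Fin d)) :
    Matrix (Fin d) (Fin d) ℝ :=
  Matrix.of fun i j =>
    g.inner ((extChartAt I x₀).symm y)
      (chartSymmDeriv I x₀ y (EuclideanSpace.single i (1 : ℝ)))
      (chartSymmDeriv I x₀ y (EuclideanSpace.single j (1 : ℝ)))

/-- The measure `√(det g_ij) dy` on the domain of the chart at `x₀`, extended by zero to `N`. -/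
def chartVolume [MeasurableSpace N]
    (g : ContMDiffRiemannianMetric I ∞ (EuclideanSpace ℝ (Fin d))
      (fun x : N => TangentSpace I x)) (x₀ : N) : Measure N :=
  (((volume : Measure (EuclideanSpace ℝ (Fin d))).restrict (extChartAt I x₀).target).withDensity
    (fun y => ENNReal.ofReal (Real.sqrt (gramInChart g x₀ y).det))).map (extChartAt I x₀).symm

/-- The Riemannian volume measure `dv_g`. The measures `√(det g_ij) dy` of two charts agree where
both are defined, and `dv_g` is obtained by gluing them: it is the smallest measure that dominates
all of them, and its restriction to the domain of each chart is the measure of that chart. -/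
def riemannianVolume [MeasurableSpace N]
    (g : ContMDiffRiemannianMetric I ∞ (EuclideanSpace ℝ (Fin d))
      (fun x : N => TangentSpace I x)) : Measure N :=
  ⨆ x₀ : N, chartVolume g x₀

end Volume

/-! ### Partial energies -/

section Energy

variable {d : ℕ} {H : Type*} [TopologicalSpace H]
  {I : ModelWithCorners ℝ (EuclideanSpace ℝ (Fin d)) H}
  {N : Type*} [TopologicalSpace N] [ChartedSpace H N] [IsManifold I ∞ N]
  {E' : Type*} [NormedAddCommGroup E'] [NormedSpace ℝ E'] {H' : Type*} [TopologicalSpace H']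
  {I' : ModelWithCorners ℝ E' H'}
  {M : Type*} [TopologicalSpace M] [ChartedSpace H' M] [IsManifold I' ∞ M]

instance (x : N) : Module.Finite ℝ (TangentSpace I x) :=
  inferInstanceAs (Module.Finite ℝ (EuclideanSpace ℝ (Fin d)))

/-- The partial energy density `e'(φ) = |∂φ|²`. -/
def energyDensity10 (KN : AlmostKahler I N) (KM : AlmostKahler I' M) (φ : N → M) (x : N) : ℝ :=
  Complexified.normSq (KN.bilin x) (KM.bilin (φ x))
    (Complexified.del (KN.J x : TangentSpace I x →ₗ[ℝ] TangentSpace I x)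
      (KM.J (φ x) : TangentSpace I' (φ x) →ₗ[ℝ] TangentSpace I' (φ x))
      (mfderiv I I' φ x : TangentSpace I x →ₗ[ℝ] TangentSpace I' (φ x)))

/-- The partial energy density `e''(φ) = |∂̄φ|²`. -/
def energyDensity01 (KN : AlmostKahler I N) (KM : AlmostKahler I' M) (φ : N → M) (x : N) : ℝ :=
  Complexified.normSq (KN.bilin x) (KM.bilin (φ x))
    (Complexified.delBar (KN.J x : TangentSpace I x →ₗ[ℝ] TangentSpace I x)
      (KM.J (φ x) : TangentSpace I' (φ x) →ₗ[ℝ] TangentSpace I' (φ x))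
      (mfderiv I I' φ x : TangentSpace I x →ₗ[ℝ] TangentSpace I' (φ x)))

/-- The energy density `e(φ) = e'(φ) + e''(φ)`, which is half the squared norm of `dφ`. -/
def energyDensity (KN : AlmostKahler I N) (KM : AlmostKahler I' M) (φ : N → M) (x : N) : ℝ :=
  energyDensity10 KN KM φ x + energyDensity01 KN KM φ x

variable [MeasurableSpace N]

/-- `E'(φ) = ∫ e'(φ) dv_g`. -/
def energy10 (KN : AlmostKahler I N) (KM : AlmostKahler I' M) (φ : N → M) : ℝ :=
  ∫ x, energyDensity10 KN KM φ x ∂(riemannianVolume KN.metric)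

/-- `E''(φ) = ∫ e''(φ) dv_g`. -/
def energy01 (KN : AlmostKahler I N) (KM : AlmostKahler I' M) (φ : N → M) : ℝ :=
  ∫ x, energyDensity01 KN KM φ x ∂(riemannianVolume KN.metric)

/-- `E(φ) = ∫ e(φ) dv_g`. -/
def energy (KN : AlmostKahler I N) (KM : AlmostKahler I' M) (φ : N → M) : ℝ :=
  ∫ x, energyDensity KN KM φ x ∂(riemannianVolume KN.metric)

end Energy

/-! ### Lagrangian submanifolds and smooth families of maps of pairs -/

section Pairs

variable {E : Type*} [NormedAddCommGroup E] [NormedSpace ℝ E]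
  {H : Type*} [TopologicalSpace H] {I : ModelWithCorners ℝ E H}
  {N : Type*} [TopologicalSpace N] [ChartedSpace H N]

/-- The inclusion `ι : L → M` of an embedded submanifold makes `L` a Lagrangian submanifold of the
almost Kähler manifold `M`: `dim M = 2 dim L`, and `ω` restricts to `0` on `L`. -/
structure IsLagrangian {m : ℕ} {M : Type*} [TopologicalSpace M]
    [ChartedSpace (EuclideanSpace ℝ (Fin (2 * m))) M] [IsManifold (𝓡 (2 * m)) ∞ M]
    (K : AlmostKahler (𝓡 (2 * m)) M)
    {L : Type*} [TopologicalSpace L] [ChartedSpace (EuclideanSpace ℝ (Fin m)) L]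
    (ι : L → M) : Prop where
  isSmoothEmbedding : IsSmoothEmbedding (𝓡 m) (𝓡 (2 * m)) ∞ ι
  isotropic : ∀ (p : L) (v w : TangentSpace (𝓡 m) p),
    K.omega (ι p) ![mfderiv (𝓡 m) (𝓡 (2 * m)) ι p v, mfderiv (𝓡 m) (𝓡 (2 * m)) ι p w] = 0

variable {E' : Type*} [NormedAddCommGroup E'] [NormedSpace ℝ E'] {H' : Type*} [TopologicalSpace H']
  {M : Type*} [TopologicalSpace M] [ChartedSpace H' M]

/-- `φ t : (N, ∂N) → (M, S)`, `t ∈ [0, 1]`, is a smooth family of maps of pairs: `φ` is smooth on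
`[0, 1] × N`, and `φ t` maps the boundary of `N` into `S` for each `t`. (The values of `φ t` for
`t ∉ [0, 1]` play no role.) -/
structure IsSmoothFamily (I : ModelWithCorners ℝ E H) (I' : ModelWithCorners ℝ E' H')
    (S : Set M) (φ : ℝ → N → M) : Prop where
  smooth : ContMDiffOn (𝓘(ℝ, ℝ).prod I) I' ∞ (fun p : ℝ × N => φ p.1 p.2) (Icc (0 : ℝ) 1 ×ˢ univ)
  boundary : ∀ t ∈ Icc (0 : ℝ) 1, MapsTo (φ t) (I.boundary N) S

/-- Two maps `(N, ∂N) → (M, S)` are smoothly homotopic as maps of pairs. -/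
def SmoothlyHomotopic (I : ModelWithCorners ℝ E H) (I' : ModelWithCorners ℝ E' H')
    (S : Set M) (φ ψ : N → M) : Prop :=
  ∃ Φ : ℝ → N → M, IsSmoothFamily I I' S Φ ∧ Φ 0 = φ ∧ Φ 1 = ψ

end Pairs

end

open Set MeasureTheory Manifold Bundle
open scoped ContDiff Topology TensorProduct

noncomputable section

/-! Let `Π` be the bivector of `N` dual to its symplectic form: `Π(T) = ∑ g^{ij} T(eᵢ, J eⱼ)`, which
is `AlmostKahler.contract`. In a chart where `ω_N` has the matrix `Ω`, its coefficients are those of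
`-Ω⁻¹` (`metricTrace_compl_eq`). Expanding the Hilbert–Schmidt norms gives, pointwise, `4e' = tr
φ^*h + Π(φ^*ω_M)` and `4e'' = tr φ^*h - Π(φ^*ω_M)` (`normSq_del`, `normSq_delBar`). Hence `E' - E''`
is half of `∫ Π(φ^*ω_M) dv_g`, and both parts of the theorem are statements about this integral.

Classically `Π(α) dv_g` is a multiple of `ω_N^{n-1} ∧ α`, and since `ω_N` is closed its integral is
a boundary term when `α` is exact. The proof avoids wedge powers and orientations. Closedness of
`ω_N` is used in the form `∑ᵢ ∂ᵢ(√(det g) Ω^{ij}) = 0` (`sum_fderivWithin_density_mul_inv`). It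
makes `√(det g) Π(db)` a coordinate divergence, so Stokes' theorem becomes the divergence theorem on
the half-space together with a partition of unity (`integral_contract_extDeriv_eq_zero`). If `b`
vanishes on vectors tangent to `∂N`, the flux through the boundary vanishes too: only the normal
component `b₀` is left, and its coefficient is `Ω^{00} = 0`.

For (i), closedness of the pullback of `ω_M` to `[0,1] × N` gives `∂ₜ(φₜ^*ω_M) = dβₜ` with `βₜ =
ω_M(∂ₜφ, dφₜ ·)`. At the boundary, `∂ₜφ` and the images of vectors tangent to `∂N` are tangent to
the Lagrangian `L`, so `βₜ` vanishes on them (`integral_contractDeriv_eq_zero`) and the integral is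
constant in `t`.

For (ii), the values of `f` along the boundary map extend to a smooth function `u` on `N`
(`exists_extension_of_boundary`). Then `φ^*λ - du` is a primitive of `φ^*ω_M` which vanishes on
vectors tangent to `∂N`, because `λ|_L = df`; so the integral is zero
(`integral_contract_pullbackOmega_eq_zero`). -/

/-! ### Traces of bilinear forms and the partial energy densities -/

namespace Complexified

variable {V W : Type*} [AddCommGroup V] [Module ℝ V] [AddCommGroup W] [Module ℝ W]

/-- The trace of the bilinear form `T` with respect to the bilinear form `g`, computed in the
basis `b`. -/
def basisTrace {ι : Type*} [Fintype ι] [DecidableEq ι] (b : Module.Basis ι ℝ V)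
    (g T : LinearMap.BilinForm ℝ V) : ℝ :=
  ∑ i, ∑ j, (LinearMap.BilinForm.toMatrix b g)⁻¹ i j * T (b i) (b j)

theorem basisTrace_eq_trace {ι : Type*} [Fintype ι] [DecidableEq ι] (b : Module.Basis ι ℝ V)
    (g T : LinearMap.BilinForm ℝ V) :
    basisTrace b g T = ((LinearMap.BilinForm.toMatrix b g)⁻¹ *
      (LinearMap.BilinForm.toMatrix b T).transpose).trace := by
  simp [basisTrace, Matrix.trace, Matrix.mul_apply, LinearMap.BilinForm.toMatrix_apply]

theorem basisTrace_reindex {ι κ : Type*} [Fintype ι] [DecidableEq ι] [Fintype κ] [DecidableEq κ]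
    (b : Module.Basis ι ℝ V) (e : ι ≃ κ) (g T : LinearMap.BilinForm ℝ V) :
    basisTrace (b.reindex e) g T = basisTrace b g T := by
  have h : LinearMap.BilinForm.toMatrix (b.reindex e) g =
      Matrix.reindex e e (LinearMap.BilinForm.toMatrix b g) := by
    ext i j
    simp [LinearMap.BilinForm.toMatrix_apply]
  unfold basisTrace
  rw [h, Matrix.inv_reindex]
  rw [← e.sum_comp]
  refine Finset.sum_congr rfl fun i _ => ?_
  rw [← e.sum_comp]
  simp

/-- The trace of a bilinear form with respect to another one does not depend on the basis. -/
theorem basisTrace_eq {ι κ : Type*} [Fintype ι] [DecidableEq ι] [Fintype κ] [DecidableEq κ]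
    (b : Module.Basis ι ℝ V) (c : Module.Basis κ ℝ V) (g T : LinearMap.BilinForm ℝ V) :
    basisTrace b g T = basisTrace c g T := by
  -- With a common index type the change-of-basis matrix `P` is square and invertible, and it
  -- cancels against its inverse under the cyclic trace.
  rw [← basisTrace_reindex c (c.indexEquiv b)]
  generalize c.reindex (c.indexEquiv b) = c'
  have hP := b.invertibleToMatrix c'
  rw [basisTrace_eq_trace, basisTrace_eq_trace,
    ← LinearMap.BilinForm.toMatrix_mul_basis_toMatrix (b := b) (c := c') g,
    ← LinearMap.BilinForm.toMatrix_mul_basis_toMatrix (b := b) (c := c') T]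
  set P := b.toMatrix c'
  have hu : IsUnit P.det := Matrix.isUnit_det_of_invertible P
  have hu' : IsUnit P.transpose.det := by rwa [Matrix.det_transpose]
  rw [Matrix.mul_inv_rev, Matrix.mul_inv_rev, Matrix.transpose_mul, Matrix.transpose_mul,
    Matrix.transpose_transpose, Matrix.trace_mul_comm (P⁻¹ * _), Matrix.mul_assoc, Matrix.mul_assoc,
    Matrix.mul_nonsing_inv_cancel_left _ _ hu, ← Matrix.mul_assoc, ← Matrix.mul_assoc,
    Matrix.trace_mul_comm]
  symm
  rw [Matrix.trace_mul_comm, ← Matrix.mul_assoc, ← Matrix.mul_assoc, Matrix.nonsing_inv_mul _ hu',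
    Matrix.one_mul]

variable [Module.Finite ℝ V]

/-- The trace of the bilinear form `T` with respect to the inner product `g`. -/
def metricTrace (g T : LinearMap.BilinForm ℝ V) : ℝ :=
  basisTrace (Module.finBasis ℝ V) g T

theorem metricTrace_eq {ι : Type*} [Fintype ι] [DecidableEq ι] (b : Module.Basis ι ℝ V)
    (g T : LinearMap.BilinForm ℝ V) : metricTrace g T = basisTrace b g T :=
  basisTrace_eq _ _ _ _

theorem metricTrace_add (g T T' : LinearMap.BilinForm ℝ V) :
    metricTrace g (T + T') = metricTrace g T + metricTrace g T' := by
  simp [metricTrace, basisTrace, mul_add, Finset.sum_add_distrib]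

theorem metricTrace_smul (g T : LinearMap.BilinForm ℝ V) (c : ℝ) :
    metricTrace g (c • T) = c * metricTrace g T := by
  simp only [metricTrace, basisTrace, Finset.mul_sum, LinearMap.smul_apply, smul_eq_mul]
  exact Finset.sum_congr rfl fun i _ => Finset.sum_congr rfl fun j _ => by ring

/-- The inverse of a symmetric Gram matrix is symmetric, so the double sum may be transposed. -/
theorem metricTrace_flip (g T : LinearMap.BilinForm ℝ V) (hg : ∀ v w, g v w = g w v) :
    metricTrace g (LinearMap.flip T) = metricTrace g T := by
  simp only [metricTrace, basisTrace]
  rw [Finset.sum_comm]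
  have h : (LinearMap.BilinForm.toMatrix (Module.finBasis ℝ V) g).transpose =
      LinearMap.BilinForm.toMatrix (Module.finBasis ℝ V) g := by
    ext i j
    simp [LinearMap.BilinForm.toMatrix_apply, hg]
  refine Finset.sum_congr rfl fun i _ => Finset.sum_congr rfl fun j _ => ?_
  rw [← Matrix.transpose_apply (_⁻¹) , Matrix.transpose_nonsing_inv, h]
  rfl

/-- The trace is invariant under isometries. -/
theorem metricTrace_comp (g T : LinearMap.BilinForm ℝ V) (J : V ≃ₗ[ℝ] V)
    (hJ : ∀ v w, g (J v) (J w) = g v w) :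
    metricTrace g (T.compl₁₂ (J : V →ₗ[ℝ] V) (J : V →ₗ[ℝ] V)) = metricTrace g T := by
  -- The right-hand trace is evaluated in the image basis under `J`, which has the same Gram matrix.
  rw [metricTrace_eq ((Module.finBasis ℝ V).map J) g T, metricTrace]
  have h : LinearMap.BilinForm.toMatrix ((Module.finBasis ℝ V).map J) g =
      LinearMap.BilinForm.toMatrix (Module.finBasis ℝ V) g := by
    ext i j
    simp [LinearMap.BilinForm.toMatrix_apply, hJ]
  simp [basisTrace, h]

-- Separates the real and imaginary parts, which is the shape that `herm_re` evaluates.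
omit [Module.Finite ℝ V] in
theorem del_tmul (J : V →ₗ[ℝ] V) (J' : W →ₗ[ℝ] W) (A : V →ₗ[ℝ] W) (v : V) :
    del J J' A (1 ⊗ₜ[ℝ] v) = (1 / 4 : ℂ) ⊗ₜ[ℝ] (A v - J' (A (J v))) -
      (Complex.I / 4) ⊗ₜ[ℝ] (A (J v) + J' (A v)) := by
  simp only [del, proj10, LinearMap.comp_apply, LinearMap.smul_apply, LinearMap.sub_apply,
    LinearMap.id_apply, LinearMap.baseChange_tmul, map_sub, smul_sub,
    TensorProduct.smul_tmul', smul_eq_mul, TensorProduct.tmul_sub, TensorProduct.tmul_add]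
  have : (1 / 2 * (Complex.I * (1 / 2 * (Complex.I * 1))) : ℂ) = -(1 / 4) := by
    linear_combination (1 / 4 : ℂ) * Complex.I_sq
  rw [this, TensorProduct.neg_tmul]
  ring_nf
  abel

-- Exchanging `T^{1,0}` and `T^{0,1}` of the source amounts to replacing `J` by `-J`, so facts about
-- `∂̄` follow from those about `∂`.
omit [Module.Finite ℝ V] in
theorem delBar_tmul (J : V →ₗ[ℝ] V) (J' : W →ₗ[ℝ] W) (A : V →ₗ[ℝ] W) (v : V) :
    delBar J J' A (1 ⊗ₜ[ℝ] v) = del (-J) J' A (1 ⊗ₜ[ℝ] v) := by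
  congr 1
  simp [delBar, del, proj10, proj01, LinearMap.baseChange_neg]

/-- The cross terms between real and imaginary parts are purely imaginary and drop out. -/
theorem herm_re (h : LinearMap.BilinForm ℝ W) (x y x' y' : W) :
    (herm h ((1 / 4 : ℂ) ⊗ₜ[ℝ] x - (Complex.I / 4) ⊗ₜ[ℝ] y)
      ((1 / 4 : ℂ) ⊗ₜ[ℝ] x' - (Complex.I / 4) ⊗ₜ[ℝ] y')).re = (1 / 16) * (h x x' + h y y') := by
  simp only [herm, conj, map_sub, LinearMap.rTensor_tmul, AlgEquiv.toLinearMap_apply,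
    Complex.conjAe_coe, map_div₀, Complex.conj_I, map_one, map_ofNat, LinearMap.sub_apply,
    LinearMap.BilinForm.baseChange_tmul, Complex.sub_re]
  simp
  ring

/-- `|∂A|²` in terms of traces: `S` is the pullback of the metric, `A^* ω` that of the fundamental
form, for a compatible almost complex structure. -/
theorem normSq_del (g : LinearMap.BilinForm ℝ V) (h : LinearMap.BilinForm ℝ W)
    (J : V →ₗ[ℝ] V) (J' : W →ₗ[ℝ] W) (A : V →ₗ[ℝ] W) (hg : ∀ v w, g v w = g w v)
    (hh : ∀ v w, h v w = h w v) (hJ2 : ∀ v, J (J v) = -v) (hJ : ∀ v w, g (J v) (J w) = g v w)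
    (hJ'2 : ∀ v, J' (J' v) = -v) (hJ' : ∀ v w, h (J' v) (J' w) = h v w) :
    normSq g h (del J J' A) = (1 / 4) * (metricTrace g (h.compl₁₂ A A) +
      metricTrace g (h.compl₁₂ (J' ∘ₗ A) (A ∘ₗ J))) := by
  -- The real part of the inner product of `∂A v` and `∂A w` consists of four terms. Each occurs
  -- once among the real parts and once among the imaginary parts, whence `2/16`. The last two have
  -- the same traces as the first two, by symmetry of the trace and because `J` is an isometry.
  set T := (1 / 8 : ℝ) • (h.compl₁₂ A A + h.compl₁₂ (J' ∘ₗ A) (A ∘ₗ J) +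
    ((h.compl₁₂ (J' ∘ₗ A) (A ∘ₗ J)).flip + (h.compl₁₂ A A).compl₁₂ J J)) with hT
  have key : normSq g h (del J J' A) = metricTrace g T := by
    simp only [normSq, metricTrace, basisTrace, Complex.re_sum, Complex.re_ofReal_mul, del_tmul,
      herm_re]
    refine Finset.sum_congr rfl fun i _ => Finset.sum_congr rfl fun j _ => ?_
    congr 1
    generalize (Module.finBasis ℝ V) i = v
    generalize (Module.finBasis ℝ V) j = w
    have e1 : ∀ x y, h (J' x) y = - h x (J' y) := fun x y => by
      rw [← hJ' x (J' y), hJ'2, map_neg, neg_neg]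
    simp only [hT, LinearMap.smul_apply, LinearMap.add_apply, LinearMap.compl₁₂_apply,
      LinearMap.flip_apply, LinearMap.comp_apply, map_add, map_sub, LinearMap.sub_apply,
      LinearMap.add_apply, smul_eq_mul, e1, hJ'2, map_neg]
    rw [hh (A (J v)) (J' (A w)), e1]
    ring
  have hJe : metricTrace g ((h.compl₁₂ A A).compl₁₂ J J) = metricTrace g (h.compl₁₂ A A) := by
    have := metricTrace_comp g (h.compl₁₂ A A)
      (LinearEquiv.ofLinearMap J (-J) (by ext; simp [hJ2]) (by ext; simp [hJ2])) hJ
    exact this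
  rw [key, hT, metricTrace_smul, metricTrace_add, metricTrace_add, metricTrace_add,
    metricTrace_flip _ _ hg, hJe]
  ring

/-- `|∂̄A|²` in terms of traces. -/
theorem normSq_delBar (g : LinearMap.BilinForm ℝ V) (h : LinearMap.BilinForm ℝ W)
    (J : V →ₗ[ℝ] V) (J' : W →ₗ[ℝ] W) (A : V →ₗ[ℝ] W) (hg : ∀ v w, g v w = g w v)
    (hh : ∀ v w, h v w = h w v) (hJ2 : ∀ v, J (J v) = -v) (hJ : ∀ v w, g (J v) (J w) = g v w)
    (hJ'2 : ∀ v, J' (J' v) = -v) (hJ' : ∀ v w, h (J' v) (J' w) = h v w) :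
    normSq g h (delBar J J' A) = (1 / 4) * (metricTrace g (h.compl₁₂ A A) -
      metricTrace g (h.compl₁₂ (J' ∘ₗ A) (A ∘ₗ J))) := by
  have h1 : normSq g h (delBar J J' A) = normSq g h (del (-J) J' A) := by
    simp only [normSq, delBar_tmul]
  have h2 : h.compl₁₂ (J' ∘ₗ A) (A ∘ₗ (-J)) = (-1 : ℝ) • h.compl₁₂ (J' ∘ₗ A) (A ∘ₗ J) := by
    ext; simp
  rw [h1, normSq_del g h (-J) J' A hg hh (by simp [hJ2]) (by simp [hJ]) hJ'2 hJ', h2,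
    metricTrace_smul]
  ring

omit [Module.Finite ℝ V] in
theorem posDef_toMatrix {ι : Type*} [Fintype ι] [DecidableEq ι] (b : Module.Basis ι ℝ V)
    (g : LinearMap.BilinForm ℝ V) (hg : ∀ v w, g v w = g w v) (hpos : ∀ v, v ≠ 0 → 0 < g v v) :
    (LinearMap.BilinForm.toMatrix b g).PosDef := by
  refine Matrix.PosDef.of_dotProduct_mulVec_pos ?_ fun c hc => ?_
  · ext i j
    simp [LinearMap.BilinForm.toMatrix_apply, hg]
  · have h := LinearMap.BilinForm.apply_eq_dotProduct_toMatrix_mulVec b g (b.equivFun.symm c)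
      (b.equivFun.symm c)
    have hc' : ⇑(b.repr (b.equivFun.symm c)) = c := b.equivFun.apply_symm_apply c
    rw [hc'] at h
    rw [star_trivial, ← h]
    exact hpos _ fun h0 => hc ((LinearEquiv.map_eq_zero_iff _).1 h0)

/-- In a basis with matrix `Ω` of the fundamental form `g(J·, ·)`, the contraction of a bilinear
form with the fundamental bivector is the contraction with `-Ω⁻¹`; moreover `det Ω = ± det g`. -/
theorem metricTrace_compl_eq {ι : Type*} [Fintype ι] [DecidableEq ι] (b : Module.Basis ι ℝ V)
    (g T : LinearMap.BilinForm ℝ V) (J : V →ₗ[ℝ] V) (Ω : Matrix ι ι ℝ)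
    (hpos : IsUnit (LinearMap.BilinForm.toMatrix b g).det)
    (hJ2 : ∀ v, J (J v) = -v) (hΩ : ∀ i j, Ω i j = g (J (b i)) (b j)) :
    metricTrace g (T.compl₁₂ LinearMap.id J) = ∑ i, ∑ j, -(Ω⁻¹ i j) * T (b i) (b j) ∧
      Ω.det ^ 2 = (LinearMap.BilinForm.toMatrix b g).det ^ 2 ∧ IsUnit Ω.det := by
  set G := LinearMap.BilinForm.toMatrix b g with hG
  set Q := LinearMap.toMatrix b b J with hQ
  have hQQ : Q * Q = -1 := by
    rw [hQ, ← LinearMap.toMatrix_comp, ← LinearMap.toMatrix_id b, ← map_neg]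
    congr 1
    ext v
    simp [hJ2]
  have hJb : ∀ i, J (b i) = ∑ k, Q k i • b k := fun i => by
    rw [hQ]
    simp only [LinearMap.toMatrix_apply]
    exact (b.sum_repr (J (b i))).symm
  have hΩ' : Ω = Q.transpose * G := by
    ext i j
    rw [hΩ, hJb, Matrix.mul_apply]
    simp [hG, LinearMap.BilinForm.toMatrix_apply]
  have hdet : Q.det ^ 2 = (-1 : Matrix ι ι ℝ).det := by
    rw [sq, ← Matrix.det_mul, hQQ]
  have hdetsq : (Q.det ^ 2) ^ 2 = 1 := by
    rw [hdet, sq, ← Matrix.det_mul]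
    simp
  -- `det Q ^ 2` is nonnegative and has square `1`; the parity of the dimension is not needed.
  have hdet1 : Q.det ^ 2 = 1 := by
    nlinarith [sq_nonneg Q.det]
  have hdetΩ : Ω.det = Q.det * G.det := by
    rw [hΩ', Matrix.det_mul, Matrix.det_transpose]
  have huQ : IsUnit Q.det := by
    rw [isUnit_iff_ne_zero]
    rintro h
    rw [h] at hdet1
    norm_num at hdet1
  have hinv : G⁻¹ * Q.transpose = -Ω⁻¹ := by
    have h1 : Ω * (-(G⁻¹ * Q.transpose)) = 1 := by
      rw [hΩ', Matrix.mul_neg, Matrix.mul_assoc, Matrix.mul_nonsing_inv_cancel_left _ _ hpos,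
        ← Matrix.transpose_mul, hQQ]
      simp
    rw [Matrix.inv_eq_right_inv h1, neg_neg]
  refine ⟨?_, ?_, ?_⟩
  · rw [metricTrace_eq b, basisTrace]
    refine Finset.sum_congr rfl fun i _ => ?_
    simp only [LinearMap.compl₁₂_apply, LinearMap.id_apply, hJb, map_sum, map_smul, smul_eq_mul,
      Finset.mul_sum]
    rw [Finset.sum_comm]
    refine Finset.sum_congr rfl fun k _ => ?_
    have := congrFun (congrFun hinv i) k
    rw [Matrix.neg_apply, Matrix.mul_apply] at this
    rw [← this, Finset.sum_mul]
    exact Finset.sum_congr rfl fun j _ => by rw [Matrix.transpose_apply]; ring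
  · rw [hdetΩ, mul_pow, hdet1, one_mul]
  · rw [hdetΩ]
    exact huQ.mul hpos

end Complexified

/-! ### Partial energy densities as traces -/

section Densities

open Complexified

theorem AlmostKahler.bilin_apply {E : Type*} [NormedAddCommGroup E] [NormedSpace ℝ E]
    {H : Type*} [TopologicalSpace H] {I : ModelWithCorners ℝ E H}
    {M : Type*} [TopologicalSpace M] [ChartedSpace H M] [IsManifold I ∞ M]
    (K : AlmostKahler I M) (x : M) (v w : TangentSpace I x) :
    K.bilin x v w = K.metric.inner x v w := rfl

variable {E' : Type*} [NormedAddCommGroup E'] [NormedSpace ℝ E'] {H' : Type*} [TopologicalSpace H']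
  {I' : ModelWithCorners ℝ E' H'}
  {M : Type*} [TopologicalSpace M] [ChartedSpace H' M] [IsManifold I' ∞ M]
  {d : ℕ} {H : Type*} [TopologicalSpace H]
  {I : ModelWithCorners ℝ (EuclideanSpace ℝ (Fin d)) H}
  {N : Type*} [TopologicalSpace N] [ChartedSpace H N] [IsManifold I ∞ N]

/-- The contraction `∑ i j, g^{ij} T(eᵢ, J eⱼ)` of a bilinear form with the fundamental
bivector of an almost Kähler structure. -/
def AlmostKahler.contract (K : AlmostKahler I N) (x : N)
    (T : LinearMap.BilinForm ℝ (TangentSpace I x)) : ℝ :=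
  metricTrace (K.bilin x)
    (T.compl₁₂ LinearMap.id (K.J x : TangentSpace I x →ₗ[ℝ] TangentSpace I x))

/-- The pullback of the metric of `M` to a tangent space of `N`. -/
def pullbackMetric (KM : AlmostKahler I' M) (φ : N → M) (x : N) :
    LinearMap.BilinForm ℝ (TangentSpace I x) :=
  (KM.bilin (φ x)).compl₁₂ (mfderiv I I' φ x : TangentSpace I x →ₗ[ℝ] TangentSpace I' (φ x))
    (mfderiv I I' φ x : TangentSpace I x →ₗ[ℝ] TangentSpace I' (φ x))

/-- The pullback of the symplectic form of `M` to a tangent space of `N`. -/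
def pullbackOmega (KM : AlmostKahler I' M) (φ : N → M) (x : N) :
    LinearMap.BilinForm ℝ (TangentSpace I x) :=
  (KM.bilin (φ x)).compl₁₂
    ((KM.J (φ x) : TangentSpace I' (φ x) →ₗ[ℝ] TangentSpace I' (φ x)) ∘ₗ
      (mfderiv I I' φ x : TangentSpace I x →ₗ[ℝ] TangentSpace I' (φ x)))
    (mfderiv I I' φ x : TangentSpace I x →ₗ[ℝ] TangentSpace I' (φ x))

omit [IsManifold I ∞ N] in
theorem pullbackOmega_apply (KM : AlmostKahler I' M) (φ : N → M) (x : N)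
    (v w : TangentSpace I x) :
    pullbackOmega KM φ x v w = KM.omega (φ x) ![mfderiv I I' φ x v, mfderiv I I' φ x w] := by
  rw [KM.omega_eq]; rfl

/-- The metric term is shared with `energyDensity01_eq`, while the symplectic term enters there with
the opposite sign: it cancels in `e' + e''` and is all that remains of `e' - e''`. -/
theorem energyDensity10_eq (KN : AlmostKahler I N) (KM : AlmostKahler I' M) (φ : N → M) (x : N) :
    energyDensity10 KN KM φ x = (1 / 4) * (metricTrace (KN.bilin x) (pullbackMetric KM φ x) +
      KN.contract x (pullbackOmega KM φ x)) :=
  normSq_del _ _ _ _ _ (KN.metric.symm x) (KM.metric.symm _) (KN.J_sq x) (KN.J_isometry x)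
    (KM.J_sq _) (KM.J_isometry _)

theorem energyDensity01_eq (KN : AlmostKahler I N) (KM : AlmostKahler I' M) (φ : N → M) (x : N) :
    energyDensity01 KN KM φ x = (1 / 4) * (metricTrace (KN.bilin x) (pullbackMetric KM φ x) -
      KN.contract x (pullbackOmega KM φ x)) :=
  normSq_delBar _ _ _ _ _ (KN.metric.symm x) (KM.metric.symm _) (KN.J_sq x) (KN.J_isometry x)
    (KM.J_sq _) (KM.J_isometry _)

theorem AlmostKahler.contract_add (K : AlmostKahler I N) (x : N)
    (T T' : LinearMap.BilinForm ℝ (TangentSpace I x)) :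
    K.contract x (T + T') = K.contract x T + K.contract x T' := by
  rw [contract, contract, contract, ← metricTrace_add]
  rfl

theorem AlmostKahler.contract_zero (K : AlmostKahler I N) (x : N) :
    K.contract x 0 = 0 := by
  simpa using K.contract_add x 0 0

end Densities

/-! ### Coordinate frames -/

section Frames

open Complexified

variable {d : ℕ} {H : Type*} [TopologicalSpace H]
  {I : ModelWithCorners ℝ (EuclideanSpace ℝ (Fin d)) H}
  {N : Type*} [TopologicalSpace N] [ChartedSpace H N]

/-- The standard basis vectors of Euclidean space. -/
abbrev stdVec (i : Fin d) : EuclideanSpace ℝ (Fin d) := EuclideanSpace.single i (1 : ℝ)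

variable [IsManifold I ∞ N]

theorem isInvertible_chartSymmDeriv {x₀ : N} {y : EuclideanSpace ℝ (Fin d)}
    (hy : y ∈ (extChartAt I x₀).target) : (chartSymmDeriv I x₀ y).IsInvertible :=
  haveI : IsManifold I 1 N := .of_le (n := ∞) (by simp)
  isInvertible_mfderivWithin_extChartAt_symm hy

/-- The coordinate frame of the chart at `x₀`. -/
def chartFrame {x₀ : N} {y : EuclideanSpace ℝ (Fin d)}
    (hy : y ∈ (extChartAt I x₀).target) :
    Module.Basis (Fin d) ℝ (TangentSpace I ((extChartAt I x₀).symm y)) :=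
  (EuclideanSpace.basisFun (Fin d) ℝ).toBasis.map
    (isInvertible_chartSymmDeriv hy).choose.toLinearEquiv

theorem chartFrame_apply {x₀ : N} {y : EuclideanSpace ℝ (Fin d)}
    (hy : y ∈ (extChartAt I x₀).target) (i : Fin d) :
    chartFrame hy i = chartSymmDeriv I x₀ y (stdVec i) := by
  have h := (isInvertible_chartSymmDeriv hy).choose_spec
  rw [chartFrame, Module.Basis.map_apply, OrthonormalBasis.coe_toBasis,
    EuclideanSpace.basisFun_apply]
  exact congrArg (fun A : EuclideanSpace ℝ (Fin d) →L[ℝ] TangentSpace I _ => A (stdVec i)) h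

theorem toMatrix_chartFrame (g : ContMDiffRiemannianMetric I ∞ (EuclideanSpace ℝ (Fin d))
      (fun x : N => TangentSpace I x)) {x₀ : N} {y : EuclideanSpace ℝ (Fin d)}
    (hy : y ∈ (extChartAt I x₀).target)
    (B : LinearMap.BilinForm ℝ (TangentSpace I ((extChartAt I x₀).symm y)))
    (hB : ∀ v w, B v w = g.inner _ v w) :
    LinearMap.BilinForm.toMatrix (chartFrame hy) B = gramInChart g x₀ y := by
  ext i j
  rw [LinearMap.BilinForm.toMatrix_apply, gramInChart, chartFrame_apply, chartFrame_apply, hB]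
  rfl

/-- A Riemannian metric at a point as a bilinear form. -/
def metricForm (g : ContMDiffRiemannianMetric I ∞ (EuclideanSpace ℝ (Fin d))
      (fun x : N => TangentSpace I x)) (x : N) : LinearMap.BilinForm ℝ (TangentSpace I x) :=
  LinearMap.mk₂ ℝ (fun v w => g.inner x v w) (by simp) (by simp) (by simp) (by simp)

theorem det_gramInChart_pos (g : ContMDiffRiemannianMetric I ∞ (EuclideanSpace ℝ (Fin d))
      (fun x : N => TangentSpace I x)) {x₀ : N} {y : EuclideanSpace ℝ (Fin d)}
    (hy : y ∈ (extChartAt I x₀).target) : 0 < (gramInChart g x₀ y).det := by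
  rw [← toMatrix_chartFrame g hy (metricForm g _) fun _ _ => rfl]
  exact (posDef_toMatrix _ (metricForm g _) (g.symm _) (g.pos _)).det_pos

/-- The coefficients `ω(∂ᵢ, ∂ⱼ)` of the symplectic form in the chart at `x₀`. -/
def omegaInChart (K : AlmostKahler I N) (x₀ : N) (y : EuclideanSpace ℝ (Fin d)) :
    Matrix (Fin d) (Fin d) ℝ :=
  Matrix.of fun i j => K.omega.inChart x₀ y ![stdVec i, stdVec j]

theorem omegaInChart_apply (K : AlmostKahler I N) {x₀ : N} {y : EuclideanSpace ℝ (Fin d)}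
    (hy : y ∈ (extChartAt I x₀).target) (i j : Fin d) :
    omegaInChart K x₀ y i j =
      K.bilin _ (K.J _ (chartFrame hy i)) (chartFrame hy j) := by
  rw [K.bilin_apply, ← K.omega_eq, chartFrame_apply, chartFrame_apply, omegaInChart,
    Matrix.of_apply, DiffForm.inChart, ContinuousAlternatingMap.compContinuousLinearMap_apply]
  congr 1
  ext k
  fin_cases k <;> rfl

theorem omegaInChart_swap (K : AlmostKahler I N) (x₀ : N) (y : EuclideanSpace ℝ (Fin d))
    (i j : Fin d) : omegaInChart K x₀ y i j = -omegaInChart K x₀ y j i := by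
  have := (K.omega.inChart x₀ y).map_swap ![stdVec j, stdVec i] (i := 0) (j := 1) (by simp)
  simp only [omegaInChart, Matrix.of_apply]
  refine Eq.trans ?_ this
  refine congrArg (K.omega.inChart x₀ y) ?_
  ext k
  fin_cases k <;> rfl

theorem isUnit_det_omegaInChart (K : AlmostKahler I N) {x₀ : N} {y : EuclideanSpace ℝ (Fin d)}
    (hy : y ∈ (extChartAt I x₀).target) : IsUnit (omegaInChart K x₀ y).det := by
  refine (metricTrace_compl_eq (chartFrame hy) (K.bilin _) 0 _ _ ?_ (K.J_sq _)
    (omegaInChart_apply K hy)).2.2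
  rw [toMatrix_chartFrame K.metric hy _ fun _ _ => rfl]
  exact (det_gramInChart_pos K.metric hy).ne'.isUnit

/-- `Ω = Qᵀ G` for the matrix `Q` of `J`, and `(det Q)² = 1`. Squaring makes the sign of `det Q`
irrelevant. -/
theorem det_omegaInChart_sq (K : AlmostKahler I N) {x₀ : N} {y : EuclideanSpace ℝ (Fin d)}
    (hy : y ∈ (extChartAt I x₀).target) :
    (omegaInChart K x₀ y).det ^ 2 = (gramInChart K.metric x₀ y).det ^ 2 := by
  have h := toMatrix_chartFrame K.metric hy (K.bilin _) fun _ _ => rfl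
  rw [← h]
  refine (metricTrace_compl_eq (chartFrame hy) (K.bilin _) 0 _ _ ?_ (K.J_sq _)
    (omegaInChart_apply K hy)).2.1
  rw [h]
  exact (det_gramInChart_pos K.metric hy).ne'.isUnit

/-- The contraction with the fundamental bivector in coordinates. -/
theorem contract_eq_sum (K : AlmostKahler I N) {x₀ : N} {y : EuclideanSpace ℝ (Fin d)}
    (hy : y ∈ (extChartAt I x₀).target)
    (T : LinearMap.BilinForm ℝ (TangentSpace I ((extChartAt I x₀).symm y))) :
    K.contract _ T = ∑ i, ∑ j, -((omegaInChart K x₀ y)⁻¹ i j) *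
      T (chartSymmDeriv I x₀ y (stdVec i)) (chartSymmDeriv I x₀ y (stdVec j)) := by
  rw [AlmostKahler.contract, (metricTrace_compl_eq (chartFrame hy) (K.bilin _) T _ _ ?_ (K.J_sq _)
    (omegaInChart_apply K hy)).1]
  · simp only [chartFrame_apply]
  rw [toMatrix_chartFrame K.metric hy _ fun _ _ => rfl]
  exact (det_gramInChart_pos K.metric hy).ne'.isUnit

/-- The trace with respect to the metric in coordinates. -/
theorem metricTrace_eq_sum (K : AlmostKahler I N) {x₀ : N} {y : EuclideanSpace ℝ (Fin d)}
    (hy : y ∈ (extChartAt I x₀).target)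
    (T : LinearMap.BilinForm ℝ (TangentSpace I ((extChartAt I x₀).symm y))) :
    metricTrace (K.bilin _) T = ∑ i, ∑ j, (gramInChart K.metric x₀ y)⁻¹ i j *
      T (chartSymmDeriv I x₀ y (stdVec i)) (chartSymmDeriv I x₀ y (stdVec j)) := by
  rw [metricTrace_eq (chartFrame hy), basisTrace,
    toMatrix_chartFrame K.metric hy _ fun _ _ => rfl]
  simp only [chartFrame_apply]

end Frames

/-! ### Derivatives in charts -/

section ChainRule

variable {F : Type*} [NormedAddCommGroup F] [NormedSpace ℝ F]
  {E : Type*} [NormedAddCommGroup E] [NormedSpace ℝ E]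
  {H : Type*} [TopologicalSpace H] {I : ModelWithCorners ℝ E H}
  {M : Type*} [TopologicalSpace M] [ChartedSpace H M]

variable [IsManifold I 1 M] in
/-- The derivative of a map into a manifold, factored through a chart. -/
theorem mfderivWithin_eq_chartSymmDeriv_comp {f : F → M} {S : Set F} {p : F} {x₁ : M}
    (hf : MDifferentiableWithinAt 𝓘(ℝ, F) I f S p) (hS : UniqueDiffWithinAt ℝ S p)
    (hx : f p ∈ (extChartAt I x₁).source) :
    (show F →L[ℝ] E from mfderivWithin 𝓘(ℝ, F) I f S p) =
      (show E →L[ℝ] E from chartSymmDeriv I x₁ (extChartAt I x₁ (f p))).comp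
        (fderivWithin ℝ (extChartAt I x₁ ∘ f) S p) := by
  have hx' : f p ∈ (chartAt H x₁).source := by rwa [extChartAt_source] at hx
  have h1 : mfderivWithin 𝓘(ℝ, F) 𝓘(ℝ, E) (extChartAt I x₁ ∘ f) S p =
      (mfderiv I 𝓘(ℝ, E) (extChartAt I x₁) (f p)).comp (mfderivWithin 𝓘(ℝ, F) I f S p) :=
    mfderiv_comp_mfderivWithin p (mdifferentiableAt_extChartAt hx') hf hS.uniqueMDiffWithinAt
  have h2 := mfderivWithin_extChartAt_symm_comp_mfderiv_extChartAt' (I := I) hx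
  rw [← mfderivWithin_eq_fderivWithin]
  ext v
  have h3 := congrArg (fun A => A v) h1
  have h4 := congrArg (fun A => A (mfderivWithin 𝓘(ℝ, F) I f S p v)) h2
  refine Eq.trans h4.symm ?_
  exact congrArg (fun u => chartSymmDeriv I x₁ (extChartAt I x₁ (f p)) u) h3.symm

/-- Evaluation of a family of functions on the tangent spaces at equal points. -/
theorem tangent_congr {X : Sort*} (q : ∀ x : M, TangentSpace I x → X) {x x' : M} (h : x = x')
    (v : E) : q x (show TangentSpace I x from v) = q x' (show TangentSpace I x' from v) := by
  subst h; rfl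

/-- All tangent spaces unfold to the model space `E`. This moves fixed vectors of `E` between base
points that are only propositionally equal, such as `x` and the value of a chart inverse at the
coordinates of `x`. -/
theorem tangent_congr₂ {X : Sort*} (q : ∀ x : M, TangentSpace I x → TangentSpace I x → X)
    {x x' : M} (h : x = x') (v w : E) :
    q x (show TangentSpace I x from v) (show TangentSpace I x from w) =
      q x' (show TangentSpace I x' from v) (show TangentSpace I x' from w) := by
  subst h; rfl

/-- A metric applied to the derivative of a smooth map is continuous. -/
theorem continuousOn_inner_mfderivWithin [IsManifold I ∞ M]
    (g : ContMDiffRiemannianMetric I ∞ E (fun x : M => TangentSpace I x))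
    {f : F → M} {S : Set F} (hf : ContMDiffOn 𝓘(ℝ, F) I ∞ f S) (hS : UniqueDiffOn ℝ S) (v w : F) :
    ContinuousOn (fun y => g.inner (f y) (mfderivWithin 𝓘(ℝ, F) I f S y v)
      (mfderivWithin 𝓘(ℝ, F) I f S y w)) S := by
  have htan : ∀ u : F, ContinuousOn (fun y => TotalSpace.mk' E (E := fun x : M => TangentSpace I x)
      (f y) (mfderivWithin 𝓘(ℝ, F) I f S y u)) S := by
    intro u
    have h1 := hf.continuousOn_tangentMapWithin (by simp) hS.uniqueMDiffOn
    have h2 : Continuous (fun y : F => (⟨y, u⟩ : TangentBundle 𝓘(ℝ, F) F)) := by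
      have := (tangentBundleModelSpaceHomeomorph 𝓘(ℝ, F)).symm.continuous.comp
        (Continuous.prodMk continuous_id continuous_const : Continuous fun y : F => (y, u))
      exact this
    exact h1.comp h2.continuousOn fun y hy => hy
  have hg : ContinuousOn (fun y => TotalSpace.mk' (E →L[ℝ] E →L[ℝ] ℝ)
      (E := fun x : M => TangentSpace I x →L[ℝ] TangentSpace I x →L[ℝ] ℝ) (f y) (g.inner (f y))) S :=
    g.contMDiff.continuous.comp_continuousOn hf.continuousOn
  have := ContinuousOn.clm_bundle_apply₂ (F₁ := E) (F₂ := E) (F₃ := ℝ)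
    (E₁ := fun x : M => TangentSpace I x) (E₂ := fun x : M => TangentSpace I x)
    (E₃ := Bundle.Trivial M ℝ) (b := f) (ψ := fun y => g.inner (f y)) hg (htan v) (htan w)
  intro y hy
  have h3 := this y hy
  simp only [FiberBundle.continuousWithinAt_totalSpace] at h3
  exact h3.2

end ChainRule

/-! ### The Riemannian volume in charts -/

section VolumeInCharts

variable {d : ℕ} {H : Type*} [TopologicalSpace H]
  {I : ModelWithCorners ℝ (EuclideanSpace ℝ (Fin d)) H}
  {N : Type*} [TopologicalSpace N] [ChartedSpace H N]

theorem measurableSet_extChartAt_target (x₀ : N) : MeasurableSet (extChartAt I x₀).target := by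
  rw [extChartAt_target]
  exact ((chartAt H x₀).open_target.preimage I.continuous_symm).measurableSet.inter
    I.isClosed_range.measurableSet

theorem uniqueDiffOn_target (x₀ : N) : UniqueDiffOn ℝ (extChartAt I x₀).target :=
  uniqueDiffOn_extChartAt_target x₀

variable [IsManifold I ∞ N]

theorem contMDiffOn_symm (x₀ : N) : ContMDiffOn 𝓘(ℝ, EuclideanSpace ℝ (Fin d)) I ∞
    (extChartAt I x₀).symm (extChartAt I x₀).target :=
  contMDiffOn_extChartAt_symm x₀

theorem chartSymmDeriv_eq {x₀ : N} {y : EuclideanSpace ℝ (Fin d)}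
    (hy : y ∈ (extChartAt I x₀).target) : chartSymmDeriv I x₀ y =
      mfderivWithin 𝓘(ℝ, EuclideanSpace ℝ (Fin d)) I (extChartAt I x₀).symm
        (extChartAt I x₀).target y :=
  (mfderivWithin_subset (extChartAt_target_subset_range x₀)
    (uniqueDiffOn_target x₀ y hy).uniqueMDiffWithinAt
    (mdifferentiableWithinAt_extChartAt_symm hy)).symm

theorem continuousOn_gramInChart (g : ContMDiffRiemannianMetric I ∞ (EuclideanSpace ℝ (Fin d))
      (fun x : N => TangentSpace I x)) (x₀ : N) :
    ContinuousOn (gramInChart g x₀) (extChartAt I x₀).target := by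
  refine continuousOn_pi.2 fun i => continuousOn_pi.2 fun j => ?_
  refine (continuousOn_inner_mfderivWithin g (contMDiffOn_symm x₀) (uniqueDiffOn_target x₀)
    (stdVec i) (stdVec j)).congr fun y hy => ?_
  simp only [gramInChart, Matrix.of_apply]
  rw [chartSymmDeriv_eq hy]
  rfl

theorem continuousOn_sqrt_det_gramInChart
    (g : ContMDiffRiemannianMetric I ∞ (EuclideanSpace ℝ (Fin d))
      (fun x : N => TangentSpace I x)) (x₀ : N) :
    ContinuousOn (fun y => Real.sqrt (gramInChart g x₀ y).det) (extChartAt I x₀).target := by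
  refine Real.continuous_sqrt.comp_continuousOn ?_
  exact (continuous_id.matrix_det).comp_continuousOn (continuousOn_gramInChart g x₀)

/-- Coordinate fields transform by the Jacobian matrix `P` of the transition map, so `G₀ = Pᵀ G₁ P`;
the square root of the determinant acquires exactly the factor `|det P|` of the change of variables
formula. -/
theorem gramInChart_change (g : ContMDiffRiemannianMetric I ∞ (EuclideanSpace ℝ (Fin d))
      (fun x : N => TangentSpace I x)) {x₀ x₁ : N} {y : EuclideanSpace ℝ (Fin d)}
    (hy : y ∈ (extChartAt I x₀).target) (hy' : (extChartAt I x₀).symm y ∈ (extChartAt I x₁).source) :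
    Real.sqrt (gramInChart g x₀ y).det =
      |(fderivWithin ℝ (extChartAt I x₁ ∘ (extChartAt I x₀).symm) (extChartAt I x₀).target y).det| *
      Real.sqrt (gramInChart g x₁ (extChartAt I x₁ ((extChartAt I x₀).symm y))).det := by
  set A := fderivWithin ℝ (extChartAt I x₁ ∘ (extChartAt I x₀).symm) (extChartAt I x₀).target y
  set b := (EuclideanSpace.basisFun (Fin d) ℝ).toBasis
  set P := LinearMap.toMatrix b b (A : EuclideanSpace ℝ (Fin d) →ₗ[ℝ] EuclideanSpace ℝ (Fin d))
  set z := extChartAt I x₁ ((extChartAt I x₀).symm y)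
  have h1 := mfderivWithin_eq_chartSymmDeriv_comp (I := I) (x₁ := x₁)
    ((contMDiffOn_symm (I := I) x₀ y hy).mdifferentiableWithinAt (by simp))
    (uniqueDiffOn_target x₀ y hy) hy'
  rw [← chartSymmDeriv_eq hy] at h1
  have hA : ∀ i, A (stdVec i) = ∑ k, P k i • stdVec k := by
    intro i
    have := (b.sum_repr (A (stdVec i))).symm
    rw [this]
    refine Finset.sum_congr rfl fun k _ => ?_
    simp [P, LinearMap.toMatrix_apply, b, stdVec]
  have hG : gramInChart g x₀ y = P.transpose * gramInChart g x₁ z * P := by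
    ext i j
    have h2 : ∀ i, (show EuclideanSpace ℝ (Fin d) from chartSymmDeriv I x₀ y (stdVec i)) =
        (show EuclideanSpace ℝ (Fin d) from chartSymmDeriv I x₁ z (A (stdVec i))) :=
      fun i => congrArg (fun B => B (stdVec i)) h1
    have h3 : gramInChart g x₀ y i j = g.inner _ (chartSymmDeriv I x₁ z (A (stdVec i)))
        (chartSymmDeriv I x₁ z (A (stdVec j))) := by
      refine Eq.trans ?_ (tangent_congr₂ (fun x v w => g.inner x v w)
        ((extChartAt I x₁).left_inv hy').symm
        (show EuclideanSpace ℝ (Fin d) from chartSymmDeriv I x₁ z (A (stdVec i)))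
        (show EuclideanSpace ℝ (Fin d) from chartSymmDeriv I x₁ z (A (stdVec j))))
      rw [← h2, ← h2]
      rfl
    rw [h3, hA, hA]
    simp only [map_sum, map_smul, Matrix.mul_apply, Matrix.transpose_apply, gramInChart,
      Matrix.of_apply, Finset.sum_mul, sum_apply, smul_apply, smul_eq_mul, Finset.mul_sum, stdVec]
    refine Finset.sum_congr rfl fun k _ => Finset.sum_congr rfl fun l _ => by ring
  have hdet : A.det = P.det := (LinearMap.det_toMatrix b _).symm
  rw [hG, Matrix.det_mul, Matrix.det_mul, Matrix.det_transpose, hdet,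
    show P.det * (gramInChart g x₁ z).det * P.det = P.det ^ 2 * (gramInChart g x₁ z).det by ring,
    Real.sqrt_mul (sq_nonneg _), Real.sqrt_sq_eq_abs]

variable [MeasurableSpace N] [BorelSpace N]

omit [IsManifold I ∞ N] in
theorem aemeasurable_symm (x₀ : N) : AEMeasurable (extChartAt I x₀).symm
    ((volume : Measure (EuclideanSpace ℝ (Fin d))).restrict (extChartAt I x₀).target) :=
  (continuousOn_extChartAt_symm x₀).aemeasurable (measurableSet_extChartAt_target x₀)

theorem chartVolume_apply (g : ContMDiffRiemannianMetric I ∞ (EuclideanSpace ℝ (Fin d))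
      (fun x : N => TangentSpace I x)) (x₀ : N) {s : Set N} (hs : MeasurableSet s) :
    chartVolume g x₀ s = ∫⁻ y in (extChartAt I x₀).symm ⁻¹' s ∩ (extChartAt I x₀).target,
      ENNReal.ofReal (Real.sqrt (gramInChart g x₀ y).det) := by
  have hn := (aemeasurable_symm (I := I) x₀).nullMeasurable hs
  rw [chartVolume, Measure.map_apply_of_aemeasurable
    ((aemeasurable_symm x₀).mono_ac (withDensity_absolutelyContinuous _ _)) hs,
    withDensity_apply', Measure.restrict_restrict₀ hn]

omit [IsManifold I ∞ N] in
theorem measurableSet_symm_preimage_inter (x₀ : N) {s : Set N} (hs : MeasurableSet s) :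
    MeasurableSet ((extChartAt I x₀).symm ⁻¹' s ∩ (extChartAt I x₀).target) := by
  have h := (continuousOn_iff_continuous_domRestrict.1
    (continuousOn_extChartAt_symm (I := I) x₀)).measurable hs
  have h2 := (measurableSet_extChartAt_target (I := I) x₀).subtype_image h
  convert h2 using 1
  ext y
  simp

/-- The transition map carries one coordinate integral into the other. The change of variables
formula needs only derivatives within the measurable set, so boundary points require no separate
treatment. -/
theorem chartVolume_eq_of_subset (g : ContMDiffRiemannianMetric I ∞ (EuclideanSpace ℝ (Fin d))
      (fun x : N => TangentSpace I x)) (x₀ x₁ : N) {s : Set N} (hs : MeasurableSet s)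
    (h₀ : s ⊆ (extChartAt I x₀).source) (h₁ : s ⊆ (extChartAt I x₁).source) :
    chartVolume g x₁ s = chartVolume g x₀ s := by
  rw [chartVolume_apply g x₀ hs, chartVolume_apply g x₁ hs]
  set A₀ := (extChartAt I x₀).symm ⁻¹' s ∩ (extChartAt I x₀).target with hA₀
  set τ := extChartAt I x₁ ∘ (extChartAt I x₀).symm with hτ
  have himg : (extChartAt I x₁).symm ⁻¹' s ∩ (extChartAt I x₁).target = τ '' A₀ := by
    ext z
    constructor
    · rintro ⟨hz, hz'⟩
      refine ⟨extChartAt I x₀ ((extChartAt I x₁).symm z), ⟨?_, ?_⟩, ?_⟩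
      · rw [mem_preimage, (extChartAt I x₀).left_inv (h₀ hz)]
        exact hz
      · exact (extChartAt I x₀).map_source (h₀ hz)
      · rw [hτ, Function.comp_apply, (extChartAt I x₀).left_inv (h₀ hz),
          (extChartAt I x₁).right_inv hz']
    · rintro ⟨y, ⟨hy, hy'⟩, rfl⟩
      refine ⟨?_, (extChartAt I x₁).map_source (h₁ hy)⟩
      rw [mem_preimage, hτ, Function.comp_apply, (extChartAt I x₁).left_inv (h₁ hy)]
      exact hy
  have hinj : InjOn τ A₀ := by
    intro y hy y' hy' h
    have := (extChartAt I x₁).injOn (h₁ hy.1) (h₁ hy'.1) h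
    exact (extChartAt I x₀).symm.injOn hy.2 hy'.2 this
  have hder : ∀ y ∈ A₀, HasFDerivWithinAt τ (fderivWithin ℝ τ (extChartAt I x₀).target y) A₀ y := by
    intro y hy
    have h2 : ContMDiffWithinAt 𝓘(ℝ, EuclideanSpace ℝ (Fin d)) 𝓘(ℝ, EuclideanSpace ℝ (Fin d)) ∞
        τ (extChartAt I x₀).target y :=
      (contMDiffAt_extChartAt' (by simpa using h₁ hy.1)).comp_contMDiffWithinAt y
        (contMDiffOn_symm (I := I) x₀ y hy.2)
    exact ((contMDiffWithinAt_iff_contDiffWithinAt.1 h2).differentiableWithinAt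
      (by simp)).hasFDerivWithinAt.mono inter_subset_right
  have hmeas := measurableSet_symm_preimage_inter (I := I) x₀ hs
  rw [himg, lintegral_image_eq_lintegral_abs_det_fderiv_mul volume hmeas hder hinj]
  refine setLIntegral_congr_fun hmeas fun y hy => ?_
  rw [gramInChart_change g hy.2 (h₁ hy.1), ENNReal.ofReal_mul (abs_nonneg _)]
  rfl

theorem riemannianVolume_restrict (g : ContMDiffRiemannianMetric I ∞ (EuclideanSpace ℝ (Fin d))
      (fun x : N => TangentSpace I x)) (x₀ : N) :
    (riemannianVolume g).restrict (extChartAt I x₀).source = chartVolume g x₀ := by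
  have hsrc : ∀ x : N, MeasurableSet (extChartAt I x).source := fun x =>
    (isOpen_extChartAt_source x).measurableSet
  have hcompl : ∀ x : N, ∀ s, MeasurableSet s →
      chartVolume g x s = chartVolume g x (s ∩ (extChartAt I x).source) := by
    intro x s hs
    rw [chartVolume_apply g x hs, chartVolume_apply g x (hs.inter (hsrc x))]
    congr 2
    ext y
    simp only [mem_inter_iff, mem_preimage]
    exact ⟨fun h => ⟨⟨h.1, (extChartAt I x).map_target h.2⟩, h.2⟩, fun h => ⟨h.1.1, h.2⟩⟩
  apply le_antisymm
  -- A supremum of measures is not taken set by set, so an explicit upper bound is used: `ν` is the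
  -- chart measure on the chart domain and the supremum itself on the complement. It dominates each
  -- chart measure, hence their supremum.
  · let ν : Measure N := chartVolume g x₀ +
      (riemannianVolume g).restrict (extChartAt I x₀).sourceᶜ
    have hle : riemannianVolume g ≤ ν := by
      refine iSup_le fun x => Measure.le_iff.2 fun s hs => ?_
      rw [← measure_inter_add_sdiff s (hsrc x₀)]
      refine add_le_add ?_ ?_
      · have hm := (hs.inter (hsrc x₀)).inter (hsrc x)
        rw [hcompl x _ (hs.inter (hsrc x₀)), chartVolume_eq_of_subset g x₀ x hm
          (fun y hy => hy.1.2) inter_subset_right]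
        exact measure_mono fun y hy => hy.1.1
      · change _ ≤ (riemannianVolume g).restrict (extChartAt I x₀).sourceᶜ s
        rw [Measure.restrict_apply hs, ← sdiff_eq]
        exact (le_iSup (fun x => chartVolume g x) x) _
    refine Measure.le_iff.2 fun s hs => ?_
    rw [Measure.restrict_apply hs]
    refine (hle _).trans ?_
    have : (riemannianVolume g).restrict (extChartAt I x₀).sourceᶜ
        (s ∩ (extChartAt I x₀).source) = 0 := by
      rw [Measure.restrict_apply (hs.inter (hsrc x₀))]
      simp [inter_assoc]
    rw [Measure.add_apply, this, add_zero]
    exact measure_mono inter_subset_left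
  · refine Measure.le_iff.2 fun s hs => ?_
    rw [Measure.restrict_apply hs, hcompl x₀ s hs]
    exact (le_iSup (fun x => chartVolume g x) x₀) _

end VolumeInCharts

/-! ### Integration against the Riemannian volume and its finiteness. -/

section VolumeIntegrals

variable {d : ℕ} {H : Type*} [TopologicalSpace H]
  {I : ModelWithCorners ℝ (EuclideanSpace ℝ (Fin d)) H}
  {N : Type*} [TopologicalSpace N] [ChartedSpace H N] [IsManifold I ∞ N]
  [MeasurableSpace N] [BorelSpace N]

omit [IsManifold I ∞ N] [MeasurableSpace N] [BorelSpace N] in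
/-- Continuity can be checked in a chart. -/
theorem continuousOn_source_of_comp_symm {X : Type*} [TopologicalSpace X] {f : N → X} {x₀ : N}
    (hf : ContinuousOn (fun y => f ((extChartAt I x₀).symm y)) (extChartAt I x₀).target) :
    ContinuousOn f (extChartAt I x₀).source :=
  (hf.comp (continuousOn_extChartAt x₀) fun _ hx => (extChartAt I x₀).map_source hx).congr
    fun x hx => by rw [Function.comp_apply, (extChartAt I x₀).left_inv hx]

/-- Integrals over `N` of functions supported in the domain of a chart. -/
theorem integral_riemannianVolume_of_support
    (g : ContMDiffRiemannianMetric I ∞ (EuclideanSpace ℝ (Fin d))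
      (fun x : N => TangentSpace I x)) (x₀ : N) {f : N → ℝ}
    (hf : ContinuousOn (fun y => f ((extChartAt I x₀).symm y)) (extChartAt I x₀).target)
    (hf0 : ∀ x ∉ (extChartAt I x₀).source, f x = 0) :
    (Integrable f (riemannianVolume g) ↔
      IntegrableOn (fun y => Real.sqrt (gramInChart g x₀ y).det * f ((extChartAt I x₀).symm y))
        (extChartAt I x₀).target) ∧
    ∫ x, f x ∂(riemannianVolume g) = ∫ y in (extChartAt I x₀).target,
      Real.sqrt (gramInChart g x₀ y).det * f ((extChartAt I x₀).symm y) := by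
  set T := (extChartAt I x₀).target
  have hT : MeasurableSet T := measurableSet_extChartAt_target x₀
  have hsrc : MeasurableSet (extChartAt I x₀).source :=
    (isOpen_extChartAt_source x₀).measurableSet
  have hdens : AEMeasurable (fun y => (Real.sqrt (gramInChart g x₀ y).det).toNNReal)
      ((volume : Measure (EuclideanSpace ℝ (Fin d))).restrict T) :=
    ((continuousOn_sqrt_det_gramInChart g x₀).aemeasurable hT).real_toNNReal
  have hae : AEMeasurable (extChartAt I x₀).symm
      (((volume : Measure (EuclideanSpace ℝ (Fin d))).restrict T).withDensity
        (fun y => ENNReal.ofReal (Real.sqrt (gramInChart g x₀ y).det))) :=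
    (aemeasurable_symm x₀).mono_ac (withDensity_absolutelyContinuous _ _)
  have hmeas : AEStronglyMeasurable f (chartVolume g x₀) := by
    rw [← riemannianVolume_restrict]
    exact (continuousOn_source_of_comp_symm hf).aestronglyMeasurable hsrc
  constructor
  · rw [← integrableOn_iff_integrable_of_support_subset (s := (extChartAt I x₀).source)
      (fun x hx => by_contra fun h => hx (hf0 x h)), IntegrableOn, riemannianVolume_restrict]
    unfold chartVolume at hmeas ⊢
    rw [integrable_map_measure hmeas hae]
    simp only [ENNReal.ofReal] at hae ⊢
    rw [integrable_withDensity_iff_integrable_smul₀ hdens]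
    refine integrable_congr (Filter.Eventually.of_forall fun y => ?_)
    simp [NNReal.smul_def, Real.coe_toNNReal _ (Real.sqrt_nonneg _)]
  · rw [← setIntegral_eq_integral_of_forall_compl_eq_zero hf0, riemannianVolume_restrict]
    unfold chartVolume at hmeas ⊢
    rw [integral_map hae hmeas]
    simp only [ENNReal.ofReal] at hae ⊢
    rw [integral_withDensity_eq_integral_smul₀ hdens]
    refine integral_congr_ae (Filter.Eventually.of_forall fun y => ?_)
    simp [NNReal.smul_def, Real.coe_toNNReal _ (Real.sqrt_nonneg _)]

/-- The density is continuous, hence integrable on a compact piece of the chart target around a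
given point. So the measure is locally finite, and compactness of `N` does the rest. -/
theorem isFiniteMeasure_riemannianVolume [CompactSpace N]
    (g : ContMDiffRiemannianMetric I ∞ (EuclideanSpace ℝ (Fin d))
      (fun x : N => TangentSpace I x)) : IsFiniteMeasure (riemannianVolume g) := by
  have : IsLocallyFiniteMeasure (riemannianVolume g) := by
    refine ⟨fun x => ?_⟩
    obtain ⟨ε, hε, hsub⟩ := Metric.mem_nhdsWithin_iff.1 (extChartAt_target_mem_nhdsWithin (I := I) x)
    set K := Metric.closedBall (extChartAt I x x) (ε / 2) ∩ range I
    have hK : IsCompact K := (isCompact_closedBall _ _).inter_right I.isClosed_range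
    have hKT : K ⊆ (extChartAt I x).target := fun y hy =>
      hsub ⟨Metric.closedBall_subset_ball (by linarith) hy.1, hy.2⟩
    set U := (extChartAt I x).source ∩ extChartAt I x ⁻¹' Metric.ball (extChartAt I x x) (ε / 2)
    have hUo : IsOpen U := (continuousOn_extChartAt x).isOpen_inter_preimage
      (isOpen_extChartAt_source x) Metric.isOpen_ball
    refine ⟨U, hUo.mem_nhds ⟨mem_extChartAt_source x, Metric.mem_ball_self (by linarith)⟩, ?_⟩
    have h1 : riemannianVolume g U = chartVolume g x U := by
      rw [← riemannianVolume_restrict, Measure.restrict_apply hUo.measurableSet,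
        inter_eq_left.2 inter_subset_left]
    have hint : IntegrableOn (fun y => Real.sqrt (gramInChart g x y).det) K :=
      ((continuousOn_sqrt_det_gramInChart g x).mono hKT).integrableOn_compact hK
    rw [h1, chartVolume_apply g x hUo.measurableSet]
    refine lt_of_le_of_lt (lintegral_mono_set ?_) hint.lintegral_lt_top
    rintro y ⟨hy, hy'⟩
    refine ⟨?_, extChartAt_target_subset_range x hy'⟩
    have := hy.2
    rw [mem_preimage, (extChartAt I x).right_inv hy'] at this
    exact Metric.ball_subset_closedBall this
  infer_instance

end VolumeIntegrals

/-! ### Matrix calculus and the divergence of the fundamental bivector -/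

section MatrixCalculus

variable {ι : Type*} [Fintype ι] [DecidableEq ι]

theorem contDiff_det {n : WithTop ℕ∞} :
    ContDiff ℝ n (fun M : ι → ι → ℝ => Matrix.det (Matrix.of M)) := by
  simp only [Matrix.det_apply]
  refine ContDiff.sum fun σ _ => ContDiff.const_smul _ (contDiff_prod fun i _ => ?_)
  simp only [Matrix.of_apply]
  fun_prop

/-- Jacobi's formula for the derivative of the determinant at an invertible matrix. -/
theorem fderiv_det (M V : ι → ι → ℝ) (hM : IsUnit (Matrix.of M).det) :
    fderiv ℝ (fun M : ι → ι → ℝ => Matrix.det (Matrix.of M)) M V =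
      (Matrix.of M).det * ((Matrix.of M)⁻¹ * Matrix.of V).trace := by
  have h1 : HasDerivAt (fun t : ℝ => Matrix.det (Matrix.of (M + t • V)))
      (fderiv ℝ (fun M : ι → ι → ℝ => Matrix.det (Matrix.of M)) M V) 0 := by
    have hd : HasFDerivAt (fun M : ι → ι → ℝ => Matrix.det (Matrix.of M))
        (fderiv ℝ (fun M : ι → ι → ℝ => Matrix.det (Matrix.of M)) M) (M + (0 : ℝ) • V) := by
      rw [zero_smul, add_zero]
      exact ((contDiff_det (n := 1)).differentiable (by simp) M).hasFDerivAt
    have hl : HasDerivAt (fun t : ℝ => M + t • V) V 0 := by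
      simpa using ((hasDerivAt_id (0 : ℝ)).smul_const V).const_add M
    exact hd.comp_hasDerivAt (0 : ℝ) hl
  -- Factoring `M + tV = M(1 + t M⁻¹V)` reduces the claim to the linear coefficient of the
  -- polynomial `det(1 + X A)`, which is `tr A`.
  have h2 : ∀ t : ℝ, Matrix.det (Matrix.of (M + t • V)) = (Matrix.of M).det *
      (Polynomial.eval t (1 + (Polynomial.X : Polynomial ℝ) •
        ((Matrix.of M)⁻¹ * Matrix.of V).map Polynomial.C).det) := by
    intro t
    have h3 : Matrix.of (M + t • V) =
        Matrix.of M * (1 + t • ((Matrix.of M)⁻¹ * Matrix.of V)) := by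
      rw [Matrix.mul_add, Matrix.mul_one, Matrix.mul_smul, Matrix.mul_nonsing_inv_cancel_left _ _ hM]
      rfl
    rw [h3, Matrix.det_mul]
    congr 1
    rw [← Polynomial.coe_evalRingHom, RingHom.map_det]
    congr 1
    generalize (Matrix.of M)⁻¹ * Matrix.of V = A
    ext i j
    simp [Matrix.one_apply, apply_ite]
    exact mul_comm _ _
  simp only [h2] at h1
  have h4 := ((1 + (Polynomial.X : Polynomial ℝ) •
        ((Matrix.of M)⁻¹ * Matrix.of V).map Polynomial.C).det.hasDerivAt 0).const_mul
        (Matrix.of M).det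
  rw [Matrix.derivative_det_one_add_X_smul] at h4
  exact h1.unique h4

omit [DecidableEq ι] in
/-- The cyclic identity for a closed `2`-form, contracted with the inverse matrix. -/
theorem sum_cyclic_eq (Q : Matrix ι ι ℝ) (W : ι → Matrix ι ι ℝ)
    (hQ : ∀ i j, Q i j = -Q j i) (hW : ∀ k i j, W k i j = -W k j i)
    (hcyc : ∀ i a b, W i a b + W a b i + W b i a = 0) (j : ι) :
    ∑ i, ((1 / 2 : ℝ) * (Q * W i).trace * Q i j - (Q * W i * Q) i j) = 0 := by
  -- On contracting the cyclic identity with `Q`, antisymmetry makes the first two terms equal and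
  -- turns the third into minus the trace.
  have hc : ∀ b, ∑ i, ∑ a, Q i a * W i a b = (1 / 2 : ℝ) * (Q * W b).trace := by
    intro b
    have h1 : ∑ i, ∑ a, Q i a * W a b i = ∑ i, ∑ a, Q i a * W i a b := by
      rw [Finset.sum_comm]
      refine Finset.sum_congr rfl fun i _ => Finset.sum_congr rfl fun a _ => ?_
      rw [hQ, hW]
      ring
    have h2 : ∑ i, ∑ a, (Q i a * W i a b + Q i a * W a b i + Q i a * W b i a) = 0 := by
      refine Finset.sum_eq_zero fun i _ => Finset.sum_eq_zero fun a _ => ?_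
      rw [← mul_add, ← mul_add, hcyc, mul_zero]
    simp only [Finset.sum_add_distrib] at h2
    rw [h1] at h2
    have h3 : (Q * W b).trace = -∑ i, ∑ a, Q i a * W b i a := by
      rw [Matrix.trace, ← Finset.sum_neg_distrib]
      refine Finset.sum_congr rfl fun i _ => ?_
      rw [Matrix.diag_apply, Matrix.mul_apply, ← Finset.sum_neg_distrib]
      refine Finset.sum_congr rfl fun a _ => ?_
      rw [hW]
      ring
    rw [h3]
    linarith
  rw [Finset.sum_sub_distrib, sub_eq_zero]
  simp only [← hc]
  simp only [Matrix.mul_apply, Finset.sum_mul]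
  symm
  calc ∑ i, ∑ b, ∑ a, Q i a * W i a b * Q b j
      = ∑ b, ∑ i, ∑ a, Q i a * W i a b * Q b j := Finset.sum_comm
    _ = _ := rfl

variable {E : Type*} [NormedAddCommGroup E] [NormedSpace ℝ E]

theorem contDiffOn_matrix_det {n : WithTop ℕ∞} {T : Set E} {Ω : E → Matrix ι ι ℝ}
    (hΩ : ∀ i j, ContDiffOn ℝ n (fun y => Ω y i j) T) : ContDiffOn ℝ n (fun y => (Ω y).det) T :=
  contDiff_det.comp_contDiffOn (f := fun y i j => Ω y i j)
    (contDiffOn_pi.2 fun i => contDiffOn_pi.2 fun j => hΩ i j)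

/-- Cramer's rule: each entry of the adjugate is the determinant of a matrix whose entries are
constants or entries of `Ω`. -/
theorem contDiffOn_matrix_inv {n : WithTop ℕ∞} {T : Set E} {Ω : E → Matrix ι ι ℝ}
    (hΩ : ∀ i j, ContDiffOn ℝ n (fun y => Ω y i j) T) (hu : ∀ y ∈ T, IsUnit (Ω y).det) (i j : ι) :
    ContDiffOn ℝ n (fun y => (Ω y)⁻¹ i j) T := by
  simp only [Matrix.inv_def, Ring.inverse_eq_inv', Matrix.smul_apply, smul_eq_mul,
    Matrix.adjugate_apply]
  refine ContDiffOn.mul ((contDiffOn_matrix_det hΩ).inv fun y hy => (hu y hy).ne_zero)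
    (contDiffOn_matrix_det fun k l => ?_)
  simp only [Matrix.updateRow_apply]
  split_ifs
  · exact contDiffOn_const
  · exact hΩ k l

/-- For a closed nondegenerate `2`-form `Ω` with volume density `s`, the bivector density
`s Ω⁻¹` is divergence free. -/
theorem sum_fderivWithin_density_mul_inv {T : Set E} (hT : UniqueDiffOn ℝ T)
    {Ω : E → Matrix ι ι ℝ} {s : E → ℝ} (hΩ : ∀ i j, ContDiffOn ℝ 1 (fun y => Ω y i j) T)
    (hu : ∀ y ∈ T, IsUnit (Ω y).det) (hanti : ∀ y ∈ T, ∀ i j, Ω y i j = -Ω y j i)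
    (hs : ContDiffOn ℝ 1 s T) (hs0 : ∀ y ∈ T, 0 < s y) (hs4 : ∀ y ∈ T, s y ^ 4 = (Ω y).det ^ 2)
    (e : ι → E) {y : E} (hy : y ∈ T)
    (hcyc : ∀ i a b, fderivWithin ℝ (fun y => Ω y a b) T y (e i) +
      fderivWithin ℝ (fun y => Ω y b i) T y (e a) +
      fderivWithin ℝ (fun y => Ω y i a) T y (e b) = 0) (j : ι) :
    ∑ i, fderivWithin ℝ (fun y => s y * (Ω y)⁻¹ i j) T y (e i) = 0 := by
  have hy' := hT y hy
  have dΩ : ∀ i j, DifferentiableWithinAt ℝ (fun y => Ω y i j) T y := fun i j =>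
    (hΩ i j).differentiableOn (by simp) y hy
  have dQ : ∀ i j, DifferentiableWithinAt ℝ (fun y => (Ω y)⁻¹ i j) T y := fun i j =>
    (contDiffOn_matrix_inv hΩ hu i j).differentiableOn (by simp) y hy
  have ds := hs.differentiableOn (by simp) y hy
  have dD := (contDiffOn_matrix_det hΩ).differentiableOn (by simp) y hy
  set Q := (Ω y)⁻¹ with hQdef
  set W : E → Matrix ι ι ℝ := fun v => Matrix.of fun a b =>
    fderivWithin ℝ (fun y => Ω y a b) T y v with hW
  have hdet : ∀ v, fderivWithin ℝ (fun y => (Ω y).det) T y v =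
      (Ω y).det * (Q * W v).trace := by
    intro v
    have h1 : HasFDerivWithinAt (fun y => (fun i j => Ω y i j : ι → ι → ℝ))
        (ContinuousLinearMap.pi fun i => ContinuousLinearMap.pi fun j =>
          fderivWithin ℝ (fun y => Ω y i j) T y) T y :=
      hasFDerivWithinAt_pi.2 fun i => hasFDerivWithinAt_pi.2 fun j => (dΩ i j).hasFDerivWithinAt
    have h2 := (((contDiff_det (ι := ι) (n := 1)).differentiable (by simp)
      (fun i j => Ω y i j)).hasFDerivAt).comp_hasFDerivWithinAt y h1
    have h3 := h2.fderivWithin hy'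
    have h4 := fderiv_det (fun i j => Ω y i j) (fun i j => W v i j) (hu y hy)
    refine Eq.trans ?_ h4
    exact congrArg (fun A => A v) h3
  -- Differentiating `s⁴ = (det Ω)²` with Jacobi's formula gives `4 s³ ds = 2 s⁴ tr(Q W)`. The
  -- fourth power dispenses with the sign of `det Ω`.
  have hds : ∀ v, fderivWithin ℝ s T y v = (1 / 2 : ℝ) * (Q * W v).trace * s y := by
    intro v
    have h1 : HasFDerivWithinAt (fun y => s y ^ 4) _ T y := ds.hasFDerivWithinAt.pow 4
    have h2 : HasFDerivWithinAt (fun y => (Ω y).det ^ 2) _ T y := dD.hasFDerivWithinAt.pow 2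
    have h3 := hy'.eq (h1.congr (fun z hz => (hs4 z hz).symm) (hs4 y hy).symm) h2
    have h4 := congrArg (fun A => A v) h3
    simp at h4
    rw [hdet] at h4
    have hp := hs0 y hy
    have h5 := hs4 y hy
    have : s y ^ 3 * (4 * fderivWithin ℝ s T y v) =
        s y ^ 3 * (4 * ((1 / 2 : ℝ) * (Q * W v).trace * s y)) := by
      linear_combination h4 - 2 * (Q * W v).trace * h5
    have := mul_left_cancel₀ (pow_pos hp 3).ne' this
    linarith
  have hdQ : ∀ v i j, fderivWithin ℝ (fun y => (Ω y)⁻¹ i j) T y v = -(Q * W v * Q) i j := by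
    intro v
    set R : Matrix ι ι ℝ := Matrix.of fun i j => fderivWithin ℝ (fun y => (Ω y)⁻¹ i j) T y v with hR
    -- The derivative of the constant matrix `Ω Ω⁻¹ = 1`, entry by entry.
    have h1 : Ω y * R + W v * Q = 0 := by
      ext i j
      have h2 : HasFDerivWithinAt (fun y => ∑ k, Ω y i k * (Ω y)⁻¹ k j) _ T y :=
        HasFDerivWithinAt.fun_sum fun k _ =>
          (dΩ i k).hasFDerivWithinAt.mul (dQ k j).hasFDerivWithinAt
      have h3 : HasFDerivWithinAt (fun y => ∑ k, Ω y i k * (Ω y)⁻¹ k j) (0 : E →L[ℝ] ℝ) T y := by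
        refine (hasFDerivWithinAt_const ((1 : Matrix ι ι ℝ) i j) y T).congr
          (fun z hz => ?_) ?_
        · rw [← Matrix.mul_apply, Matrix.mul_nonsing_inv _ (hu z hz)]
        · rw [← Matrix.mul_apply, Matrix.mul_nonsing_inv _ (hu y hy)]
      have h4 := congrArg (fun A => A v) (hy'.eq h2 h3)
      simp only [sum_apply, add_apply, smul_apply, smul_eq_mul] at h4
      rw [Matrix.add_apply, Matrix.mul_apply, Matrix.mul_apply, Matrix.zero_apply,
        ← Finset.sum_add_distrib]
      refine Eq.trans ?_ h4
      refine Finset.sum_congr rfl fun k _ => ?_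
      simp only [hR, hW, Matrix.of_apply, hQdef]
      ring
    have h5 : R = -(Q * W v * Q) := by
      have h6 := congrArg (fun A => Q * A) h1
      simp only [Matrix.mul_add, Matrix.mul_zero, hQdef] at h6
      rw [Matrix.nonsing_inv_mul_cancel_left _ _ (hu y hy)] at h6
      rw [eq_neg_iff_add_eq_zero, Matrix.mul_assoc]
      exact h6
    intro i j
    rw [← Matrix.neg_apply, ← h5]
    rfl
  have hQa : ∀ i j, Q i j = -Q j i := by
    have h1 : (Ω y).transpose = -Ω y := by
      ext i j
      rw [Matrix.transpose_apply, hanti y hy]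
      rfl
    have h2 : Q.transpose = -Q := by
      rw [hQdef, Matrix.transpose_nonsing_inv, h1]
      refine Matrix.inv_eq_right_inv ?_
      rw [neg_mul_neg, Matrix.mul_nonsing_inv _ (hu y hy)]
    intro i j
    rw [← Matrix.neg_apply, ← h2, Matrix.transpose_apply]
  have hWa : ∀ k i j, W (e k) i j = -W (e k) j i := by
    intro k i j
    have h1 : fderivWithin ℝ (fun y => Ω y i j) T y = -fderivWithin ℝ (fun y => Ω y j i) T y := by
      rw [← fderivWithin_fun_neg hy']
      exact fderivWithin_congr (fun z hz => hanti z hz i j) (hanti y hy i j)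
    simp only [hW, Matrix.of_apply, h1]
    rfl
  -- By the product rule `∂ᵢ(s Qᵢⱼ) = s (½ tr(Q Wᵢ) Qᵢⱼ - (Q Wᵢ Q)ᵢⱼ)`, whose sum over `i` is `s`
  -- times the contracted cyclic identity.
  have key := sum_cyclic_eq Q (fun i => W (e i)) hQa hWa hcyc j
  rw [← mul_zero (s y), ← key, Finset.mul_sum]
  refine Finset.sum_congr rfl fun i _ => ?_
  rw [fderivWithin_fun_mul hy' ds (dQ i j)]
  simp only [add_apply, smul_apply, smul_eq_mul]
  rw [hds, hdQ]
  ring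

end MatrixCalculus

/-! ### The divergence theorem on the half-space -/

section HalfSpace

variable {d : ℕ}

theorem eventuallyEq_zero_of_notMem {X : Type*} [TopologicalSpace X] {K S : Set X}
    (hK : IsClosed K) {V : X → ℝ} (hV : ∀ y ∈ S, y ∉ K → V y = 0) {y : X} (hyK : y ∉ K) :
    V =ᶠ[𝓝[S] y] fun _ => 0 := by
  filter_upwards [self_mem_nhdsWithin, mem_nhdsWithin_of_mem_nhds (hK.isOpen_compl.mem_nhds hyK)]
    with z hz hz' using hV z hz hz'

/-- The divergence theorem for a compactly supported vector field on the half-space which is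
tangent to the boundary. -/
theorem integral_divergence_halfSpace [NeZero d]
    {V : Fin d → EuclideanSpace ℝ (Fin d) → ℝ} {S K : Set (EuclideanSpace ℝ (Fin d))}
    (hS : S = {y | 0 ≤ y 0}) (hSu : UniqueDiffOn ℝ S) (hV : ∀ i, ContDiffOn ℝ 1 (V i) S)
    (hK : IsCompact K) (hVK : ∀ i, ∀ y ∈ S, y ∉ K → V i y = 0)
    (h0 : ∀ y : EuclideanSpace ℝ (Fin d), y 0 = 0 → V 0 y = 0) :
    IntegrableOn (fun y => ∑ i, fderivWithin ℝ (V i) S y (stdVec i)) S ∧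
      ∫ y in S, ∑ i, fderivWithin ℝ (V i) S y (stdVec i) = 0 := by
  obtain ⟨n, rfl⟩ : ∃ n, d = n + 1 := ⟨d - 1, (Nat.succ_pred_eq_of_ne_zero (NeZero.ne d)).symm⟩
  set D : EuclideanSpace ℝ (Fin (n + 1)) → ℝ :=
    fun y => ∑ i, fderivWithin ℝ (V i) S y (stdVec i) with hD
  have hSc : IsClosed S := by
    rw [hS]
    exact isClosed_le continuous_const (PiLp.continuous_apply 2 _ 0)
  have hDK : ∀ y ∈ S, y ∉ K → D y = 0 := by
    intro y hy hyK
    refine Finset.sum_eq_zero fun i _ => ?_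
    rw [(eventuallyEq_zero_of_notMem hK.isClosed (hVK i) hyK).fderivWithin_eq (hVK i y hy hyK)]
    simp
  have hDc : ContinuousOn D S := continuousOn_finsetSum _ fun i _ =>
    ((hV i).continuousOn_fderivWithin hSu le_rfl).clm_apply continuousOn_const
  have hDi : IntegrableOn D S := by
    have h1 : IntegrableOn D (S ∩ K) :=
      (hDc.mono inter_subset_left).integrableOn_compact (hK.inter_left hSc)
    exact h1.of_forall_sdiff_eq_zero hSc.measurableSet fun y hy =>
      hDK y hy.1 fun h => hy.2 ⟨hy.1, h⟩
  refine ⟨hDi, ?_⟩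
  obtain ⟨R, hR0, hR⟩ := hK.isBounded.subset_ball_lt 0 0
  have hRK : ∀ y ∈ K, ∀ i, |y i| < R := by
    intro y hy i
    refine lt_of_le_of_lt ?_ (mem_ball_zero_iff.1 (hR hy))
    exact PiLp.norm_apply_le y i
  set e := EuclideanSpace.equiv (Fin (n + 1)) ℝ with he
  -- The box has one face on the wall `y 0 = 0`, where the normal component of the field vanishes.
  -- On every other face some coordinate has absolute value `R`, so these faces miss `K`.
  set a : Fin (n + 1) → ℝ := fun i => if i = 0 then 0 else -R with ha
  set b : Fin (n + 1) → ℝ := fun _ => R with hb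
  have ha0 : a 0 = 0 := by simp [ha]
  have hab : a ≤ b := by
    intro i
    simp only [ha, hb]
    split_ifs <;> linarith
  have hbox : ∀ x ∈ Icc a b, e.symm x ∈ S := by
    intro x hx
    rw [hS]
    have := hx.1 0
    rw [ha0] at this
    exact this
  have hdiv := integral_divergence_of_hasFDerivAt_off_countable' a b hab
    (fun i x => V i (e.symm x))
    (fun i x => (fderivWithin ℝ (V i) S (e.symm x)).comp (e.symm : _ →L[ℝ] _)) ∅ countable_empty
    (fun i => (hV i).continuousOn.comp e.symm.continuous.continuousOn hbox) ?_ ?_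
  rotate_left
  · rintro x ⟨hx, -⟩ i
    -- Inside the open box the zeroth coordinate is positive, so `S` is a neighbourhood and
    -- derivatives within `S` are full derivatives.
    have hpos : e.symm x ∈ {y : EuclideanSpace ℝ (Fin (n + 1)) | 0 < y 0} := by
      have := (hx 0 (mem_univ _)).1
      rw [ha0] at this
      exact this
    have hmem : S ∈ 𝓝 (e.symm x) := by
      refine Filter.mem_of_superset (IsOpen.mem_nhds ?_ hpos) ?_
      · exact isOpen_lt continuous_const (PiLp.continuous_apply 2 _ 0)
      · intro y hy
        rw [hS]
        exact le_of_lt (show 0 < y 0 from hy)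
    have h1 := ((hV i).differentiableOn (by simp) _ (mem_of_mem_nhds hmem)).hasFDerivWithinAt
    exact (h1.hasFDerivAt hmem).comp x e.symm.hasFDerivAt
  · have : ContinuousOn (fun x => D (e.symm x)) (Icc a b) :=
      hDc.comp e.symm.continuous.continuousOn hbox
    exact this.integrableOn_compact isCompact_Icc
  have hRHS : ∫ x in Icc a b, D (e.symm x) = 0 := by
    refine Eq.trans hdiv (Finset.sum_eq_zero fun i _ => ?_)
    have hfront : ∀ (i : Fin (n + 1)) (c : ℝ), a i ≤ c → c ≤ b i → (i ≠ 0 → |c| = R) →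
        (i = 0 → c = 0 ∨ c = R) → ∫ x in Icc (a ∘ i.succAbove) (b ∘ i.succAbove),
          V i (e.symm (i.insertNth c x)) = 0 := by
      intro i c hac hcb hc hc0
      refine setIntegral_eq_zero_of_forall_eq_zero fun x hx => ?_
      have hz : i.insertNth c x ∈ Icc a b := by
        rw [Fin.insertNth_mem_Icc]
        exact ⟨⟨hac, hcb⟩, hx⟩
      have hzi : (e.symm (i.insertNth c x)) i = c := by simp [he]
      by_cases hi : i = 0 ∧ c = 0
      · obtain ⟨rfl, rfl⟩ := hi
        exact h0 _ hzi
      · refine hVK i _ (hbox _ hz) fun hzK => ?_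
        have h1 := hRK _ hzK i
        rw [hzi] at h1
        by_cases hi0 : i = 0
        · rcases hc0 hi0 with h2 | h2
          · exact hi ⟨hi0, h2⟩
          · rw [h2, abs_of_pos hR0] at h1
            exact lt_irrefl _ h1
        · rw [hc hi0] at h1
          exact lt_irrefl _ h1
    rw [hfront i (b i) (hab i) le_rfl (fun _ => abs_of_pos hR0) (fun _ => Or.inr rfl),
      hfront i (a i) le_rfl (hab i) (fun hi => by simp [ha, hi, abs_of_pos hR0])
        (fun hi => by simp [ha, hi]), sub_zero]
  have hmp := PiLp.volume_preserving_toLp (Fin (n + 1))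
  have hmi : ∫ y in S, D y = ∫ x in e.symm ⁻¹' S, D (e.symm x) :=
    (hmp.setIntegral_preimage_emb
      (MeasurableEquiv.toLp 2 (Fin (n + 1) → ℝ)).measurableEmbedding D S).symm
  rw [hmi, ← hRHS]
  -- Points of the half-space outside the box lie outside `K`, where the divergence is zero.
  refine setIntegral_eq_of_subset_of_forall_sdiff_eq_zero
    (hSc.measurableSet.preimage e.symm.continuous.measurable) hbox ?_
  rintro x ⟨hx, hxb⟩
  refine hDK _ hx fun hxK => hxb ⟨fun i => ?_, fun i => ?_⟩
  · have h1 := hRK _ hxK i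
    simp only [ha]
    split_ifs with hi
    · subst hi
      have : e.symm x ∈ {y : EuclideanSpace ℝ (Fin (n + 1)) | 0 ≤ y 0} := hS ▸ hx
      exact this
    · exact (abs_lt.1 h1).1.le
  · exact (abs_lt.1 (hRK _ hxK i)).2.le

end HalfSpace

/-! ### Stokes' theorem for the contraction with the fundamental bivector -/

section Stokes

section General

variable {E : Type*} [NormedAddCommGroup E] [NormedSpace ℝ E]
  {H : Type*} [TopologicalSpace H] {I : ModelWithCorners ℝ E H}
  {N : Type*} [TopologicalSpace N] [ChartedSpace H N]

/-- Near a point of the chart target, the target and the range of the model coincide. Exterior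
derivatives of forms are taken within the range, whereas coordinate expressions are smooth on the
target. -/
theorem fderivWithin_target {G : Type*} [NormedAddCommGroup G] [NormedSpace ℝ G] (f : E → G)
    {x₀ : N} {y : E} (hy : y ∈ (extChartAt I x₀).target) :
    fderivWithin ℝ f (extChartAt I x₀).target y = fderivWithin ℝ f (range I) y := by
  refine fderivWithin_congr_set ?_
  have := extChartAt_target_eventuallyEq' (I := I) ((extChartAt I x₀).map_target hy)
  rwa [(extChartAt I x₀).right_inv hy] at this

theorem extDerivWithin_target {k : ℕ} (α : E → E [⋀^Fin k]→L[ℝ] ℝ)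
    {x₀ : N} {y : E} (hy : y ∈ (extChartAt I x₀).target) :
    extDerivWithin α (extChartAt I x₀).target y = extDerivWithin α (range I) y := by
  rw [extDerivWithin, extDerivWithin, fderivWithin_target α hy]

theorem DiffForm.inChart_zero {k : ℕ} (x₀ : N) (y : E) :
    DiffForm.inChart (I := I) (k := k) (fun _ : N => 0) x₀ y = 0 := by
  ext v
  rfl

/-- The expression of a `1`-form, given by its values on tangent vectors, in a chart. -/
def oneFormInChart (b : ∀ x : N, TangentSpace I x →L[ℝ] ℝ) (x₀ : N) (y : E) : E →L[ℝ] ℝ :=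
  (b ((extChartAt I x₀).symm y)).comp (chartSymmDeriv I x₀ y)

/-- The derivative of a `2`-form evaluated on three vectors. -/
theorem extDerivWithin_two_apply {α : E → E [⋀^Fin 2]→L[ℝ] ℝ} {T : Set E} {y : E}
    (hα : DifferentiableWithinAt ℝ α T y) (hT : UniqueDiffWithinAt ℝ T y) (u v w : E) :
    extDerivWithin α T y ![u, v, w] = fderivWithin ℝ (fun z => α z ![v, w]) T y u -
      fderivWithin ℝ (fun z => α z ![u, w]) T y v + fderivWithin ℝ (fun z => α z ![u, v]) T y w := by
  rw [extDerivWithin_apply hα hT, Fin.sum_univ_three]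
  have e0 : (0 : Fin 3).removeNth ![u, v, w] = ![v, w] := by
    ext k; fin_cases k <;> rfl
  have e1 : (1 : Fin 3).removeNth ![u, v, w] = ![u, w] := by
    ext k; fin_cases k <;> rfl
  have e2 : (2 : Fin 3).removeNth ![u, v, w] = ![u, v] := by
    ext k; fin_cases k <;> rfl
  rw [e0, e1, e2]
  simp
  ring

end General

variable {d : ℕ} {H : Type*} [TopologicalSpace H]
  {I : ModelWithCorners ℝ (EuclideanSpace ℝ (Fin d)) H}
  {N : Type*} [TopologicalSpace N] [ChartedSpace H N] [IsManifold I ∞ N]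

theorem contDiffOn_omegaInChart (K : AlmostKahler I N) (x₀ : N) (i j : Fin d) :
    ContDiffOn ℝ ∞ (fun y => omegaInChart K x₀ y i j) (extChartAt I x₀).target := by
  simp only [omegaInChart, Matrix.of_apply]
  exact ((ContinuousAlternatingMap.apply ℝ _ ℝ ![stdVec i, stdVec j]).contDiff).comp_contDiffOn
    (K.omega_smooth x₀)

/-- This is `dω = 0` on three coordinate vectors, with the minus sign of the middle term absorbed by
antisymmetry. -/
theorem omegaInChart_cyclic (K : AlmostKahler I N) {x₀ : N} {y : EuclideanSpace ℝ (Fin d)}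
    (hy : y ∈ (extChartAt I x₀).target) (i a b : Fin d) :
    fderivWithin ℝ (fun y => omegaInChart K x₀ y a b) (extChartAt I x₀).target y (stdVec i) +
      fderivWithin ℝ (fun y => omegaInChart K x₀ y b i) (extChartAt I x₀).target y (stdVec a) +
      fderivWithin ℝ (fun y => omegaInChart K x₀ y i a) (extChartAt I x₀).target y (stdVec b)
        = 0 := by
  have hT := uniqueDiffOn_target (I := I) x₀ y hy
  have h1 := K.omega_closed x₀ y hy
  rw [DiffForm.inChart_zero, ← extDerivWithin_target _ hy] at h1
  have h2 := extDerivWithin_two_apply ((K.omega_smooth x₀).differentiableOn (by simp) y hy) hT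
    (stdVec i) (stdVec a) (stdVec b)
  rw [h1] at h2
  have h3 : fderivWithin ℝ (fun y => omegaInChart K x₀ y b i) (extChartAt I x₀).target y =
      -fderivWithin ℝ (fun y => omegaInChart K x₀ y i b) (extChartAt I x₀).target y := by
    rw [← fderivWithin_fun_neg hT]
    exact fderivWithin_congr (fun z _ => omegaInChart_swap K x₀ z b i)
      (omegaInChart_swap K x₀ y b i)
  rw [h3]
  exact (h2.trans (by simp only [omegaInChart, Matrix.of_apply, neg_apply]; ring)).symm

/-- The density `√(det g)` in a chart. -/
def sqrtDet (K : AlmostKahler I N) (x₀ : N) (y : EuclideanSpace ℝ (Fin d)) : ℝ :=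
  Real.sqrt (gramInChart K.metric x₀ y).det

theorem sqrtDet_pos (K : AlmostKahler I N) {x₀ : N} {y : EuclideanSpace ℝ (Fin d)}
    (hy : y ∈ (extChartAt I x₀).target) : 0 < sqrtDet K x₀ y :=
  Real.sqrt_pos.2 (det_gramInChart_pos K.metric hy)

theorem sqrtDet_pow (K : AlmostKahler I N) {x₀ : N} {y : EuclideanSpace ℝ (Fin d)}
    (hy : y ∈ (extChartAt I x₀).target) :
    sqrtDet K x₀ y ^ 4 = (omegaInChart K x₀ y).det ^ 2 := by
  rw [det_omegaInChart_sq K hy, show 4 = 2 * 2 by rfl, pow_mul, sqrtDet,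
    Real.sq_sqrt (det_gramInChart_pos K.metric hy).le]

/-- Smoothness is read off from `ω` and not from the metric: the density is the fourth root of `(det
Ω)²`, and `det Ω` has no zeros. -/
theorem contDiffOn_sqrtDet (K : AlmostKahler I N) (x₀ : N) :
    ContDiffOn ℝ ∞ (sqrtDet K x₀) (extChartAt I x₀).target := by
  have h1 : ContDiffOn ℝ ∞ (fun y => Real.sqrt (Real.sqrt ((omegaInChart K x₀ y).det ^ 2)))
      (extChartAt I x₀).target := by
    refine ContDiffOn.sqrt (ContDiffOn.sqrt
      ((contDiffOn_matrix_det (contDiffOn_omegaInChart K x₀)).pow 2) fun y hy => ?_)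
      fun y hy => ?_
    · exact pow_ne_zero 2 (isUnit_det_omegaInChart K hy).ne_zero
    · rw [Real.sqrt_ne_zero (sq_nonneg _)]
      exact pow_ne_zero 2 (isUnit_det_omegaInChart K hy).ne_zero
  refine h1.congr fun y hy => ?_
  rw [← sqrtDet_pow K hy, show sqrtDet K x₀ y ^ 4 = (sqrtDet K x₀ y ^ 2) ^ 2 by ring,
    Real.sqrt_sq (sq_nonneg _), Real.sqrt_sq (sqrtDet_pos K hy).le]

/-- The codifferential-type expression `∑ i j, Π^{ij} ∂ᵢ bⱼ` of a coordinate `1`-form. -/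
def bivectorDeriv (K : AlmostKahler I N) (x₀ : N)
    (b : EuclideanSpace ℝ (Fin d) → EuclideanSpace ℝ (Fin d) →L[ℝ] ℝ)
    (y : EuclideanSpace ℝ (Fin d)) : ℝ :=
  ∑ i, ∑ j, -((omegaInChart K x₀ y)⁻¹ i j) *
    fderivWithin ℝ b (extChartAt I x₀).target y (stdVec i) (stdVec j)

theorem continuousOn_omegaInChart_inv (K : AlmostKahler I N) (x₀ : N) (i j : Fin d) :
    ContinuousOn (fun y => (omegaInChart K x₀ y)⁻¹ i j) (extChartAt I x₀).target :=
  (contDiffOn_matrix_inv (contDiffOn_omegaInChart K x₀)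
    (fun _ hy => isUnit_det_omegaInChart K hy) i j).continuousOn

theorem continuousOn_bivectorDeriv (K : AlmostKahler I N) (x₀ : N)
    {b : EuclideanSpace ℝ (Fin d) → EuclideanSpace ℝ (Fin d) →L[ℝ] ℝ}
    (hb : ContDiffOn ℝ 1 b (extChartAt I x₀).target) :
    ContinuousOn (bivectorDeriv K x₀ b) (extChartAt I x₀).target :=
  continuousOn_finsetSum _ fun i _ => continuousOn_finsetSum _ fun j _ =>
    (continuousOn_omegaInChart_inv K x₀ i j).neg.mul
      (((hb.continuousOn_fderivWithin (uniqueDiffOn_target x₀) le_rfl).clm_apply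
        continuousOn_const).clm_apply continuousOn_const)

/-- In the Leibniz expansion of the divergence of `-s Ω^{ij} bⱼ`, the terms that differentiate `s
Ω^{ij}` add up to zero since that density is divergence free. -/
theorem sum_fderivWithin_eq_bivectorDeriv (K : AlmostKahler I N) (x₀ : N)
    {b : EuclideanSpace ℝ (Fin d) → EuclideanSpace ℝ (Fin d) →L[ℝ] ℝ}
    (hb : ContDiffOn ℝ 1 b (extChartAt I x₀).target) {y : EuclideanSpace ℝ (Fin d)}
    (hy : y ∈ (extChartAt I x₀).target) :
    ∑ i, fderivWithin ℝ (fun y => ∑ j, -(sqrtDet K x₀ y * (omegaInChart K x₀ y)⁻¹ i j) *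
      b y (stdVec j)) (extChartAt I x₀).target y (stdVec i) =
      sqrtDet K x₀ y * bivectorDeriv K x₀ b y := by
  set T := (extChartAt I x₀).target
  have hT := uniqueDiffOn_target (I := I) x₀ y hy
  have hΩ : ∀ i j, ContDiffOn ℝ 1 (fun y => omegaInChart K x₀ y i j) T := fun i j =>
    (contDiffOn_omegaInChart K x₀ i j).of_le (by simp)
  have hs : ContDiffOn ℝ 1 (sqrtDet K x₀) T := (contDiffOn_sqrtDet K x₀).of_le (by simp)
  have hu : ∀ y ∈ T, IsUnit (omegaInChart K x₀ y).det := fun _ hy => isUnit_det_omegaInChart K hy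
  have dsQ : ∀ i j, DifferentiableWithinAt ℝ
      (fun y => sqrtDet K x₀ y * (omegaInChart K x₀ y)⁻¹ i j) T y := fun i j =>
    (hs.mul (contDiffOn_matrix_inv hΩ hu i j)).differentiableOn (by simp) y hy
  have db := hb.differentiableOn (by simp) y hy
  have dbj : ∀ j, HasFDerivWithinAt (fun y => b y (stdVec j))
      ((ContinuousLinearMap.apply ℝ ℝ (stdVec j)).comp (fderivWithin ℝ b T y)) T y := fun j =>
    (ContinuousLinearMap.apply ℝ ℝ (stdVec j)).hasFDerivAt.comp_hasFDerivWithinAt y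
      db.hasFDerivWithinAt
  have hdiv := fun j => sum_fderivWithin_density_mul_inv (uniqueDiffOn_target x₀) hΩ hu
    (fun z _ a b => omegaInChart_swap K x₀ z a b) hs (fun _ hy => sqrtDet_pos K hy)
    (fun _ hy => sqrtDet_pow K hy) stdVec hy (omegaInChart_cyclic K hy) j
  have h1 : ∀ i, fderivWithin ℝ (fun y => ∑ j, -(sqrtDet K x₀ y * (omegaInChart K x₀ y)⁻¹ i j) *
      b y (stdVec j)) T y (stdVec i) =
      ∑ j, (-(sqrtDet K x₀ y * (omegaInChart K x₀ y)⁻¹ i j) *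
        fderivWithin ℝ b T y (stdVec i) (stdVec j) - b y (stdVec j) *
        fderivWithin ℝ (fun y => sqrtDet K x₀ y * (omegaInChart K x₀ y)⁻¹ i j) T y (stdVec i)) := by
    intro i
    have h2 := HasFDerivWithinAt.fun_sum (u := Finset.univ) fun j _ =>
      ((dsQ i j).hasFDerivWithinAt.fun_neg).mul (dbj j)
    refine Eq.trans (congrArg (fun A => A (stdVec i)) (h2.fderivWithin hT)) ?_
    simp only [sum_apply, add_apply, smul_apply, smul_eq_mul, neg_apply,
      ContinuousLinearMap.comp_apply, ContinuousLinearMap.apply_apply]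
    exact Finset.sum_congr rfl fun j _ => by ring
  have h3 : ∑ i, ∑ j, b y (stdVec j) *
      fderivWithin ℝ (fun y => sqrtDet K x₀ y * (omegaInChart K x₀ y)⁻¹ i j) T y (stdVec i)
        = 0 := by
    rw [Finset.sum_comm]
    refine Finset.sum_eq_zero fun j _ => ?_
    rw [← Finset.mul_sum]
    exact (congrArg _ (hdiv j)).trans (mul_zero _)
  simp only [h1, Finset.sum_sub_distrib]
  rw [h3, sub_zero, bivectorDeriv, Finset.mul_sum]
  refine Finset.sum_congr rfl fun i _ => ?_
  rw [Finset.mul_sum]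
  exact Finset.sum_congr rfl fun j _ => by ring

end Stokes

/-! ### Stokes' theorem on manifolds with boundary, for forms vanishing on vectors tangent to the
boundary. -/

section Stokes

variable {d : ℕ} [NeZero d]
  {N : Type*} [TopologicalSpace N] [ChartedSpace (EuclideanHalfSpace d) N] [IsManifold (𝓡∂ d) ∞ N]

theorem range_halfSpace : range (𝓡∂ d) = {y : EuclideanSpace ℝ (Fin d) | 0 ≤ y 0} :=
  range_modelWithCornersEuclideanHalfSpace d

/-- Stokes' theorem in a chart. -/
theorem integral_bivectorDeriv_target (K : AlmostKahler (𝓡∂ d) N) (x₀ : N)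
    {b : EuclideanSpace ℝ (Fin d) → EuclideanSpace ℝ (Fin d) →L[ℝ] ℝ}
    (hb : ContDiffOn ℝ 1 b (extChartAt (𝓡∂ d) x₀).target)
    {C : Set (EuclideanSpace ℝ (Fin d))} (hC : IsCompact C)
    (hCT : C ⊆ (extChartAt (𝓡∂ d) x₀).target)
    (hbC : ∀ y ∈ (extChartAt (𝓡∂ d) x₀).target, y ∉ C → b y = 0)
    (hbd : ∀ y ∈ (extChartAt (𝓡∂ d) x₀).target, y 0 = 0 → ∀ j ≠ 0, b y (stdVec j) = 0) :
    IntegrableOn (fun y => sqrtDet K x₀ y * bivectorDeriv K x₀ b y)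
        (extChartAt (𝓡∂ d) x₀).target ∧
      ∫ y in (extChartAt (𝓡∂ d) x₀).target, sqrtDet K x₀ y * bivectorDeriv K x₀ b y = 0 := by
  classical
  set T := (extChartAt (𝓡∂ d) x₀).target with hTdef
  have hTS : T ⊆ range (𝓡∂ d) := extChartAt_target_subset_range x₀
  have hTm : MeasurableSet T := measurableSet_extChartAt_target x₀
  set V : Fin d → EuclideanSpace ℝ (Fin d) → ℝ := fun i y =>
    ∑ j, -(sqrtDet K x₀ y * (omegaInChart K x₀ y)⁻¹ i j) * b y (stdVec j) with hV
  have hVC : ∀ i, ContDiffOn ℝ 1 (V i) T := by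
    intro i
    refine ContDiffOn.sum fun j _ => ContDiffOn.mul (ContDiffOn.neg (ContDiffOn.mul ?_ ?_)) ?_
    · exact (contDiffOn_sqrtDet K x₀).of_le (by simp)
    · exact contDiffOn_matrix_inv (fun i j => (contDiffOn_omegaInChart K x₀ i j).of_le (by simp))
        (fun _ hy => isUnit_det_omegaInChart K hy) i j
    · exact hb.clm_apply contDiffOn_const
  -- Extension by zero to the whole half-space. It stays differentiable because `T` is relatively
  -- open in the range and the support lies in the compact `C ⊆ T`.
  set V' : Fin d → EuclideanSpace ℝ (Fin d) → ℝ := fun i => T.indicator (V i) with hV'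
  have hV0 : ∀ i, ∀ y ∉ C, V' i y = 0 := by
    intro i y hyC
    by_cases hy : y ∈ T
    · refine (indicator_of_mem hy (V i)).trans ?_
      exact Finset.sum_eq_zero fun j _ => by rw [hbC y hy hyC]; simp
    · exact indicator_of_notMem hy _
  have hmem : ∀ y ∈ T, T ∈ 𝓝[range (𝓡∂ d)] y := fun y hy =>
    extChartAt_target_mem_nhdsWithin_of_mem hy
  have hV'C : ∀ i, ContDiffOn ℝ 1 (V' i) (range (𝓡∂ d)) := by
    intro i y hy
    by_cases hyC : y ∈ C
    · have hyT := hCT hyC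
      refine ContDiffWithinAt.mono_of_mem_nhdsWithin (s := T) ?_ (hmem y hyT)
      exact (hVC i y hyT).congr (fun z hz => indicator_of_mem hz _) (indicator_of_mem hyT _)
    · exact (contDiffWithinAt_const (c := (0 : ℝ))).congr_of_eventuallyEq
        (eventuallyEq_zero_of_notMem hC.isClosed (fun z _ hz => hV0 i z hz) hyC) (hV0 i y hyC)
  obtain ⟨hint, hzero⟩ := integral_divergence_halfSpace range_halfSpace (𝓡∂ d).uniqueDiffOn hV'C hC
    (fun i y _ hy => hV0 i y hy) (by
      intro y hy
      by_cases hyT : y ∈ T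
      · refine (indicator_of_mem hyT (V 0)).trans ?_
        refine Finset.sum_eq_zero fun j _ => ?_
        -- The normal component of `V` pairs `b₀` with the diagonal entry of the antisymmetric
        -- `Ω⁻¹`, which is zero; the tangential components of `b` vanish by `hbd`.
        by_cases hj : j = 0
        · subst hj
          have hu := isUnit_det_omegaInChart K hyT
          have hanti : (omegaInChart K x₀ y)⁻¹ 0 0 = 0 := by
            have h1 : (omegaInChart K x₀ y).transpose = -omegaInChart K x₀ y := by
              ext i j
              rw [Matrix.transpose_apply, omegaInChart_swap]
              rfl
            have h2 : ((omegaInChart K x₀ y)⁻¹).transpose = -(omegaInChart K x₀ y)⁻¹ := by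
              rw [Matrix.transpose_nonsing_inv, h1]
              refine Matrix.inv_eq_right_inv ?_
              rw [neg_mul_neg, Matrix.mul_nonsing_inv _ hu]
            have h3 := congrFun (congrFun h2 0) 0
            rw [Matrix.transpose_apply, Matrix.neg_apply] at h3
            linarith
          rw [hanti]
          simp
        · rw [hbd y hyT hy j hj, mul_zero]
      · exact indicator_of_notMem hyT _)
  have hEq : ∀ y ∈ T, ∑ i, fderivWithin ℝ (V' i) (range (𝓡∂ d)) y (stdVec i) =
      sqrtDet K x₀ y * bivectorDeriv K x₀ b y := by
    intro y hy
    rw [← sum_fderivWithin_eq_bivectorDeriv K x₀ hb hy]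
    refine Finset.sum_congr rfl fun i _ => ?_
    rw [← fderivWithin_target _ hy]
    have h : fderivWithin ℝ (V' i) T y = fderivWithin ℝ (V i) T y :=
      fderivWithin_congr (fun z hz => indicator_of_mem hz (V i)) (indicator_of_mem hy (V i))
    exact congrArg (fun A : EuclideanSpace ℝ (Fin d) →L[ℝ] ℝ => A (stdVec i)) h
  have hOff : ∀ y ∈ range (𝓡∂ d) \ T,
      ∑ i, fderivWithin ℝ (V' i) (range (𝓡∂ d)) y (stdVec i) = 0 := by
    rintro y ⟨-, hyT⟩
    have hyC : y ∉ C := fun h => hyT (hCT h)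
    refine Finset.sum_eq_zero fun i _ => ?_
    rw [(eventuallyEq_zero_of_notMem hC.isClosed (fun z _ hz => hV0 i z hz) hyC).fderivWithin_eq
      (hV0 i y hyC)]
    simp
  refine ⟨(hint.mono_set hTS).congr_fun hEq hTm, ?_⟩
  rw [← hzero, ← setIntegral_congr_fun hTm hEq]
  exact (setIntegral_eq_of_subset_of_forall_sdiff_eq_zero
    (𝓡∂ d).isClosed_range.measurableSet hTS hOff).symm

omit [NeZero d] [IsManifold (𝓡∂ d) ∞ N] in
theorem mfderiv_chartSymmDeriv {H : Type*} [TopologicalSpace H]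
    {I : ModelWithCorners ℝ (EuclideanSpace ℝ (Fin d)) H}
    {N : Type*} [TopologicalSpace N] [ChartedSpace H N] [IsManifold I ∞ N]
    {E' : Type*} [NormedAddCommGroup E'] [NormedSpace ℝ E'] {H' : Type*} [TopologicalSpace H']
    {I' : ModelWithCorners ℝ E' H'} {M : Type*} [TopologicalSpace M] [ChartedSpace H' M]
    {f : N → M} {x₀ : N} {y : EuclideanSpace ℝ (Fin d)} (hy : y ∈ (extChartAt I x₀).target)
    (hf : MDifferentiableAt I I' f ((extChartAt I x₀).symm y)) (v : EuclideanSpace ℝ (Fin d)) :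
    mfderiv I I' f ((extChartAt I x₀).symm y) (chartSymmDeriv I x₀ y v) =
      mfderivWithin 𝓘(ℝ, EuclideanSpace ℝ (Fin d)) I' (fun z => f ((extChartAt I x₀).symm z))
        (extChartAt I x₀).target y v := by
  rw [chartSymmDeriv_eq hy]
  have h := mfderiv_comp_mfderivWithin (I := 𝓘(ℝ, EuclideanSpace ℝ (Fin d))) (I' := I) (I'' := I') y
    (f := (extChartAt I x₀).symm) (g := f) hf
    ((mdifferentiableWithinAt_extChartAt_symm hy).mono (extChartAt_target_subset_range x₀))
    (uniqueDiffOn_target x₀ y hy).uniqueMDiffWithinAt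
  exact (congrArg (fun A => A v) h).symm

/-- The differential of a real-valued function. -/
def realDifferential (f : N → ℝ) (x : N) : TangentSpace (𝓡∂ d) x →L[ℝ] ℝ :=
  show TangentSpace (𝓡∂ d) x →L[ℝ] ℝ from mfderiv (𝓡∂ d) 𝓘(ℝ, ℝ) f x

omit [IsManifold (𝓡∂ d) ∞ N] in
theorem realDifferential_eq_zero {f : N → ℝ} {x : N} (h : f =ᶠ[𝓝 x] fun _ => 0) :
    realDifferential (d := d) f x = 0 := by
  have h2 : mfderiv (𝓡∂ d) 𝓘(ℝ, ℝ) f x = mfderiv (𝓡∂ d) 𝓘(ℝ, ℝ) (fun _ => (0 : ℝ)) x :=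
    h.mfderiv_eq
  rw [mfderiv_const] at h2
  exact h2

theorem oneFormInChart_realDifferential {f : N → ℝ} {x₀ : N} {y : EuclideanSpace ℝ (Fin d)}
    (hy : y ∈ (extChartAt (𝓡∂ d) x₀).target)
    (hf : MDifferentiableAt (𝓡∂ d) 𝓘(ℝ, ℝ) f ((extChartAt (𝓡∂ d) x₀).symm y)) :
    oneFormInChart (realDifferential f) x₀ y =
      fderivWithin ℝ (fun z => f ((extChartAt (𝓡∂ d) x₀).symm z))
        (extChartAt (𝓡∂ d) x₀).target y := by
  ext v
  refine (mfderiv_chartSymmDeriv hy hf v).trans ?_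
  rw [mfderivWithin_eq_fderivWithin]
  rfl

variable [T2Space N] [CompactSpace N] [MeasurableSpace N] [BorelSpace N]

/-- Stokes' theorem: the integral over `N` of the contraction with the fundamental bivector of the
exterior derivative of a `1`-form `b` which vanishes on vectors tangent to the boundary. -/
theorem integral_contract_extDeriv_eq_zero (K : AlmostKahler (𝓡∂ d) N)
    (b : ∀ x : N, TangentSpace (𝓡∂ d) x →L[ℝ] ℝ) (l : N → ℝ)
    (hb : ∀ x₀, ContDiffOn ℝ 1 (oneFormInChart b x₀) (extChartAt (𝓡∂ d) x₀).target)
    (hbd : ∀ x₀, ∀ y ∈ (extChartAt (𝓡∂ d) x₀).target, y 0 = 0 → ∀ j ≠ 0,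
      oneFormInChart b x₀ y (stdVec j) = 0)
    (hl : ∀ x₀, ∀ y ∈ (extChartAt (𝓡∂ d) x₀).target,
      l ((extChartAt (𝓡∂ d) x₀).symm y) = bivectorDeriv K x₀ (oneFormInChart b x₀) y) :
    ∫ x, l x ∂(riemannianVolume K.metric) = 0 := by
  classical
  obtain ⟨ρ, hρ⟩ := SmoothPartitionOfUnity.exists_isSubordinate_chartAt_source (𝓡∂ d) N
  have hfin : {k | (Function.support (ρ k)).Nonempty}.Finite :=
    ρ.locallyFinite.finite_nonempty_of_compact
  set F := hfin.toFinset with hF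
  have hsum : ∀ x, ∑ k ∈ F, ρ k x = 1 := by
    intro x
    rw [← ρ.sum_eq_one (mem_univ x)]
    refine (finsum_eq_sum_of_support_subset _ fun k hk => ?_).symm
    rw [hF, Finite.coe_toFinset]
    exact ⟨x, hk⟩
  have hρd : ∀ k x, MDifferentiableAt (𝓡∂ d) 𝓘(ℝ, ℝ) (ρ k) x := fun k x =>
    (ρ k).contMDiff.mdifferentiable (by simp) x
  set W : ∀ (k : N) (x : N), LinearMap.BilinForm ℝ (TangentSpace (𝓡∂ d) x) := fun k x =>
    ((realDifferential (d := d) (ρ k) x).toLinearMap).smulRight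
      (b x : TangentSpace (𝓡∂ d) x →ₗ[ℝ] ℝ) with hW
  -- A globally defined version of `Π(d(ρₖ b)) = ρₖ Π(db) + Π(dρₖ ⊗ b)`, up to the normalisation in
  -- `bivectorDeriv`. Being global, it can be compared with the coordinate expression in any chart.
  set L : N → N → ℝ := fun k x => ρ k x * l x + K.contract x (W k x) with hL
  have hρs : ∀ k x₀, ContDiffOn ℝ ∞ (fun z => ρ k ((extChartAt (𝓡∂ d) x₀).symm z))
      (extChartAt (𝓡∂ d) x₀).target := fun k x₀ =>
    contMDiffOn_iff_contDiffOn.1 ((ρ k).contMDiff.comp_contMDiffOn (contMDiffOn_symm x₀))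
  have hWc : ∀ k x₀, ∀ y ∈ (extChartAt (𝓡∂ d) x₀).target,
      K.contract _ (W k ((extChartAt (𝓡∂ d) x₀).symm y)) =
      ∑ i, ∑ j, -((omegaInChart K x₀ y)⁻¹ i j) *
        (fderivWithin ℝ (fun z => ρ k ((extChartAt (𝓡∂ d) x₀).symm z))
          (extChartAt (𝓡∂ d) x₀).target y (stdVec i) * oneFormInChart b x₀ y (stdVec j)) := by
    intro k x₀ y hy
    rw [contract_eq_sum K hy]
    refine Finset.sum_congr rfl fun i _ => Finset.sum_congr rfl fun j _ => ?_
    rw [← oneFormInChart_realDifferential hy (hρd k _)]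
    rfl
  have hLc : ∀ k x₀, ∀ y ∈ (extChartAt (𝓡∂ d) x₀).target,
      L k ((extChartAt (𝓡∂ d) x₀).symm y) = bivectorDeriv K x₀
        (fun z => ρ k ((extChartAt (𝓡∂ d) x₀).symm z) • oneFormInChart b x₀ z) y := by
    intro k x₀ y hy
    rw [hL]
    simp only
    rw [hWc k x₀ y hy, hl x₀ y hy, bivectorDeriv, bivectorDeriv, Finset.mul_sum,
      ← Finset.sum_add_distrib]
    refine Finset.sum_congr rfl fun i _ => ?_
    rw [Finset.mul_sum, ← Finset.sum_add_distrib]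
    refine Finset.sum_congr rfl fun j _ => ?_
    rw [fderivWithin_fun_smul (uniqueDiffOn_target x₀ y hy)
      ((hρs k x₀).differentiableOn (by simp) y hy) ((hb x₀).differentiableOn (by simp) y hy)]
    simp only [add_apply, smul_apply, smul_eq_mul, ContinuousLinearMap.smulRight_apply]
    ring
  -- The functions `ρₖ` sum to `1`, so their differentials sum to zero and the correction terms
  -- disappear.
  have hWsum : ∀ x, ∑ k ∈ F, K.contract x (W k x) = 0 := by
    intro x
    have hx : (extChartAt (𝓡∂ d) x).symm (extChartAt (𝓡∂ d) x x) = x := extChartAt_to_inv x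
    have hy := mem_extChartAt_target (I := 𝓡∂ d) x
    rw [← hx]
    have h1 : ∀ v, ∑ k ∈ F, fderivWithin ℝ (fun z => ρ k ((extChartAt (𝓡∂ d) x).symm z))
        (extChartAt (𝓡∂ d) x).target (extChartAt (𝓡∂ d) x x) v = 0 := by
      intro v
      have h2 := fderivWithin_fun_sum (uniqueDiffOn_target x _ hy) fun k (_ : k ∈ F) =>
        (hρs k x).differentiableOn (by simp) _ hy
      simp only [hsum] at h2
      have h3 := congrArg (fun A => A v) h2
      simp at h3
      simpa using h3.symm
    simp only [fun k => hWc k x _ hy]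
    rw [Finset.sum_comm]
    refine Finset.sum_eq_zero fun i _ => ?_
    rw [Finset.sum_comm]
    refine Finset.sum_eq_zero fun j _ => ?_
    rw [← Finset.mul_sum, ← Finset.sum_mul, h1, zero_mul, mul_zero]
  have hlsum : ∀ x, l x = ∑ k ∈ F, L k x := by
    intro x
    simp only [hL, Finset.sum_add_distrib, ← Finset.sum_mul, hsum, hWsum, one_mul, add_zero]
  have hLint : ∀ k, Integrable (L k) (riemannianVolume K.metric) ∧
      ∫ x, L k x ∂(riemannianVolume K.metric) = 0 := by
    intro k
    have hsub : tsupport (ρ k) ⊆ (extChartAt (𝓡∂ d) k).source := by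
      rw [extChartAt_source]
      exact hρ k
    set β : EuclideanSpace ℝ (Fin d) → EuclideanSpace ℝ (Fin d) →L[ℝ] ℝ :=
      fun z => ρ k ((extChartAt (𝓡∂ d) k).symm z) • oneFormInChart b k z with hβ
    have hβC : ContDiffOn ℝ 1 β (extChartAt (𝓡∂ d) k).target :=
      ((hρs k k).of_le (by simp)).smul (hb k)
    have hcont : ContinuousOn (fun y => L k ((extChartAt (𝓡∂ d) k).symm y))
        (extChartAt (𝓡∂ d) k).target :=
      (continuousOn_bivectorDeriv K k hβC).congr fun y hy => hLc k k y hy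
    have hzero : ∀ x ∉ (extChartAt (𝓡∂ d) k).source, L k x = 0 := by
      intro x hx
      have hx' : x ∉ tsupport (ρ k) := fun h => hx (hsub h)
      have h1 : (ρ k : N → ℝ) =ᶠ[𝓝 x] fun _ => 0 := notMem_tsupport_iff_eventuallyEq.1 hx'
      have h2 := realDifferential_eq_zero (d := d) h1
      have h3 : W k x = 0 := by
        simp only [hW, h2]
        ext v w
        simp
      simp only [hL, h3, K.contract_zero, h1.eq_of_nhds, zero_mul, add_zero]
    obtain ⟨h1, h2⟩ := integral_riemannianVolume_of_support K.metric k hcont hzero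
    have hcongr : ∀ y ∈ (extChartAt (𝓡∂ d) k).target,
        sqrtDet K k y * bivectorDeriv K k β y =
        Real.sqrt (gramInChart K.metric k y).det * L k ((extChartAt (𝓡∂ d) k).symm y) := by
      intro y hy
      rw [hLc k k y hy]
      rfl
    have hm := measurableSet_extChartAt_target (I := 𝓡∂ d) k
    -- The partition is indexed by the points of `N`, and the support of `ρ k` lies in the chart at
    -- `k`; so `L k` is integrated in that single chart.
    obtain ⟨h3, h4⟩ := integral_bivectorDeriv_target K k hβC
      (C := extChartAt (𝓡∂ d) k '' tsupport (ρ k))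
      ((isClosed_tsupport _).isCompact.image_of_continuousOn
        ((continuousOn_extChartAt k).mono hsub))
      (by
        rintro _ ⟨x, hx, rfl⟩
        exact (extChartAt (𝓡∂ d) k).map_source (hsub hx))
      (by
        intro y hy hyC
        have h5 : (extChartAt (𝓡∂ d) k).symm y ∉ tsupport (ρ k) := fun h =>
          hyC ⟨_, h, (extChartAt (𝓡∂ d) k).right_inv hy⟩
        simp only [hβ, image_eq_zero_of_notMem_tsupport h5, zero_smul])
      (by
        intro y hy hy0 j hj
        simp only [hβ, smul_apply, hbd k y hy hy0 j hj, smul_zero])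
    refine ⟨h1.2 (h3.congr_fun hcongr hm), ?_⟩
    rw [h2, ← setIntegral_congr_fun hm hcongr, h4]
  simp only [hlsum]
  rw [integral_finsetSum _ fun k _ => (hLint k).1]
  exact Finset.sum_eq_zero fun k _ => (hLint k).2

end Stokes

/-! ### Pullback of differential forms -/

section Pullback

variable {F : Type*} [NormedAddCommGroup F] [NormedSpace ℝ F]
  {E : Type*} [NormedAddCommGroup E] [NormedSpace ℝ E]

/-- Induction on the degree: currying off the first argument is bounded linear, and it leaves the
application of a linear map to a vector. -/
theorem ContDiffWithinAt.continuousAlternatingMap_apply {r : ℕ∞ω} {S : Set F} {p : F} {k : ℕ}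
    {A : F → E [⋀^Fin k]→L[ℝ] ℝ} {w : Fin k → F → E} (hA : ContDiffWithinAt ℝ r A S p)
    (hw : ∀ i, ContDiffWithinAt ℝ r (w i) S p) :
    ContDiffWithinAt ℝ r (fun z => A z fun i => w i z) S p := by
  induction k with
  | zero =>
    have h : (fun z => A z fun i => w i z) = fun z => A z ![] := by
      ext z
      congr 1
      exact Subsingleton.elim _ _
    rw [h]
    exact ((ContinuousAlternatingMap.apply ℝ E ℝ ![]).contDiff).comp_contDiffWithinAt hA
  | succ k ih =>
    have h0 : IsBoundedLinearMap ℝ (fun B : E [⋀^Fin (k + 1)]→L[ℝ] ℝ => B.curryLeft) :=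
      ⟨⟨fun _ _ => ContinuousAlternatingMap.curryLeft_add _ _,
        fun _ _ => ContinuousAlternatingMap.curryLeft_smul _ _⟩, 1, one_pos, fun B => by
          rw [one_mul]
          exact (ContinuousAlternatingMap.norm_curryLeft B).le⟩
    have h1 : ContDiffWithinAt ℝ r (fun z => (A z).curryLeft) S p :=
      ContDiff.comp_contDiffWithinAt (g := fun B : E [⋀^Fin (k + 1)]→L[ℝ] ℝ => B.curryLeft)
        (IsBoundedLinearMap.contDiff (E := E [⋀^Fin (k + 1)]→L[ℝ] ℝ)
          (F := E →L[ℝ] E [⋀^Fin k]→L[ℝ] ℝ) (by exact h0)) hA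
    have h2 := ih (h1.clm_apply (hw 0)) fun i => hw i.succ
    refine h2.congr_of_eventuallyEq (Filter.Eventually.of_forall fun z => ?_) ?_ <;>
    · simp only [ContinuousAlternatingMap.curryLeft_apply_apply]
      congr 1
      ext i
      cases i using Fin.cases <;> rfl

variable {H : Type*} [TopologicalSpace H] {I : ModelWithCorners ℝ E H}
  {M : Type*} [TopologicalSpace M] [ChartedSpace H M]

/-- The pullback of a form on a manifold under a map defined on a subset of a vector space. -/
def pullbackForm {k : ℕ} (I : ModelWithCorners ℝ E H) {M : Type*} [TopologicalSpace M]
    [ChartedSpace H M] (f : F → M) (S : Set F) (α : DiffForm I M k) (p : F) : F [⋀^Fin k]→L[ℝ] ℝ :=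
  (α (f p)).compContinuousLinearMap (mfderivWithin 𝓘(ℝ, F) I f S p)

variable [IsManifold I ∞ M] {k : ℕ} {f : F → M} {S : Set F} {p : F}

/-- Factoring `f` through a chart of `M` reduces the calculus of pullbacks to forms on vector
spaces. -/
theorem pullbackForm_eq_inChart (α : DiffForm I M k) {x₁ : M}
    (hf : MDifferentiableWithinAt 𝓘(ℝ, F) I f S p) (hS : UniqueDiffWithinAt ℝ S p)
    (hx : f p ∈ (extChartAt I x₁).source) :
    pullbackForm I f S α p = (α.inChart x₁ ((extChartAt I x₁ ∘ f) p)).compContinuousLinearMap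
      (fderivWithin ℝ (extChartAt I x₁ ∘ f) S p) := by
  have : IsManifold I 1 M := IsManifold.of_le (n := ∞) (by simp)
  ext v
  have h := mfderivWithin_eq_chartSymmDeriv_comp hf hS hx
  have h1 : ∀ x x' : M, x = x' → ∀ u : Fin k → E,
      α x (show Fin k → TangentSpace I x from u) = α x' (show Fin k → TangentSpace I x' from u) := by
    rintro x _ rfl u
    rfl
  refine Eq.trans (congrArg (fun A : F →L[ℝ] E => α (f p)
    (show Fin k → TangentSpace I (f p) from fun i => A (v i))) h) ?_
  exact h1 _ _ ((extChartAt I x₁).left_inv hx).symm _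

theorem contDiffWithinAt_extChartAt_comp {x₁ : M} (hf : ContMDiffOn 𝓘(ℝ, F) I ∞ f S) (hp : p ∈ S)
    (hx : f p ∈ (extChartAt I x₁).source) :
    ContDiffWithinAt ℝ ∞ (extChartAt I x₁ ∘ f) S p := by
  rw [extChartAt_source] at hx
  exact contMDiffWithinAt_iff_contDiffWithinAt.1
    ((contMDiffAt_extChartAt' hx).comp_contMDiffWithinAt p (hf p hp))

omit [IsManifold I ∞ M] in
/-- Locally, the source can be restricted so as to be mapped to a chart. -/
theorem eventually_mem_extChartAt_source (hf : ContMDiffOn 𝓘(ℝ, F) I ∞ f S) (hp : p ∈ S) :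
    ∀ᶠ q in 𝓝[S] p, f q ∈ (extChartAt I (f p)).source :=
  (hf p hp).continuousWithinAt (extChartAt_source_mem_nhds (f p))

theorem pullbackForm_eventuallyEq (α : DiffForm I M k) (hf : ContMDiffOn 𝓘(ℝ, F) I ∞ f S)
    (hS : UniqueDiffOn ℝ S) (hp : p ∈ S) :
    pullbackForm I f S α =ᶠ[𝓝[S] p] fun q =>
      (α.inChart (f p) ((extChartAt I (f p) ∘ f) q)).compContinuousLinearMap
      (fderivWithin ℝ (extChartAt I (f p) ∘ f) S q) := by
  filter_upwards [eventually_mem_extChartAt_source hf hp, self_mem_nhdsWithin] with q hq hqS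
  exact pullbackForm_eq_inChart α ((hf q hqS).mdifferentiableWithinAt (by simp)) (hS q hqS) hq

theorem contDiffWithinAt_inChart_comp {α : DiffForm I M k} (hα : α.IsSmooth)
    (hf : ContMDiffOn 𝓘(ℝ, F) I ∞ f S) (hp : p ∈ S) :
    ContDiffWithinAt ℝ ∞ (fun q => α.inChart (f p) ((extChartAt I (f p) ∘ f) q)) S p := by
  have h1 : ContDiffWithinAt ℝ ∞ (α.inChart (f p)) (extChartAt I (f p)).target
      ((extChartAt I (f p) ∘ f) p) := hα (f p) _ (mem_extChartAt_target (f p))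
  refine h1.comp_of_preimage_mem_nhdsWithin p (contDiffWithinAt_extChartAt_comp hf hp
    (mem_extChartAt_source (f p))) ?_
  filter_upwards [eventually_mem_extChartAt_source hf hp] with q hq
  exact (extChartAt I (f p)).map_source hq

/-- The pullback of a smooth form under a smooth map is smooth. -/
theorem contDiffOn_pullbackForm_apply {α : DiffForm I M k} (hα : α.IsSmooth)
    (hf : ContMDiffOn 𝓘(ℝ, F) I ∞ f S) (hS : UniqueDiffOn ℝ S) (v : Fin k → F) :
    ContDiffOn ℝ ∞ (fun q => pullbackForm I f S α q v) S := by
  intro p hp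
  have h2 := (contDiffWithinAt_extChartAt_comp hf hp (mem_extChartAt_source (I := I) (f p)))
  have h3 := ((h2.fderivWithin_right (m := ∞) hS (by simp) hp))
  have h4 := (contDiffWithinAt_inChart_comp hα hf hp).continuousAlternatingMap_apply
    (w := fun i q => fderivWithin ℝ (extChartAt I (f p) ∘ f) S q (v i))
    fun i => h3.clm_apply contDiffWithinAt_const
  refine h4.congr_of_eventuallyEq_of_mem ?_ hp
  filter_upwards [pullbackForm_eventuallyEq α hf hS hp] with q hq
  rw [hq]
  rfl

theorem differentiableWithinAt_pullbackForm {α : DiffForm I M k} (hα : α.IsSmooth)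
    (hf : ContMDiffOn 𝓘(ℝ, F) I ∞ f S) (hS : UniqueDiffOn ℝ S) (hp : p ∈ S) :
    DifferentiableWithinAt ℝ (pullbackForm I f S α) S p := by
  have h2 := (contDiffWithinAt_extChartAt_comp hf hp (mem_extChartAt_source (I := I) (f p)))
  have h3 := ((h2.fderivWithin_right (m := ∞) hS (by simp) hp))
  refine DifferentiableWithinAt.congr_of_eventuallyEq ?_ (pullbackForm_eventuallyEq α hf hS hp)
    ((pullbackForm_eventuallyEq α hf hS hp).eq_of_nhdsWithin hp)
  exact DifferentiableWithinAt.continuousAlternatingMapCompContinuousLinearMap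
    ((contDiffWithinAt_inChart_comp hα hf hp).differentiableWithinAt (by simp))
    (h3.differentiableWithinAt (by simp))

/-- The exterior derivative commutes with pullback. -/
theorem extDerivWithin_pullbackForm {α : DiffForm I M k} {β : DiffForm I M (k + 1)}
    (hα : α.IsSmooth) (hαβ : α.HasExtDeriv β)
    (hf : ContMDiffOn 𝓘(ℝ, F) I ∞ f S) (hS : UniqueDiffOn ℝ S) (hp : p ∈ S)
    (hpc : p ∈ closure (interior S)) :
    extDerivWithin (pullbackForm I f S α) S p = pullbackForm I f S β p := by
  -- Shrinking `S` to `O ∩ S`, which `f` maps into a single chart of `M`, allows the use of the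
  -- vector space version of the theorem. Derivatives within `O ∩ S` and within `S` agree on `O`.
  obtain ⟨O, hO, hpO, hOS⟩ := mem_nhdsWithin.1 (eventually_mem_extChartAt_source hf hp)
  have hxs := mem_extChartAt_source (I := I) (f p)
  have h2 := contDiffWithinAt_extChartAt_comp hf hp hxs
  have hfd : ∀ q ∈ O, fderivWithin ℝ (extChartAt I (f p) ∘ f) (O ∩ S) q =
      fderivWithin ℝ (extChartAt I (f p) ∘ f) S q := fun q hq => by
    rw [inter_comm]
    exact fderivWithin_inter (hO.mem_nhds hq)
  have hOd : UniqueDiffOn ℝ (O ∩ S) := by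
    rw [inter_comm]
    exact hS.inter hO
  have hd : DifferentiableWithinAt ℝ (α.inChart (f p)) (extChartAt I (f p)).target
      ((extChartAt I (f p) ∘ f) p) :=
    (hα (f p)).differentiableOn (by simp) _ (mem_extChartAt_target (f p))
  have h5 := extDerivWithin_pullback (s := O ∩ S) (r := ∞) (x := p) hd (h2.mono inter_subset_right)
    (by rw [minSmoothness_of_isRCLikeNormedField]; exact WithTop.coe_le_coe.2 le_top) hOd (by
      rw [interior_inter, hO.interior_eq]
      exact hO.inter_closure ⟨hpO, hpc⟩) ⟨hpO, hp⟩
    fun q hq => (extChartAt I (f p)).map_source (hOS hq)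
  have h7 := (extDerivWithin_target (α.inChart (f p)) (mem_extChartAt_target (I := I) (f p))).trans
    (hαβ (f p) _ (mem_extChartAt_target (f p)))
  rw [hfd p hpO] at h5
  replace h5 := h5.trans (congrArg (fun A => ContinuousAlternatingMap.compContinuousLinearMap A
    (fderivWithin ℝ (extChartAt I (f p) ∘ f) S p)) h7)
  rw [pullbackForm_eq_inChart β ((hf p hp).mdifferentiableWithinAt (by simp)) (hS p hp) hxs]
  refine Eq.trans ?_ h5
  have h6 : extDerivWithin (pullbackForm I f S α) S p =
      extDerivWithin (pullbackForm I f S α) (O ∩ S) p := by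
    rw [extDerivWithin, extDerivWithin, inter_comm, fderivWithin_inter (hO.mem_nhds hpO)]
  rw [h6]
  refine extDerivWithin_congr' (fun q hq => ?_) ⟨hpO, hp⟩
  rw [hfd q hq.1]
  exact pullbackForm_eq_inChart α ((hf q hq.2).mdifferentiableWithinAt (by simp)) (hS q hq.2)
    (hOS hq)

end Pullback

/-! ### Embedded submanifolds -/

section Embedded

variable {E' : Type*} [NormedAddCommGroup E'] [NormedSpace ℝ E'] {H' : Type*} [TopologicalSpace H']
  {I' : ModelWithCorners ℝ E' H'} {M : Type*} [TopologicalSpace M] [ChartedSpace H' M]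
  {E : Type*} [NormedAddCommGroup E] [NormedSpace ℝ E]
  {H : Type*} [TopologicalSpace H] {I : ModelWithCorners ℝ E H} [I.Boundaryless]
  {L : Type*} [TopologicalSpace L] [ChartedSpace H L]

/-- A smooth local retraction onto an embedded submanifold. -/
theorem Manifold.IsSmoothEmbedding.exists_retraction {ι : L → M}
    (hι : IsSmoothEmbedding I I' ∞ ι) (p : L) :
    ∃ (V : Set M) (r : M → L), IsOpen V ∧ ι p ∈ V ∧ ContMDiffOn I' I ∞ r V ∧
      ∀ z ∈ V, z ∈ range ι → ι (r z) = z := by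
  have h : IsImmersionAt I I' ∞ ι p := hι.isImmersion.isImmersionAt p
  -- This is where an embedding is needed rather than an immersion: within `W` only points of the
  -- chart domain around `p` occur, so no other sheet of `L` interferes.
  obtain ⟨W, hW, hWs⟩ := hι.isEmbedding.isOpen_iff.1 h.domChart.open_source
  -- In charts adapted to the immersion, `ι` is `u ↦ (u, 0)`. The retraction forgets the transverse
  -- coordinate.
  set g : M → E := fun z => (h.equiv.symm (h.codChart.extend I' z)).1 with hg
  have hgs : ContMDiffOn I' 𝓘(ℝ, E) ∞ g h.codChart.source := by
    have h1 := OpenPartialHomeomorph.contMDiffOn_extend (I := I') h.codChart_mem_maximalAtlas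
    have h2 : ContDiff ℝ ∞ fun u : E' => (h.equiv.symm u).1 :=
      contDiff_fst.comp h.equiv.symm.contDiff
    exact h2.contMDiff.comp_contMDiffOn h1
  have hgι : ∀ q ∈ h.domChart.source, g (ι q) = h.domChart.extend I q := by
    intro q hq
    have hq' : q ∈ (h.domChart.extend I).source := by rwa [OpenPartialHomeomorph.extend_source]
    have h1 := h.writtenInCharts ((h.domChart.extend I).map_source hq')
    simp only [Function.comp_apply, (h.domChart.extend I).left_inv hq'] at h1
    rw [hg]
    simp only [h1, ContinuousLinearEquiv.symm_apply_apply]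
  have hpos : IsOpen (h.codChart.source ∩ g ⁻¹' (h.domChart.extend I).target) :=
    hgs.continuousOn.isOpen_inter_preimage h.codChart.open_source
      (h.domChart.isOpen_extend_target (I := I))
  refine ⟨h.codChart.source ∩ g ⁻¹' (h.domChart.extend I).target ∩ W,
    fun z => (h.domChart.extend I).symm (g z), hpos.inter hW, ⟨⟨h.mem_codChart_source, ?_⟩, ?_⟩,
    ?_, ?_⟩
  · rw [mem_preimage, hgι p h.mem_domChart_source]
    refine (h.domChart.extend I).map_source ?_
    rw [OpenPartialHomeomorph.extend_source]
    exact h.mem_domChart_source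
  · have := h.mem_domChart_source
    rwa [← hWs] at this
  · refine (contMDiffOn_extend_symm h.domChart_mem_maximalAtlas).comp
      (hgs.mono fun z hz => hz.1.1) fun z hz => ?_
    have := hz.1.2
    rw [OpenPartialHomeomorph.extend_target'] at this
    exact this
  · rintro _ hz ⟨q, rfl⟩
    have hq : q ∈ h.domChart.source := by
      rw [← hWs]
      exact hz.2
    simp only [hgι q hq]
    rw [(h.domChart.extend I).left_inv (by rwa [OpenPartialHomeomorph.extend_source])]

/-- A curve in `M` with values in an embedded submanifold lifts to it. -/
theorem Manifold.IsSmoothEmbedding.exists_lift {ι : L → M} (hι : IsSmoothEmbedding I I' ∞ ι)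
    {γ : ℝ → M} (hγ : MDifferentiableAt 𝓘(ℝ, ℝ) I' γ 0) (h : ∀ᶠ s in 𝓝 0, γ s ∈ range ι) :
    ∃ ρ : ℝ → L, MDifferentiableAt 𝓘(ℝ, ℝ) I ρ 0 ∧ ∀ᶠ s in 𝓝 0, ι (ρ s) = γ s := by
  obtain ⟨p, hp⟩ := h.self_of_nhds
  obtain ⟨V, r, hV, hpV, hr, hrV⟩ := hι.exists_retraction p
  rw [hp] at hpV
  refine ⟨r ∘ γ, ?_, ?_⟩
  · exact (((hr _ hpV).contMDiffAt (hV.mem_nhds hpV)).mdifferentiableAt (by simp)).comp 0 hγ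
  · filter_upwards [h, hγ.continuousAt.preimage_mem_nhds (hV.mem_nhds hpV)] with s h1 h2
    exact hrV _ h2 h1

end Embedded

/-! ### Boundary points and tangential curves in half-space charts. -/

section Boundary

variable {d : ℕ} [NeZero d]
  {N : Type*} [TopologicalSpace N] [ChartedSpace (EuclideanHalfSpace d) N]

/-- The points of the target of a chart with vanishing first coordinate parametrize the
boundary. -/
theorem symm_mem_boundary [IsManifold (𝓡∂ d) ∞ N] {x₀ : N} {y : EuclideanSpace ℝ (Fin d)}
    (hy : y ∈ (extChartAt (𝓡∂ d) x₀).target) (hy0 : y 0 = 0) :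
    (extChartAt (𝓡∂ d) x₀).symm y ∈ (𝓡∂ d).boundary N := by
  have h1 := (extChartAt (𝓡∂ d) x₀).map_target hy
  rw [extChartAt_source] at h1
  refine ((𝓡∂ d).isBoundaryPoint_iff_of_mem_atlas (n := ∞) (by simp)
    (chart_mem_atlas _ x₀) h1).2 ?_
  have h2 : (chartAt (EuclideanHalfSpace d) x₀).extend (𝓡∂ d) ((extChartAt (𝓡∂ d) x₀).symm y) = y :=
    (extChartAt (𝓡∂ d) x₀).right_inv hy
  refine ⟨subset_closure ?_, fun h3 => ?_⟩
  · rw [h2]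
    exact hy
  · rw [h2] at h3
    have h4 : y ∈ frontier (range (𝓡∂ d)) := by
      rw [frontier_range_modelWithCornersEuclideanHalfSpace]
      exact hy0.symm
    exact h4.2 (interior_mono (extChartAt_target_subset_range x₀) h3)

/-- Supplies curves that stay in `∂N` and have the tangential coordinate directions as velocities;
their images under maps of pairs are curves in `L`. -/
theorem eventually_add_smul_mem_target {x₀ : N} {y : EuclideanSpace ℝ (Fin d)}
    (hy : y ∈ (extChartAt (𝓡∂ d) x₀).target) (hy0 : y 0 = 0) {j : Fin d} (hj : j ≠ 0) :
    ∀ᶠ s : ℝ in 𝓝 0, y + s • stdVec j ∈ (extChartAt (𝓡∂ d) x₀).target ∧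
      (y + s • stdVec j) 0 = 0 := by
  have h0 : ∀ s : ℝ, (y + s • stdVec j) 0 = 0 := by
    intro s
    simp [hy0, stdVec, hj.symm]
  have hc : Filter.Tendsto (fun s : ℝ => y + s • (stdVec j : EuclideanSpace ℝ (Fin d))) (𝓝 0)
      (𝓝[range (𝓡∂ d)] y) := by
    refine tendsto_nhdsWithin_iff.2 ⟨?_, Filter.Eventually.of_forall fun s => ?_⟩
    · have : Continuous fun s : ℝ => y + s • (stdVec j : EuclideanSpace ℝ (Fin d)) := by fun_prop
      simpa using this.tendsto 0
    · rw [range_halfSpace]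
      exact (h0 s).ge
  have h1 := extChartAt_target_mem_nhdsWithin_of_mem hy
  filter_upwards [hc h1] with s hs
  exact ⟨hs, h0 s⟩

end Boundary

/-! ### Energies as integrals of traces -/

section Energies

open Complexified

variable {d : ℕ} {H : Type*} [TopologicalSpace H]
  {I : ModelWithCorners ℝ (EuclideanSpace ℝ (Fin d)) H}
  {N : Type*} [TopologicalSpace N] [ChartedSpace H N] [IsManifold I ∞ N]
  {E' : Type*} [NormedAddCommGroup E'] [NormedSpace ℝ E'] {H' : Type*} [TopologicalSpace H']
  {I' : ModelWithCorners ℝ E' H'}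
  {M : Type*} [TopologicalSpace M] [ChartedSpace H' M] [IsManifold I' ∞ M]

omit [IsManifold I' ∞ M] in
theorem pullbackForm_pair {F : Type*} [NormedAddCommGroup F] [NormedSpace ℝ F] (f : F → M)
    (S : Set F) (α : DiffForm I' M 2) (p v w : F) :
    pullbackForm I' f S α p ![v, w] =
      α (f p) ![mfderivWithin 𝓘(ℝ, F) I' f S p v, mfderivWithin 𝓘(ℝ, F) I' f S p w] := by
  refine congrArg (α (f p)) ?_
  ext k
  fin_cases k <;> rfl

theorem contract_pullbackOmega_symm (KN : AlmostKahler I N) (KM : AlmostKahler I' M) {φ : N → M}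
    (hφ : ContMDiff I I' ∞ φ) {x₀ : N} {y : EuclideanSpace ℝ (Fin d)}
    (hy : y ∈ (extChartAt I x₀).target) :
    KN.contract _ (pullbackOmega KM φ ((extChartAt I x₀).symm y)) =
      ∑ i, ∑ j, -((omegaInChart KN x₀ y)⁻¹ i j) *
        pullbackForm I' (fun z => φ ((extChartAt I x₀).symm z)) (extChartAt I x₀).target KM.omega y
          ![stdVec i, stdVec j] := by
  rw [contract_eq_sum KN hy]
  refine Finset.sum_congr rfl fun i _ => Finset.sum_congr rfl fun j _ => congrArg _ ?_
  rw [pullbackOmega_apply, pullbackForm_pair,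
    mfderiv_chartSymmDeriv hy (hφ.mdifferentiable (by simp) _),
    mfderiv_chartSymmDeriv hy (hφ.mdifferentiable (by simp) _)]

omit [IsManifold I ∞ N] in
theorem continuous_of_comp_symm {f : N → ℝ}
    (hf : ∀ x₀, ContinuousOn (fun y => f ((extChartAt I x₀).symm y)) (extChartAt I x₀).target) :
    Continuous f :=
  continuous_iff_continuousAt.2 fun x =>
    (continuousOn_source_of_comp_symm (hf x)).continuousAt (extChartAt_source_mem_nhds x)

theorem continuous_contract_pullbackOmega (KN : AlmostKahler I N) (KM : AlmostKahler I' M)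
    {φ : N → M} (hφ : ContMDiff I I' ∞ φ) :
    Continuous fun x => KN.contract x (pullbackOmega KM φ x) := by
  refine continuous_of_comp_symm (I := I) fun x₀ => ?_
  refine ContinuousOn.congr ?_ fun y hy => contract_pullbackOmega_symm KN KM hφ hy
  refine continuousOn_finsetSum _ fun i _ => continuousOn_finsetSum _ fun j _ =>
    (continuousOn_omegaInChart_inv KN x₀ i j).neg.mul ?_
  exact (contDiffOn_pullbackForm_apply KM.omega_smooth (hφ.comp_contMDiffOn (contMDiffOn_symm x₀))
    (uniqueDiffOn_target x₀) _).continuousOn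

theorem continuousOn_gramInChart_inv (g : ContMDiffRiemannianMetric I ∞ (EuclideanSpace ℝ (Fin d))
      (fun x : N => TangentSpace I x)) (x₀ : N) (i j : Fin d) :
    ContinuousOn (fun y => (gramInChart g x₀ y)⁻¹ i j) (extChartAt I x₀).target := by
  have h := continuousOn_gramInChart g x₀
  simp only [Matrix.inv_def, Ring.inverse_eq_inv', Matrix.smul_apply, smul_eq_mul]
  refine ContinuousOn.mul (ContinuousOn.inv₀ ?_ fun y hy => (det_gramInChart_pos g hy).ne') ?_
  · exact (continuous_id.matrix_det).comp_continuousOn h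
  · exact ((continuous_id.matrix_adjugate).matrix_elem i j).comp_continuousOn h

theorem continuous_metricTrace_pullbackMetric (KN : AlmostKahler I N) (KM : AlmostKahler I' M)
    {φ : N → M} (hφ : ContMDiff I I' ∞ φ) :
    Continuous fun x => metricTrace (KN.bilin x) (pullbackMetric KM φ x) := by
  refine continuous_of_comp_symm (I := I) fun x₀ => ?_
  refine ContinuousOn.congr ?_ fun y hy => metricTrace_eq_sum KN hy _
  refine continuousOn_finsetSum _ fun i _ => continuousOn_finsetSum _ fun j _ =>
    (continuousOn_gramInChart_inv KN.metric x₀ i j).mul ?_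
  refine (continuousOn_inner_mfderivWithin KM.metric
    (hφ.comp_contMDiffOn (contMDiffOn_symm x₀)) (uniqueDiffOn_target x₀) (stdVec i)
    (stdVec j)).congr fun y hy => ?_
  have h := fun v => mfderiv_chartSymmDeriv hy (hφ.mdifferentiable (by simp) _) v
  change KM.metric.inner _ (mfderiv I I' φ _ (chartSymmDeriv I x₀ y (stdVec i)))
    (mfderiv I I' φ _ (chartSymmDeriv I x₀ y (stdVec j))) = _
  rw [h, h]
  rfl

variable [CompactSpace N] [MeasurableSpace N] [BorelSpace N]

/-- Compactness and finite volume; this licenses splitting `E'` and `E''` into a metric and a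
symplectic integral. -/
theorem integrable_of_continuous (g : ContMDiffRiemannianMetric I ∞ (EuclideanSpace ℝ (Fin d))
      (fun x : N => TangentSpace I x)) {f : N → ℝ} (hf : Continuous f) :
    Integrable f (riemannianVolume g) := by
  have := isFiniteMeasure_riemannianVolume g
  exact hf.integrable_of_hasCompactSupport (HasCompactSupport.of_compactSpace f)

omit [CompactSpace N] [BorelSpace N] in
theorem energy_eq (KN : AlmostKahler I N) (KM : AlmostKahler I' M) {φ : N → M} : energy KN KM φ = (1 / 2) *
    ∫ x, metricTrace (KN.bilin x) (pullbackMetric KM φ x) ∂(riemannianVolume KN.metric) := by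
  rw [energy, ← integral_const_mul]
  refine integral_congr_ae (Filter.Eventually.of_forall fun x => ?_)
  simp only [energyDensity, energyDensity10_eq, energyDensity01_eq]
  ring

variable (KN : AlmostKahler I N) (KM : AlmostKahler I' M) {φ : N → M} (hφ : ContMDiff I I' ∞ φ)
include hφ

theorem energy10_eq : energy10 KN KM φ = (1 / 4) *
    (∫ x, metricTrace (KN.bilin x) (pullbackMetric KM φ x) ∂(riemannianVolume KN.metric) +
      ∫ x, KN.contract x (pullbackOmega KM φ x) ∂(riemannianVolume KN.metric)) := by
  rw [energy10, ← integral_add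
    (integrable_of_continuous _ (continuous_metricTrace_pullbackMetric KN KM hφ))
    (integrable_of_continuous _ (continuous_contract_pullbackOmega KN KM hφ)),
    ← integral_const_mul]
  exact integral_congr_ae (Filter.Eventually.of_forall fun x => energyDensity10_eq KN KM φ x)

theorem energy01_eq : energy01 KN KM φ = (1 / 4) *
    (∫ x, metricTrace (KN.bilin x) (pullbackMetric KM φ x) ∂(riemannianVolume KN.metric) -
      ∫ x, KN.contract x (pullbackOmega KM φ x) ∂(riemannianVolume KN.metric)) := by
  rw [energy01, ← integral_sub
    (integrable_of_continuous _ (continuous_metricTrace_pullbackMetric KN KM hφ))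
    (integrable_of_continuous _ (continuous_contract_pullbackOmega KN KM hφ)),
    ← integral_const_mul]
  exact integral_congr_ae (Filter.Eventually.of_forall fun x => energyDensity01_eq KN KM φ x)

end Energies

/-! ### Curves in Lagrangian submanifolds -/

section Curves

variable {F : Type*} [NormedAddCommGroup F] [NormedSpace ℝ F]
  {E' : Type*} [NormedAddCommGroup E'] [NormedSpace ℝ E'] {H' : Type*} [TopologicalSpace H']
  {I' : ModelWithCorners ℝ E' H'}
  {M : Type*} [TopologicalSpace M] [ChartedSpace H' M]

/-- A chain rule in which `g` needs to enter `S` only near `q`. The derivatives are compared in the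
model space, since their tangent spaces sit at the formally different points `f (g q)` and `f p`. -/
theorem mfderivWithin_comp_eq {F' : Type*} [NormedAddCommGroup F'] [NormedSpace ℝ F']
    {f : F → M} {S : Set F} {g : F' → F} {g' : F' →L[ℝ] F} {S' : Set F'} {q : F'} {p : F}
    (hp : g q = p) (hf : MDifferentiableWithinAt 𝓘(ℝ, F) I' f S p)
    (hg : HasFDerivWithinAt g g' S' q) (hS' : UniqueDiffWithinAt ℝ S' q)
    (hgS : ∀ᶠ z in 𝓝[S'] q, g z ∈ S) (v : F') :
    MDifferentiableWithinAt 𝓘(ℝ, F') I' (fun z => f (g z)) S' q ∧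
    (show E' from mfderivWithin 𝓘(ℝ, F') I' (fun z => f (g z)) S' q v) =
      (show E' from mfderivWithin 𝓘(ℝ, F) I' f S p (g' v)) := by
  subst hp
  have h1 := hf.hasMFDerivWithinAt.comp q (hg.hasMFDerivWithinAt.mono (inter_subset_left (t := g ⁻¹' S)))
    inter_subset_right
  have h := (hasMFDerivWithinAt_inter' hgS).1 h1
  exact ⟨h.mdifferentiableWithinAt,
    congrArg (fun A => A v) (h.mfderivWithin hS'.uniqueMDiffWithinAt)⟩

theorem mfderiv_curve_eq {f : F → M} {S : Set F} {c : ℝ → F} {u : F} {t : ℝ} {p : F}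
    (hp : c t = p) (hf : MDifferentiableWithinAt 𝓘(ℝ, F) I' f S p)
    (hc : HasDerivAt c u t) (hcS : ∀ᶠ s in 𝓝 t, c s ∈ S) :
    MDifferentiableAt 𝓘(ℝ, ℝ) I' (fun s => f (c s)) t ∧
    (show E' from mfderiv 𝓘(ℝ, ℝ) I' (fun s => f (c s)) t (1 : ℝ)) =
      (show E' from mfderivWithin 𝓘(ℝ, F) I' f S p u) := by
  have h := mfderivWithin_comp_eq hp hf (S' := univ) hc.hasFDerivAt.hasFDerivWithinAt
    uniqueDiffWithinAt_univ (by rwa [nhdsWithin_univ]) 1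
  rw [mdifferentiableWithinAt_univ, mfderivWithin_univ] at h
  refine ⟨h.1, h.2.trans ?_⟩
  rw [ContinuousLinearMap.toSpanSingleton_apply, one_smul]

variable {E : Type*} [NormedAddCommGroup E] [NormedSpace ℝ E]
  {H : Type*} [TopologicalSpace H] {I : ModelWithCorners ℝ E H} [I.Boundaryless]
  {L : Type*} [TopologicalSpace L] [ChartedSpace H L]

/-- The derivative of a map in the direction of a curve that it maps to an embedded submanifold is
tangent to the submanifold. -/
theorem Manifold.IsSmoothEmbedding.exists_mfderivWithin_eq {ι : L → M}
    (hι : IsSmoothEmbedding I I' ∞ ι) {f : F → M} {S : Set F} {c : ℝ → F} {u p : F}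
    (hp : c 0 = p) (hf : MDifferentiableWithinAt 𝓘(ℝ, F) I' f S p)
    (hc : HasDerivAt c u 0) (hcS : ∀ᶠ s in 𝓝 0, c s ∈ S ∧ f (c s) ∈ range ι) :
    ∃ ρ : ℝ → L, MDifferentiableAt 𝓘(ℝ, ℝ) I ρ 0 ∧ (∀ᶠ s in 𝓝 0, ι (ρ s) = f (c s)) ∧
      ι (ρ 0) = f p ∧
      (show E' from mfderivWithin 𝓘(ℝ, F) I' f S p u) =
        (show E' from mfderiv I I' ι (ρ 0) (mfderiv 𝓘(ℝ, ℝ) I ρ 0 (1 : ℝ))) := by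
  obtain ⟨h1, h2⟩ := mfderiv_curve_eq hp hf hc (hcS.mono fun _ h => h.1)
  obtain ⟨ρ, hρ, hρf⟩ := hι.exists_lift h1 (hcS.mono fun _ h => h.2)
  refine ⟨ρ, hρ, hρf, hρf.self_of_nhds.trans (congrArg f hp), h2.symm.trans ?_⟩
  have h3 : HasMFDerivAt 𝓘(ℝ, ℝ) I' (ι ∘ ρ) 0 _ :=
    ((hι.contMDiff.mdifferentiable (by simp) (ρ 0)).hasMFDerivAt).comp 0 hρ.hasMFDerivAt
  have h4 : (fun s => f (c s)) =ᶠ[𝓝 0] ι ∘ ρ := hρf.mono fun s hs => hs.symm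
  exact congrArg (fun A : ℝ →L[ℝ] E' => A 1) ((h3.congr_of_eventuallyEq h4).mfderiv)

variable {m : ℕ} {M : Type*} [TopologicalSpace M]
    [ChartedSpace (EuclideanSpace ℝ (Fin (2 * m))) M] [IsManifold (𝓡 (2 * m)) ∞ M]
    {K : AlmostKahler (𝓡 (2 * m)) M}
    {L : Type*} [TopologicalSpace L] [ChartedSpace (EuclideanSpace ℝ (Fin m)) L] {ι : L → M}

/-- The symplectic form vanishes on two tangent directions of curves in a Lagrangian
submanifold. -/
theorem IsLagrangian.pullbackForm_omega_eq_zero (hL : IsLagrangian K ι) {f : F → M} {S : Set F}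
    {c c' : ℝ → F} {u u' p : F} (hp : c 0 = p) (hp' : c' 0 = p)
    (hf : MDifferentiableWithinAt 𝓘(ℝ, F) (𝓡 (2 * m)) f S p)
    (hc : HasDerivAt c u 0) (hcS : ∀ᶠ s in 𝓝 0, c s ∈ S ∧ f (c s) ∈ range ι)
    (hc' : HasDerivAt c' u' 0) (hcS' : ∀ᶠ s in 𝓝 0, c' s ∈ S ∧ f (c' s) ∈ range ι) :
    pullbackForm (𝓡 (2 * m)) f S K.omega p ![u, u'] = 0 := by
  obtain ⟨ρ, -, -, h1, h2⟩ := hL.isSmoothEmbedding.exists_mfderivWithin_eq hp hf hc hcS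
  obtain ⟨σ, -, -, h3, h4⟩ := hL.isSmoothEmbedding.exists_mfderivWithin_eq hp' hf hc' hcS'
  -- Both lifted curves start at the same point of `L`, so their velocities can be inserted together
  -- into the isotropy condition there.
  have h5 : σ 0 = ρ 0 := hL.isSmoothEmbedding.isEmbedding.injective (h3.trans h1.symm)
  obtain ⟨w, h6⟩ : ∃ w : TangentSpace (𝓡 m) (ρ 0),
      (show EuclideanSpace ℝ (Fin (2 * m)) from
        mfderiv (𝓡 m) (𝓡 (2 * m)) ι (σ 0) (mfderiv 𝓘(ℝ, ℝ) (𝓡 m) σ 0 (1 : ℝ))) =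
      (show EuclideanSpace ℝ (Fin (2 * m)) from mfderiv (𝓡 m) (𝓡 (2 * m)) ι (ρ 0) w) := by
    generalize (mfderiv 𝓘(ℝ, ℝ) (𝓡 m) σ 0 (1 : ℝ)) = w'
    revert w'
    rw [h5]
    exact fun w' => ⟨w', rfl⟩
  rw [pullbackForm_pair]
  have h7 := hL.isotropic (ρ 0) (mfderiv 𝓘(ℝ, ℝ) (𝓡 m) ρ 0 (1 : ℝ)) w
  rw [← h7]
  have h8 := tangent_congr₂ (fun x v w => K.omega x ![v, w]) h1.symm
    (show EuclideanSpace ℝ (Fin (2 * m)) from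
      mfderivWithin 𝓘(ℝ, F) (𝓡 (2 * m)) f S p u)
    (show EuclideanSpace ℝ (Fin (2 * m)) from
      mfderivWithin 𝓘(ℝ, F) (𝓡 (2 * m)) f S p u')
  rw [h4.trans h6, h2] at h8
  refine Eq.trans ?_ h8
  rw [← h2, ← h4.trans h6]

end Curves

/-! ### Families of maps in charts -/

section Families

variable {E' : Type*} [NormedAddCommGroup E'] [NormedSpace ℝ E'] {H' : Type*} [TopologicalSpace H']
  {I' : ModelWithCorners ℝ E' H'}
  {M : Type*} [TopologicalSpace M] [ChartedSpace H' M]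
  {d : ℕ} {H : Type*} [TopologicalSpace H]
  {I : ModelWithCorners ℝ (EuclideanSpace ℝ (Fin d)) H}
  {N : Type*} [TopologicalSpace N] [ChartedSpace H N]

/-- A family of maps in a chart of the source. -/
def familyInChart (I : ModelWithCorners ℝ (EuclideanSpace ℝ (Fin d)) H) (φ : ℝ → N → M) (x₀ : N)
    (q : ℝ × EuclideanSpace ℝ (Fin d)) : M :=
  φ q.1 ((extChartAt I x₀).symm q.2)

/-- The domain of a family of maps in a chart of the source. -/
def familyDomain (I : ModelWithCorners ℝ (EuclideanSpace ℝ (Fin d)) H) (x₀ : N) :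
    Set (ℝ × EuclideanSpace ℝ (Fin d)) :=
  Icc (0 : ℝ) 1 ×ˢ (extChartAt I x₀).target

theorem uniqueDiffOn_familyDomain (x₀ : N) : UniqueDiffOn ℝ (familyDomain I x₀) :=
  (uniqueDiffOn_Icc zero_lt_one).prod (uniqueDiffOn_target x₀)

/-- The domain includes faces in time and space, so this is what makes `extDerivWithin_pullbackForm`
applicable at each of its points. -/
theorem familyDomain_subset_closure_interior (x₀ : N) :
    familyDomain I x₀ ⊆ closure (interior (familyDomain I x₀)) := by
  rw [familyDomain, interior_prod_eq, closure_prod_eq, interior_Icc,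
    closure_Ioo zero_ne_one]
  exact prod_mono subset_rfl extChartAt_target_subset_closure_interior

variable [IsManifold I ∞ N] {φ : ℝ → N → M}
  (hφ : ContMDiffOn (𝓘(ℝ, ℝ).prod I) I' ∞ (fun p : ℝ × N => φ p.1 p.2) (Icc (0 : ℝ) 1 ×ˢ univ))
include hφ

theorem contMDiffOn_familyInChart (x₀ : N) :
    ContMDiffOn 𝓘(ℝ, ℝ × EuclideanSpace ℝ (Fin d)) I' ∞ (familyInChart I φ x₀)
      (familyDomain I x₀) := by
  have h1 : ContMDiffOn 𝓘(ℝ, ℝ × EuclideanSpace ℝ (Fin d)) (𝓘(ℝ, ℝ).prod I) ∞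
      (fun q : ℝ × EuclideanSpace ℝ (Fin d) => (q.1, (extChartAt I x₀).symm q.2))
      (familyDomain I x₀) := by
    refine ContMDiffOn.prodMk contDiff_fst.contMDiff.contMDiffOn ?_
    exact (contMDiffOn_symm x₀).comp contDiff_snd.contMDiff.contMDiffOn fun q hq => hq.2
  exact hφ.comp h1 fun q hq => ⟨hq.1, mem_univ _⟩

omit [IsManifold I ∞ N] in
theorem contMDiff_slice {t : ℝ} (ht : t ∈ Icc (0 : ℝ) 1) : ContMDiff I I' ∞ (φ t) := by
  rw [← contMDiffOn_univ]
  exact hφ.comp ((contMDiff_const.prodMk contMDiff_id).contMDiffOn (s := univ))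
    fun x _ => ⟨ht, mem_univ _⟩

theorem mfderivWithin_slice {x₀ : N} {t : ℝ} (ht : t ∈ Icc (0 : ℝ) 1)
    {y : EuclideanSpace ℝ (Fin d)} (hy : y ∈ (extChartAt I x₀).target)
    (v : EuclideanSpace ℝ (Fin d)) :
    mfderivWithin 𝓘(ℝ, EuclideanSpace ℝ (Fin d)) I' (fun z => φ t ((extChartAt I x₀).symm z))
        (extChartAt I x₀).target y v =
      mfderivWithin 𝓘(ℝ, ℝ × EuclideanSpace ℝ (Fin d)) I' (familyInChart I φ x₀)
        (familyDomain I x₀) (t, y) ((0, v) : ℝ × EuclideanSpace ℝ (Fin d)) := by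
  have h := (contMDiffOn_familyInChart hφ x₀ (t, y) ⟨ht, hy⟩).mdifferentiableWithinAt (by simp)
  exact (mfderivWithin_comp_eq (g := fun z => (t, z)) rfl h
    (hasFDerivAt_prodMk_right t y).hasFDerivWithinAt (uniqueDiffOn_target x₀ y hy)
    (Filter.eventually_of_mem self_mem_nhdsWithin fun z hz => ⟨ht, hz⟩) v).2

/-- The left side is a two-sided derivative in time, which forces `t` into the open interval: the
family is controlled only for times in `[0, 1]`. -/
theorem mfderiv_time {x₀ : N} {t : ℝ} (ht : t ∈ Ioo (0 : ℝ) 1)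
    {y : EuclideanSpace ℝ (Fin d)} (hy : y ∈ (extChartAt I x₀).target) :
    mfderiv 𝓘(ℝ, ℝ) I' (fun s => φ s ((extChartAt I x₀).symm y)) t (1 : ℝ) =
      mfderivWithin 𝓘(ℝ, ℝ × EuclideanSpace ℝ (Fin d)) I' (familyInChart I φ x₀)
        (familyDomain I x₀) (t, y) ((1, 0) : ℝ × EuclideanSpace ℝ (Fin d)) := by
  have h := (contMDiffOn_familyInChart hφ x₀ (t, y)
    ⟨Ioo_subset_Icc_self ht, hy⟩).mdifferentiableWithinAt (by simp)
  exact (mfderiv_curve_eq (c := fun s => (s, y)) rfl h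
    ((hasDerivAt_id t).prodMk (hasDerivAt_const t y))
    (Filter.eventually_of_mem (Icc_mem_nhds ht.1 ht.2) fun z hz => ⟨hz, hy⟩)).2

end Families

/-! ### The contraction along a family of maps -/

section AlongFamilies

section General

variable {d : ℕ} {H : Type*} [TopologicalSpace H]
  {I : ModelWithCorners ℝ (EuclideanSpace ℝ (Fin d)) H}
  {N : Type*} [TopologicalSpace N] [ChartedSpace H N] [IsManifold I ∞ N]

theorem omegaInChart_inv_swap (K : AlmostKahler I N) (x₀ : N) (y : EuclideanSpace ℝ (Fin d))
    (i j : Fin d) : (omegaInChart K x₀ y)⁻¹ i j = -(omegaInChart K x₀ y)⁻¹ j i := by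
  have h1 : (omegaInChart K x₀ y).transpose = -omegaInChart K x₀ y := by
    ext i j
    exact omegaInChart_swap K x₀ y j i
  have h2 : ((omegaInChart K x₀ y)⁻¹).transpose = -(omegaInChart K x₀ y)⁻¹ := by
    rw [Matrix.transpose_nonsing_inv, h1]
    by_cases h : IsUnit (omegaInChart K x₀ y).det
    · refine Matrix.inv_eq_left_inv ?_
      rw [neg_mul_neg, Matrix.nonsing_inv_mul _ h]
    · rw [Matrix.nonsing_inv_apply_not_isUnit _ h, neg_zero,
        Matrix.nonsing_inv_apply_not_isUnit]
      rwa [← h1, Matrix.det_transpose]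
  exact congrFun (congrFun h2 j) i

/-- An antisymmetric matrix sees only the antisymmetric part of `B`. With `B i j = ∂ᵢbⱼ` this passes
from the components of `db` to the expression in `bivectorDeriv`, at the cost of a factor `2`. -/
theorem sum_omegaInChart_inv_mul_sub (K : AlmostKahler I N) (x₀ : N)
    (y : EuclideanSpace ℝ (Fin d)) (B : Fin d → Fin d → ℝ) :
    ∑ i, ∑ j, -((omegaInChart K x₀ y)⁻¹ i j) * (B i j - B j i) =
      ∑ i, ∑ j, -((omegaInChart K x₀ y)⁻¹ i j) * (2 * B i j) := by
  have h : ∑ i, ∑ j, -((omegaInChart K x₀ y)⁻¹ i j) * B j i =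
      -∑ i, ∑ j, -((omegaInChart K x₀ y)⁻¹ i j) * B i j := by
    rw [Finset.sum_comm, ← Finset.sum_neg_distrib]
    refine Finset.sum_congr rfl fun i _ => ?_
    rw [← Finset.sum_neg_distrib]
    refine Finset.sum_congr rfl fun j _ => ?_
    rw [omegaInChart_inv_swap K x₀ y j i]
    ring
  have h2 : ∑ i, ∑ j, -((omegaInChart K x₀ y)⁻¹ i j) * (2 * B i j) =
      2 * ∑ i, ∑ j, -((omegaInChart K x₀ y)⁻¹ i j) * B i j := by
    simp only [Finset.mul_sum]
    exact Finset.sum_congr rfl fun i _ => Finset.sum_congr rfl fun j _ => by ring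
  simp only [mul_sub, Finset.sum_sub_distrib]
  rw [h, h2]
  ring

omit [IsManifold I ∞ N] in
theorem fderivWithin_apply_const {F G : Type*} [NormedAddCommGroup F] [NormedSpace ℝ F]
    [NormedAddCommGroup G] [NormedSpace ℝ G] {b : F → G →L[ℝ] ℝ} {T : Set F} {y : F}
    (hb : DifferentiableWithinAt ℝ b T y) (hT : UniqueDiffWithinAt ℝ T y) (u : F) (v : G) :
    fderivWithin ℝ b T y u v = fderivWithin ℝ (fun z => b z v) T y u := by
  rw [fderivWithin_clm_apply hT hb (differentiableWithinAt_const v)]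
  simp

omit [IsManifold I ∞ N] in
theorem continuousOn_of_comp_symm {G : ℝ × N → ℝ}
    (hG : ∀ x₀, ContinuousOn (fun q : ℝ × EuclideanSpace ℝ (Fin d) =>
      G (q.1, (extChartAt I x₀).symm q.2)) (familyDomain I x₀)) :
    ContinuousOn G (Icc (0 : ℝ) 1 ×ˢ univ) := by
  rintro ⟨t, x⟩ ⟨ht, -⟩
  have h1 : ContinuousOn (fun p : ℝ × N => (p.1, extChartAt I x p.2))
      (Icc (0 : ℝ) 1 ×ˢ (extChartAt I x).source) :=
    continuousOn_fst.prodMk ((continuousOn_extChartAt x).comp continuousOn_snd fun p hp => hp.2)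
  have h2 := (hG x).comp h1 fun p hp => ⟨hp.1, (extChartAt I x).map_source hp.2⟩
  have h3 : ContinuousOn G (Icc (0 : ℝ) 1 ×ˢ (extChartAt I x).source) := by
    refine h2.congr fun p hp => ?_
    rw [Function.comp_apply, (extChartAt I x).left_inv hp.2]
  refine (h3 (t, x) ⟨ht, mem_extChartAt_source x⟩).mono_of_mem_nhdsWithin ?_
  rw [nhdsWithin_prod_eq, nhdsWithin_univ]
  exact Filter.prod_mem_prod self_mem_nhdsWithin (extChartAt_source_mem_nhds x)

variable {E' : Type*} [NormedAddCommGroup E'] [NormedSpace ℝ E'] {H' : Type*} [TopologicalSpace H']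
  {I' : ModelWithCorners ℝ E' H'}
  {M : Type*} [TopologicalSpace M] [ChartedSpace H' M] [IsManifold I' ∞ M]
  (KN : AlmostKahler I N) (KM : AlmostKahler I' M) {φ : ℝ → N → M}

/-- The coefficients of the pullback of the symplectic form under a family of maps. -/
def omegaFamily (I : ModelWithCorners ℝ (EuclideanSpace ℝ (Fin d)) H) (KM : AlmostKahler I' M)
    (φ : ℝ → N → M) (x₀ : N) (u v : ℝ × EuclideanSpace ℝ (Fin d))
    (q : ℝ × EuclideanSpace ℝ (Fin d)) : ℝ :=
  pullbackForm I' (familyInChart I φ x₀) (familyDomain I x₀) KM.omega q ![u, v]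

variable (hφ : ContMDiffOn (𝓘(ℝ, ℝ).prod I) I' ∞ (fun p : ℝ × N => φ p.1 p.2)
  (Icc (0 : ℝ) 1 ×ˢ univ))
include hφ

theorem contDiffOn_omegaFamily (x₀ : N) (u v : ℝ × EuclideanSpace ℝ (Fin d)) :
    ContDiffOn ℝ ∞ (omegaFamily I KM φ x₀ u v) (familyDomain I x₀) :=
  contDiffOn_pullbackForm_apply KM.omega_smooth (contMDiffOn_familyInChart hφ x₀)
    (uniqueDiffOn_familyDomain x₀) _

theorem contract_family_symm {x₀ : N} {t : ℝ} (ht : t ∈ Icc (0 : ℝ) 1)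
    {y : EuclideanSpace ℝ (Fin d)} (hy : y ∈ (extChartAt I x₀).target) :
    KN.contract _ (pullbackOmega KM (φ t) ((extChartAt I x₀).symm y)) =
      ∑ i, ∑ j, -((omegaInChart KN x₀ y)⁻¹ i j) *
        omegaFamily I KM φ x₀ (0, stdVec i) (0, stdVec j) (t, y) := by
  rw [contract_pullbackOmega_symm KN KM (contMDiff_slice hφ ht) hy]
  refine Finset.sum_congr rfl fun i _ => Finset.sum_congr rfl fun j _ => congrArg _ ?_
  rw [omegaFamily, pullbackForm_pair, pullbackForm_pair, mfderivWithin_slice hφ ht hy,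
    mfderivWithin_slice hφ ht hy]
  rfl

theorem hasDerivWithinAt_omegaFamily {x₀ : N} {t : ℝ} (ht : t ∈ Icc (0 : ℝ) 1)
    {y : EuclideanSpace ℝ (Fin d)} (hy : y ∈ (extChartAt I x₀).target)
    (u v : ℝ × EuclideanSpace ℝ (Fin d)) :
    HasDerivWithinAt (fun s => omegaFamily I KM φ x₀ u v (s, y))
      (fderivWithin ℝ (omegaFamily I KM φ x₀ u v) (familyDomain I x₀) (t, y) (1, 0))
      (Icc 0 1) t := by
  have h1 := ((contDiffOn_omegaFamily KM hφ x₀ u v).differentiableOn (by simp) (t, y)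
    ⟨ht, hy⟩).hasFDerivWithinAt
  have h2 : MapsTo (fun s : ℝ => (s, y)) (Icc (0 : ℝ) 1) (familyDomain I x₀) :=
    fun s hs => ⟨hs, hy⟩
  exact h1.comp_hasDerivWithinAt t
    ((hasDerivWithinAt_id t (Icc 0 1)).prodMk (hasDerivWithinAt_const t (Icc (0 : ℝ) 1) y)) h2

theorem fderivWithin_omegaFamily_slice {x₀ : N} {t : ℝ} (ht : t ∈ Icc (0 : ℝ) 1)
    {y : EuclideanSpace ℝ (Fin d)} (hy : y ∈ (extChartAt I x₀).target)
    (u v : ℝ × EuclideanSpace ℝ (Fin d)) (w : EuclideanSpace ℝ (Fin d)) :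
    fderivWithin ℝ (fun z => omegaFamily I KM φ x₀ u v (t, z)) (extChartAt I x₀).target y w =
      fderivWithin ℝ (omegaFamily I KM φ x₀ u v) (familyDomain I x₀) (t, y) (0, w) := by
  have h1 := ((contDiffOn_omegaFamily KM hφ x₀ u v).differentiableOn (by simp) (t, y)
    ⟨ht, hy⟩).hasFDerivWithinAt
  have h2 := (h1.comp y (hasFDerivAt_prodMk_right t y).hasFDerivWithinAt
    (s := (extChartAt I x₀).target) fun z hz => ⟨ht, hz⟩).fderivWithin (uniqueDiffOn_target x₀ y hy)
  exact congrArg (fun A => A w) h2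

theorem hasDerivWithinAt_contract {x₀ : N} {t : ℝ} (ht : t ∈ Icc (0 : ℝ) 1)
    {y : EuclideanSpace ℝ (Fin d)} (hy : y ∈ (extChartAt I x₀).target) :
    HasDerivWithinAt
      (fun s => KN.contract _ (pullbackOmega KM (φ s) ((extChartAt I x₀).symm y)))
      (∑ i, ∑ j, -((omegaInChart KN x₀ y)⁻¹ i j) *
        fderivWithin ℝ (omegaFamily I KM φ x₀ (0, stdVec i) (0, stdVec j)) (familyDomain I x₀)
          (t, y) (1, 0)) (Icc 0 1) t := by
  refine HasDerivWithinAt.congr ?_ (fun s hs => contract_family_symm KN KM hφ hs hy)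
    (contract_family_symm KN KM hφ ht hy)
  exact HasDerivWithinAt.fun_sum fun i _ => HasDerivWithinAt.fun_sum fun j _ =>
    (hasDerivWithinAt_omegaFamily KM hφ ht hy _ _).const_mul _

/-- The derivative of the contraction along a family of maps. -/
def contractDeriv (KN : AlmostKahler I N) (KM : AlmostKahler I' M) (φ : ℝ → N → M) (t : ℝ)
    (x : N) : ℝ :=
  derivWithin (fun s => KN.contract x (pullbackOmega KM (φ s) x)) (Icc 0 1) t

theorem contractDeriv_symm {x₀ : N} {t : ℝ} (ht : t ∈ Icc (0 : ℝ) 1)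
    {y : EuclideanSpace ℝ (Fin d)} (hy : y ∈ (extChartAt I x₀).target) :
    contractDeriv KN KM φ t ((extChartAt I x₀).symm y) =
      ∑ i, ∑ j, -((omegaInChart KN x₀ y)⁻¹ i j) *
        fderivWithin ℝ (omegaFamily I KM φ x₀ (0, stdVec i) (0, stdVec j)) (familyDomain I x₀)
          (t, y) (1, 0) :=
  (hasDerivWithinAt_contract KN KM hφ ht hy).derivWithin (uniqueDiffOn_Icc zero_lt_one t ht)

theorem hasDerivWithinAt_contractDeriv {t : ℝ} (ht : t ∈ Icc (0 : ℝ) 1) (x : N) :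
    HasDerivWithinAt (fun s => KN.contract x (pullbackOmega KM (φ s) x))
      (contractDeriv KN KM φ t x) (Icc 0 1) t := by
  have h := hasDerivWithinAt_contract KN KM hφ ht (mem_extChartAt_target (I := I) x)
  rw [extChartAt_to_inv (I := I) x] at h
  exact h.differentiableWithinAt.hasDerivWithinAt

theorem continuousOn_contract_family :
    ContinuousOn (fun p : ℝ × N => KN.contract p.2 (pullbackOmega KM (φ p.1) p.2))
      (Icc (0 : ℝ) 1 ×ˢ univ) := by
  refine continuousOn_of_comp_symm (I := I) fun x₀ => ?_
  refine ContinuousOn.congr ?_ fun q hq => contract_family_symm KN KM hφ hq.1 hq.2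
  exact continuousOn_finsetSum _ fun i _ => continuousOn_finsetSum _ fun j _ =>
    ((continuousOn_omegaInChart_inv KN x₀ i j).comp continuousOn_snd fun q hq => hq.2).neg.mul
      (contDiffOn_omegaFamily KM hφ x₀ _ _).continuousOn

/-- Joint continuity on the compact `[0,1] × N` provides the uniform bound for differentiating under
the integral. -/
theorem continuousOn_contractDeriv :
    ContinuousOn (fun p : ℝ × N => contractDeriv KN KM φ p.1 p.2) (Icc (0 : ℝ) 1 ×ˢ univ) := by
  refine continuousOn_of_comp_symm (I := I) fun x₀ => ?_
  refine ContinuousOn.congr ?_ fun q hq => contractDeriv_symm KN KM hφ hq.1 hq.2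
  exact continuousOn_finsetSum _ fun i _ => continuousOn_finsetSum _ fun j _ =>
    ((continuousOn_omegaInChart_inv KN x₀ i j).comp continuousOn_snd fun q hq => hq.2).neg.mul
      (((contDiffOn_omegaFamily KM hφ x₀ _ _).continuousOn_fderivWithin
        (uniqueDiffOn_familyDomain x₀) (by simp)).clm_apply continuousOn_const)

/-- The pullback of the symplectic form under a family of maps is closed. -/
theorem fderivWithin_omegaFamily_closed {x₀ : N} {q : ℝ × EuclideanSpace ℝ (Fin d)}
    (hq : q ∈ familyDomain I x₀) (u v w : ℝ × EuclideanSpace ℝ (Fin d)) :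
    fderivWithin ℝ (omegaFamily I KM φ x₀ v w) (familyDomain I x₀) q u =
      fderivWithin ℝ (omegaFamily I KM φ x₀ u w) (familyDomain I x₀) q v -
      fderivWithin ℝ (omegaFamily I KM φ x₀ u v) (familyDomain I x₀) q w := by
  have hf := contMDiffOn_familyInChart hφ x₀
  have hS := uniqueDiffOn_familyDomain (I := I) x₀
  have h1 := extDerivWithin_pullbackForm KM.omega_smooth KM.omega_closed hf hS hq
    (familyDomain_subset_closure_interior x₀ hq)
  have h2 := extDerivWithin_two_apply
    (differentiableWithinAt_pullbackForm KM.omega_smooth hf hS hq) (hS q hq) u v w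
  rw [h1] at h2
  change (0 : ℝ) = fderivWithin ℝ (omegaFamily I KM φ x₀ v w) (familyDomain I x₀) q u -
    fderivWithin ℝ (omegaFamily I KM φ x₀ u w) (familyDomain I x₀) q v +
    fderivWithin ℝ (omegaFamily I KM φ x₀ u v) (familyDomain I x₀) q w at h2
  linarith

end General

end AlongFamilies

/-! ### Invariance under homotopies -/

section Parametric

/-- A parametric integral is constant if the integral of the derivative vanishes. -/
theorem integral_eq_of_integral_deriv_eq_zero {X : Type*} [TopologicalSpace X] [CompactSpace X]
    [MeasurableSpace X] [BorelSpace X] (μ : Measure X) [IsFiniteMeasure μ] {c γ : ℝ → X → ℝ}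
    (hc : ContinuousOn (fun p : ℝ × X => c p.1 p.2) (Icc (0 : ℝ) 1 ×ˢ univ))
    (hγ : ContinuousOn (fun p : ℝ × X => γ p.1 p.2) (Icc (0 : ℝ) 1 ×ˢ univ))
    (hcγ : ∀ t ∈ Icc (0 : ℝ) 1, ∀ x, HasDerivWithinAt (fun s => c s x) (γ t x) (Icc 0 1) t)
    (h0 : ∀ t ∈ Ioo (0 : ℝ) 1, ∫ x, γ t x ∂μ = 0)
    {s t : ℝ} (hs : s ∈ Icc (0 : ℝ) 1) (ht : t ∈ Icc (0 : ℝ) 1) :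
    ∫ x, c s x ∂μ = ∫ x, c t x ∂μ := by
  have hK : IsCompact (Icc (0 : ℝ) 1 ×ˢ (univ : Set X)) := isCompact_Icc.prod isCompact_univ
  obtain ⟨B, hB⟩ := hK.exists_bound_of_continuousOn hc
  obtain ⟨B', hB'⟩ := hK.exists_bound_of_continuousOn hγ
  have hslice : ∀ {f : ℝ → X → ℝ}, ContinuousOn (fun p : ℝ × X => f p.1 p.2)
      (Icc (0 : ℝ) 1 ×ˢ univ) → ∀ t ∈ Icc (0 : ℝ) 1, Continuous (f t) := fun hf t ht => by
    rw [← continuousOn_univ]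
    exact hf.comp (continuousOn_const.prodMk continuousOn_id) fun x hx => ⟨ht, hx⟩
  have hci : ∀ t ∈ Icc (0 : ℝ) 1, Integrable (c t) μ := fun t ht =>
    (hslice hc t ht).integrable_of_hasCompactSupport (HasCompactSupport.of_compactSpace _)
  have hcont : ContinuousOn (fun t => ∫ x, c t x ∂μ) (Icc 0 1) :=
    continuousOn_of_dominated (bound := fun _ => B)
      (fun t ht => (hci t ht).aestronglyMeasurable)
      (fun t ht => Filter.Eventually.of_forall fun x => hB (t, x) ⟨ht, mem_univ x⟩)
      (integrable_const B)
      (Filter.Eventually.of_forall fun x t ht => (hcγ t ht x).continuousWithinAt)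
  -- Only interior times are used: continuity on `[0, 1]` and the mean value theorem take care of
  -- the endpoints.
  have hderiv : ∀ t ∈ Ioo (0 : ℝ) 1, HasDerivAt (fun t => ∫ x, c t x ∂μ) 0 t := by
    intro t ht
    have ht' := Ioo_subset_Icc_self ht
    rw [← h0 t ht]
    refine (hasDerivAt_integral_of_dominated_loc_of_deriv_le (bound := fun _ => B') (F' := γ)
      (Ioo_mem_nhds ht.1 ht.2) ?_ (hci t ht') ?_ ?_ (integrable_const B') ?_).2
    · filter_upwards [Ioo_mem_nhds ht.1 ht.2] with s hs
      exact (hci s (Ioo_subset_Icc_self hs)).aestronglyMeasurable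
    · exact (hslice hγ t ht').aestronglyMeasurable
    · exact Filter.Eventually.of_forall fun x s hs =>
        hB' (s, x) ⟨Ioo_subset_Icc_self hs, mem_univ x⟩
    · exact Filter.Eventually.of_forall fun x s hs =>
        (hcγ s (Ioo_subset_Icc_self hs) x).hasDerivAt (Icc_mem_nhds hs.1 hs.2)
  have key : ∀ s ∈ Icc (0 : ℝ) 1, ∀ t ∈ Icc (0 : ℝ) 1, s < t →
      ∫ x, c s x ∂μ = ∫ x, c t x ∂μ := by
    intro s hs t ht hst
    obtain ⟨r, -, hr⟩ := exists_hasDerivAt_eq_slope (fun t => ∫ x, c t x ∂μ) (fun _ => 0) hst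
      (hcont.mono (Icc_subset_Icc hs.1 ht.2))
      fun r hr => hderiv r ⟨hs.1.trans_lt hr.1, hr.2.trans_le ht.2⟩
    rw [eq_comm, div_eq_zero_iff, or_iff_left (sub_pos.2 hst).ne', sub_eq_zero] at hr
    exact hr.symm
  rcases lt_trichotomy s t with h | rfl | h
  · exact key s hs t ht h
  · rfl
  · exact (key t ht s hs h).symm

end Parametric

/-! ### Constancy of `E' - E''` along homotopies of maps of pairs. -/

section Invariance

variable {d m : ℕ} [NeZero d]
  {N : Type*} [TopologicalSpace N] [ChartedSpace (EuclideanHalfSpace d) N] [IsManifold (𝓡∂ d) ∞ N]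
  {M : Type*} [TopologicalSpace M]
  [ChartedSpace (EuclideanSpace ℝ (Fin (2 * m))) M] [IsManifold (𝓡 (2 * m)) ∞ M]

/-- Twice the `1`-form `v ↦ ω(∂ₜφ, dφ v)`. -/
def variationForm (KM : AlmostKahler (𝓡 (2 * m)) M) (φ : ℝ → N → M) (t : ℝ) (x : N) :
    TangentSpace (𝓡∂ d) x →L[ℝ] ℝ :=
  (2 : ℝ) • (KM.metric.inner (φ t x) (KM.J (φ t x)
    (mfderiv 𝓘(ℝ, ℝ) (𝓡 (2 * m)) (fun s => φ s x) t (1 : ℝ)))).comp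
      (mfderiv (𝓡∂ d) (𝓡 (2 * m)) (φ t) x)

variable {KN : AlmostKahler (𝓡∂ d) N} {KM : AlmostKahler (𝓡 (2 * m)) M} {φ : ℝ → N → M}

/-- The form consists of the mixed time-space components of the pullback of `ω` to `[0,1] × N`, and
so inherits their smoothness. The factor `2` matches that of `sum_omegaInChart_inv_mul_sub`. -/
theorem oneFormInChart_variationForm
    (hφ : ContMDiffOn (𝓘(ℝ, ℝ).prod (𝓡∂ d)) (𝓡 (2 * m)) ∞ (fun p : ℝ × N => φ p.1 p.2)
      (Icc (0 : ℝ) 1 ×ˢ univ)) {x₀ : N} {t : ℝ} (ht : t ∈ Ioo (0 : ℝ) 1)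
    {y : EuclideanSpace ℝ (Fin d)} (hy : y ∈ (extChartAt (𝓡∂ d) x₀).target)
    (v : EuclideanSpace ℝ (Fin d)) :
    oneFormInChart (variationForm KM φ t) x₀ y v =
      2 * omegaFamily (𝓡∂ d) KM φ x₀ (1, 0) (0, v) (t, y) := by
  have ht' := Ioo_subset_Icc_self ht
  have h1 := mfderiv_chartSymmDeriv hy
    ((contMDiff_slice hφ ht').mdifferentiable (by simp) ((extChartAt (𝓡∂ d) x₀).symm y)) v
  rw [mfderivWithin_slice hφ ht' hy] at h1
  have h2 := mfderiv_time hφ ht hy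
  rw [omegaFamily, pullbackForm_pair]
  refine Eq.trans (congrArg (fun z => 2 * KM.metric.inner (φ t ((extChartAt (𝓡∂ d) x₀).symm y))
    (KM.J _ (mfderiv 𝓘(ℝ, ℝ) (𝓡 (2 * m)) (fun s => φ s ((extChartAt (𝓡∂ d) x₀).symm y)) t (1 : ℝ)))
    z) h1) ?_
  rw [h2]
  exact congrArg (2 * ·) (KM.omega_eq _ _ _).symm

variable [T2Space N] [CompactSpace N] [MeasurableSpace N] [BorelSpace N]
  {L : Type*} [TopologicalSpace L] [ChartedSpace (EuclideanSpace ℝ (Fin m)) L] {ι : L → M}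

/-- Cartan's formula: the pullback of `ω` to `[0,1] × N` is closed, so the time derivative of its
spatial part is the spatial differential of `ω(∂ₜφ, dφ ·)`. The Lagrangian condition kills this
`1`-form on vectors tangent to `∂N`, and Stokes' theorem applies. -/
theorem integral_contractDeriv_eq_zero (KN : AlmostKahler (𝓡∂ d) N) (hL : IsLagrangian KM ι)
    (hφ : IsSmoothFamily (𝓡∂ d) (𝓡 (2 * m)) (range ι) φ) {t : ℝ} (ht : t ∈ Ioo (0 : ℝ) 1) :
    ∫ x, contractDeriv KN KM φ t x ∂(riemannianVolume KN.metric) = 0 := by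
  have ht' := Ioo_subset_Icc_self ht
  have hC : ∀ (x₀ : N) (v : EuclideanSpace ℝ (Fin d)),
      ContDiffOn ℝ ∞ (fun z => omegaFamily (𝓡∂ d) KM φ x₀ (1, 0) (0, v) (t, z))
        (extChartAt (𝓡∂ d) x₀).target := fun x₀ v =>
    (contDiffOn_omegaFamily KM hφ.smooth x₀ _ _).comp
      (contDiff_const.prodMk contDiff_id).contDiffOn fun z hz => ⟨ht', hz⟩
  have hb : ∀ x₀ : N, ContDiffOn ℝ 1 (oneFormInChart (variationForm (d := d) KM φ t) x₀)
      (extChartAt (𝓡∂ d) x₀).target := fun x₀ => contDiffOn_clm_apply.2 fun v =>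
    (contDiffOn_const.mul ((hC x₀ v).of_le (by simp))).congr fun y hy =>
      oneFormInChart_variationForm hφ.smooth ht hy v
  refine integral_contract_extDeriv_eq_zero KN (variationForm KM φ t) _ hb ?_ ?_
  · intro x₀ y hy hy0 j hj
    rw [oneFormInChart_variationForm hφ.smooth ht hy]
    have hf := (contMDiffOn_familyInChart hφ.smooth x₀ (t, y)
      ⟨ht', hy⟩).mdifferentiableWithinAt (by simp)
    have hbd := symm_mem_boundary hy hy0
    -- Two curves through `(t, y)` are mapped into `L`: one moves in time with the boundary point
    -- fixed, the other along the boundary at the fixed time `t`.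
    have h1 : HasDerivAt (fun s : ℝ => (t + s, y))
        ((1, 0) : ℝ × EuclideanSpace ℝ (Fin d)) 0 :=
      ((hasDerivAt_id (0 : ℝ)).const_add t).prodMk (hasDerivAt_const 0 y)
    have h2 : HasDerivAt (fun s : ℝ => (t, y + s • (stdVec j : EuclideanSpace ℝ (Fin d))))
        ((0, stdVec j) : ℝ × EuclideanSpace ℝ (Fin d)) 0 := by
      have h3 := ((hasDerivAt_id (0 : ℝ)).smul_const
        (stdVec j : EuclideanSpace ℝ (Fin d))).const_add y
      rw [one_smul] at h3
      exact (hasDerivAt_const 0 t).prodMk h3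
    have h4 := hL.pullbackForm_omega_eq_zero (by simp) (by simp) hf h1 (by
      have h5 : ∀ᶠ s in 𝓝 (0 : ℝ), t + s ∈ Icc (0 : ℝ) 1 := by
        have h6 : ContinuousAt (fun s => t + s) (0 : ℝ) := by fun_prop
        refine h6.preimage_mem_nhds ?_
        rw [add_zero]
        exact Icc_mem_nhds ht.1 ht.2
      filter_upwards [h5] with s hs
      exact ⟨⟨hs, hy⟩, hφ.boundary _ hs hbd⟩) h2 (by
      filter_upwards [eventually_add_smul_mem_target hy hy0 hj] with s hs
      exact ⟨⟨ht', hs.1⟩, hφ.boundary _ ht' (symm_mem_boundary hs.1 hs.2)⟩)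
    rw [omegaFamily, h4, mul_zero]
  · intro x₀ y hy
    rw [contractDeriv_symm KN KM hφ.smooth ht' hy, bivectorDeriv]
    simp only [fderivWithin_omegaFamily_closed KM hφ.smooth (⟨ht', hy⟩ :
      (t, y) ∈ familyDomain (𝓡∂ d) x₀) (1, 0)]
    -- Closedness on `(∂ₜ, eᵢ, eⱼ)` has expressed the time derivative as `∂ᵢβⱼ - ∂ⱼβᵢ`, with `β` the
    -- mixed component.
    rw [sum_omegaInChart_inv_mul_sub KN x₀ y fun i j =>
      fderivWithin ℝ (omegaFamily (𝓡∂ d) KM φ x₀ (1, 0) (0, stdVec j)) (familyDomain (𝓡∂ d) x₀)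
        (t, y) (0, stdVec i)]
    refine Finset.sum_congr rfl fun i _ => Finset.sum_congr rfl fun j _ => congrArg _ ?_
    have hT := uniqueDiffOn_target (I := 𝓡∂ d) x₀ y hy
    rw [fderivWithin_apply_const ((hb x₀).differentiableOn (by simp) y hy) hT,
      fderivWithin_congr (fun z hz => oneFormInChart_variationForm hφ.smooth ht hz (stdVec j))
        (oneFormInChart_variationForm hφ.smooth ht hy (stdVec j)),
      fderivWithin_const_mul hT ((hC x₀ (stdVec j)).differentiableOn (by simp) y hy) 2,
      ← fderivWithin_omegaFamily_slice KM hφ.smooth ht' hy]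
    rfl

/-- The integral of the contraction with the pulled back symplectic form does not change along a
family of maps of pairs. -/
theorem integral_contract_pullbackOmega_const (KN : AlmostKahler (𝓡∂ d) N)
    (hL : IsLagrangian KM ι) (hφ : IsSmoothFamily (𝓡∂ d) (𝓡 (2 * m)) (range ι) φ)
    {s t : ℝ} (hs : s ∈ Icc (0 : ℝ) 1) (ht : t ∈ Icc (0 : ℝ) 1) :
    ∫ x, KN.contract x (pullbackOmega KM (φ s) x) ∂(riemannianVolume KN.metric) =
      ∫ x, KN.contract x (pullbackOmega KM (φ t) x) ∂(riemannianVolume KN.metric) := by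
  have := isFiniteMeasure_riemannianVolume KN.metric
  exact integral_eq_of_integral_deriv_eq_zero (riemannianVolume KN.metric)
    (c := fun t x => KN.contract x (pullbackOmega KM (φ t) x))
    (continuousOn_contract_family KN KM hφ.smooth) (continuousOn_contractDeriv KN KM hφ.smooth)
    (fun t ht x => hasDerivWithinAt_contractDeriv KN KM hφ.smooth ht x)
    (fun t ht => integral_contractDeriv_eq_zero KN hL hφ ht) hs ht

omit [T2Space N] in
theorem energy10_sub_energy01 (KN : AlmostKahler (𝓡∂ d) N) (KM : AlmostKahler (𝓡 (2 * m)) M)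
    {ψ : N → M} (hψ : ContMDiff (𝓡∂ d) (𝓡 (2 * m)) ∞ ψ) :
    energy10 KN KM ψ - energy01 KN KM ψ =
      (1 / 2) * ∫ x, KN.contract x (pullbackOmega KM ψ x) ∂(riemannianVolume KN.metric) := by
  rw [energy10_eq KN KM hψ, energy01_eq KN KM hψ]
  ring

/-- The difference of the partial energies is constant along a family of maps of pairs. -/
theorem energy10_sub_energy01_const (KN : AlmostKahler (𝓡∂ d) N)
    (hL : IsLagrangian KM ι) (hφ : IsSmoothFamily (𝓡∂ d) (𝓡 (2 * m)) (range ι) φ)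
    {s t : ℝ} (hs : s ∈ Icc (0 : ℝ) 1) (ht : t ∈ Icc (0 : ℝ) 1) :
    energy10 KN KM (φ s) - energy01 KN KM (φ s) = energy10 KN KM (φ t) - energy01 KN KM (φ t) := by
  rw [energy10_sub_energy01 KN KM (contMDiff_slice hφ.smooth hs),
    energy10_sub_energy01 KN KM (contMDiff_slice hφ.smooth ht),
    integral_contract_pullbackOmega_const KN hL hφ hs ht]

end Invariance

/-! ### Exact Lagrangian submanifolds -/

section Exact

/-- The exterior derivative of a `1`-form evaluated on two vectors. -/
theorem extDerivWithin_one_apply {E : Type*} [NormedAddCommGroup E] [NormedSpace ℝ E]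
    {α : E → E [⋀^Fin 1]→L[ℝ] ℝ} {T : Set E} {y : E}
    (hα : DifferentiableWithinAt ℝ α T y) (hT : UniqueDiffWithinAt ℝ T y) (v w : E) :
    extDerivWithin α T y ![v, w] = fderivWithin ℝ (fun z => α z ![w]) T y v -
      fderivWithin ℝ (fun z => α z ![v]) T y w := by
  rw [extDerivWithin_apply hα hT, Fin.sum_univ_two]
  have e0 : (0 : Fin 2).removeNth ![v, w] = ![w] := by
    ext k; fin_cases k; rfl
  have e1 : (1 : Fin 2).removeNth ![v, w] = ![v] := by
    ext k; fin_cases k; rfl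
  rw [e0, e1]
  simp
  ring

variable {d m : ℕ} [NeZero d]
  {N : Type*} [TopologicalSpace N] [ChartedSpace (EuclideanHalfSpace d) N] [IsManifold (𝓡∂ d) ∞ N]
  {M : Type*} [TopologicalSpace M]
  [ChartedSpace (EuclideanSpace ℝ (Fin (2 * m))) M] [IsManifold (𝓡 (2 * m)) ∞ M]
  {L : Type*} [TopologicalSpace L] [ChartedSpace (EuclideanSpace ℝ (Fin m)) L] {ι : L → M}

omit [IsManifold (𝓡 (2 * m)) ∞ M] in
/-- A smooth function on an embedded submanifold, pulled back to the boundary, extends to a smooth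
function. -/
theorem exists_extension_of_boundary [T2Space N] [CompactSpace N]
    (hι : IsSmoothEmbedding (𝓡 m) (𝓡 (2 * m)) ∞ ι) {f : L → ℝ} (hf : ContMDiff (𝓡 m) 𝓘(ℝ, ℝ) ∞ f)
    {ψ : N → M} (hψ : ContMDiff (𝓡∂ d) (𝓡 (2 * m)) ∞ ψ)
    (hbd : MapsTo ψ ((𝓡∂ d).boundary N) (range ι)) :
    ∃ u : N → ℝ, ContMDiff (𝓡∂ d) 𝓘(ℝ, ℝ) ∞ u ∧
      ∀ x ∈ (𝓡∂ d).boundary N, ∀ q, ι q = ψ x → u x = f q := by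
  -- The admissible values form a convex set at each point: one prescribed value on the boundary,
  -- all of `ℝ` elsewhere. So local extensions, obtained by retracting onto `L`, can be averaged.
  obtain ⟨u, hu⟩ := exists_contMDiffMap_forall_mem_convex_of_local (𝓡∂ d) (M := N) (F := ℝ) (n := ⊤)
    (t := fun x => {r : ℝ | x ∈ (𝓡∂ d).boundary N → ∀ q, ι q = ψ x → r = f q}) (by
      intro x r hr r' hr' a b _ _ hab hx q hq
      rw [hr hx q hq, hr' hx q hq, ← add_smul, hab, one_smul]) (by
      intro x
      by_cases hx : x ∈ (𝓡∂ d).boundary N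
      · obtain ⟨p, hp⟩ := hbd hx
        obtain ⟨V, r, hV, hpV, hr, hrV⟩ := hι.exists_retraction p
        rw [hp] at hpV
        refine ⟨ψ ⁻¹' V, hψ.continuous.continuousAt.preimage_mem_nhds (hV.mem_nhds hpV),
          fun x => f (r (ψ x)), ?_, ?_⟩
        · exact hf.comp_contMDiffOn (hr.comp hψ.contMDiffOn fun x hx => hx)
        · intro z hz _ q hq
          refine congrArg f (hι.isEmbedding.injective ?_)
          rw [hrV _ hz ⟨q, hq⟩, hq]
      · refine ⟨((𝓡∂ d).boundary N)ᶜ, ?_, fun _ => 0, contMDiffOn_const, fun z hz hz' => absurd hz' hz⟩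
        exact ((𝓡∂ d).isClosed_boundary (n := ∞) (by simp)).isOpen_compl.mem_nhds hx)
  exact ⟨u, u.contMDiff, fun x hx q hq => hu x hx q hq⟩

/-- A `1`-form as a family of linear functionals. -/
def DiffForm.toFunctional {E : Type*} [NormedAddCommGroup E] [NormedSpace ℝ E]
    {H : Type*} [TopologicalSpace H] {I : ModelWithCorners ℝ E H}
    {M : Type*} [TopologicalSpace M] [ChartedSpace H M] (α : DiffForm I M 1) (x : M) :
    TangentSpace I x →L[ℝ] ℝ :=
  (ContinuousAlternatingMap.ofSubsingleton ℝ (TangentSpace I x) ℝ (0 : Fin 1)).symm (α x)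

/-- The difference of the pullback of a `1`-form and the differential of a function. -/
def primitiveForm (lam : DiffForm (𝓡 (2 * m)) M 1) (ψ : N → M) (u : N → ℝ) (x : N) :
    TangentSpace (𝓡∂ d) x →L[ℝ] ℝ :=
  (lam.toFunctional (ψ x)).comp (mfderiv (𝓡∂ d) (𝓡 (2 * m)) ψ x) - realDifferential u x

variable {ψ : N → M} {u : N → ℝ} {lam : DiffForm (𝓡 (2 * m)) M 1}

omit [IsManifold (𝓡 (2 * m)) ∞ M] in
theorem oneFormInChart_primitiveForm (hψ : ContMDiff (𝓡∂ d) (𝓡 (2 * m)) ∞ ψ)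
    (hu : ContMDiff (𝓡∂ d) 𝓘(ℝ, ℝ) ∞ u) {x₀ : N}
    {y : EuclideanSpace ℝ (Fin d)} (hy : y ∈ (extChartAt (𝓡∂ d) x₀).target)
    (v : EuclideanSpace ℝ (Fin d)) :
    oneFormInChart (primitiveForm lam ψ u) x₀ y v =
      pullbackForm (𝓡 (2 * m)) (fun z => ψ ((extChartAt (𝓡∂ d) x₀).symm z))
        (extChartAt (𝓡∂ d) x₀).target lam y ![v] -
      fderivWithin ℝ (fun z => u ((extChartAt (𝓡∂ d) x₀).symm z))
        (extChartAt (𝓡∂ d) x₀).target y v := by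
  rw [← oneFormInChart_realDifferential hy (hu.mdifferentiable (by simp) _)]
  have h := mfderiv_chartSymmDeriv hy (hψ.mdifferentiable (by simp) _) v
  refine Eq.trans (congrArg (fun z => lam.toFunctional (ψ ((extChartAt (𝓡∂ d) x₀).symm y)) z -
    oneFormInChart (realDifferential u) x₀ y v) h) ?_
  refine congrArg (· - oneFormInChart (realDifferential u) x₀ y v) ?_
  refine congrArg (lam (ψ ((extChartAt (𝓡∂ d) x₀).symm y))) ?_
  ext k
  fin_cases k
  rfl

/-- If the symplectic form is exact and the Lagrangian submanifold is exact, then the integral of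
the contraction with the pulled back symplectic form vanishes. -/
theorem integral_contract_pullbackOmega_eq_zero [T2Space N] [CompactSpace N] [MeasurableSpace N]
    [BorelSpace N] (KN : AlmostKahler (𝓡∂ d) N) {KM : AlmostKahler (𝓡 (2 * m)) M}
    (hι : IsSmoothEmbedding (𝓡 m) (𝓡 (2 * m)) ∞ ι)
    (hψ : ContMDiff (𝓡∂ d) (𝓡 (2 * m)) ∞ ψ)
    (hbd : MapsTo ψ ((𝓡∂ d).boundary N) (range ι))
    (hlam : lam.IsSmooth) (hdlam : lam.HasExtDeriv KM.omega)
    {f : L → ℝ} (hf : ContMDiff (𝓡 m) 𝓘(ℝ, ℝ) ∞ f)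
    (hlamf : ∀ (p : L) (v : TangentSpace (𝓡 m) p),
      lam (ι p) ![mfderiv (𝓡 m) (𝓡 (2 * m)) ι p v] = mfderiv (𝓡 m) 𝓘(ℝ, ℝ) f p v) :
    ∫ x, KN.contract x (pullbackOmega KM ψ x) ∂(riemannianVolume KN.metric) = 0 := by
  obtain ⟨u, hu, huf⟩ := exists_extension_of_boundary hι hf hψ hbd
  have hψc : ∀ x₀ : N, ContMDiffOn 𝓘(ℝ, EuclideanSpace ℝ (Fin d)) (𝓡 (2 * m)) ∞
      (fun z => ψ ((extChartAt (𝓡∂ d) x₀).symm z)) (extChartAt (𝓡∂ d) x₀).target := fun x₀ =>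
    hψ.comp_contMDiffOn (contMDiffOn_symm x₀)
  have huc : ∀ x₀ : N, ContDiffOn ℝ ∞ (fun z => u ((extChartAt (𝓡∂ d) x₀).symm z))
      (extChartAt (𝓡∂ d) x₀).target := fun x₀ =>
    contMDiffOn_iff_contDiffOn.1 (hu.comp_contMDiffOn (contMDiffOn_symm x₀))
  have hduc : ∀ x₀ : N, ContDiffOn ℝ ∞ (fderivWithin ℝ
      (fun z => u ((extChartAt (𝓡∂ d) x₀).symm z)) (extChartAt (𝓡∂ d) x₀).target)
      (extChartAt (𝓡∂ d) x₀).target := fun x₀ =>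
    (huc x₀).fderivWithin (uniqueDiffOn_target x₀) (by simp)
  have hlc : ∀ (x₀ : N) (v : EuclideanSpace ℝ (Fin d)), ContDiffOn ℝ ∞
      (fun y => pullbackForm (𝓡 (2 * m)) (fun z => ψ ((extChartAt (𝓡∂ d) x₀).symm z))
        (extChartAt (𝓡∂ d) x₀).target lam y ![v]) (extChartAt (𝓡∂ d) x₀).target := fun x₀ v =>
    contDiffOn_pullbackForm_apply hlam (hψc x₀) (uniqueDiffOn_target x₀) _
  have hb : ∀ x₀ : N, ContDiffOn ℝ 1 (oneFormInChart (primitiveForm (d := d) lam ψ u) x₀)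
      (extChartAt (𝓡∂ d) x₀).target := fun x₀ => contDiffOn_clm_apply.2 fun v =>
    (((hlc x₀ v).sub ((hduc x₀).clm_apply contDiffOn_const)).of_le (by simp)).congr fun y hy =>
      oneFormInChart_primitiveForm hψ hu hy v
  -- `bivectorDeriv` of the primitive is half of the contraction, because `db` has the two terms
  -- `∂ᵢbⱼ` and `-∂ⱼbᵢ`.
  suffices h : ∫ x, (1 / 2) * KN.contract x (pullbackOmega KM ψ x)
      ∂(riemannianVolume KN.metric) = 0 by
    rw [integral_const_mul] at h
    linarith
  refine integral_contract_extDeriv_eq_zero KN (primitiveForm lam ψ u) _ hb ?_ ?_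
  · intro x₀ y hy hy0 j hj
    rw [oneFormInChart_primitiveForm hψ hu hy, sub_eq_zero]
    have hc : HasDerivAt (fun s : ℝ => y + s • (stdVec j : EuclideanSpace ℝ (Fin d)))
        (stdVec j) 0 := by
      have h3 := ((hasDerivAt_id (0 : ℝ)).smul_const
        (stdVec j : EuclideanSpace ℝ (Fin d))).const_add y
      rwa [one_smul] at h3
    have hc0 : y + (0 : ℝ) • (stdVec j : EuclideanSpace ℝ (Fin d)) = y := by simp
    have hcT := eventually_add_smul_mem_target hy hy0 hj
    -- The boundary curve in direction `eⱼ` lifts to a curve `ρ` in `L`, along which `u` equals `f ∘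
    -- ρ`. Hence `du(eⱼ) = df(ρ') = λ(dψ eⱼ)`.
    obtain ⟨ρ, hρ, hρc, hρ0, h1⟩ := hι.exists_mfderivWithin_eq hc0
      ((hψc x₀ y hy).mdifferentiableWithinAt (by simp)) hc (by
      filter_upwards [hcT] with s hs
      exact ⟨hs.1, hbd (symm_mem_boundary hs.1 hs.2)⟩)
    have h2 := (mfderiv_curve_eq hc0
      (((huc x₀) y hy).differentiableWithinAt (by simp)).mdifferentiableWithinAt hc
      (hcT.mono fun s hs => hs.1)).2
    have h3 : (fun s : ℝ => u ((extChartAt (𝓡∂ d) x₀).symm (y + s • stdVec j))) =ᶠ[𝓝 0]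
        f ∘ ρ := by
      filter_upwards [hcT, hρc] with s hs hs'
      exact huf _ (symm_mem_boundary hs.1 hs.2) _ hs'
    have h4 : HasMFDerivAt 𝓘(ℝ, ℝ) 𝓘(ℝ, ℝ) (f ∘ ρ) 0 _ :=
      (hf.mdifferentiable (by simp) (ρ 0)).hasMFDerivAt.comp 0 hρ.hasMFDerivAt
    have h5 := congrArg (fun A : ℝ →L[ℝ] ℝ => A 1) (h4.congr_of_eventuallyEq h3).mfderiv
    have h6 := hlamf (ρ 0) (mfderiv 𝓘(ℝ, ℝ) (𝓡 m) ρ 0 (1 : ℝ))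
    rw [mfderivWithin_eq_fderivWithin] at h2
    refine Eq.trans ?_ (h6.trans (h5.symm.trans h2))
    have h7 : pullbackForm (𝓡 (2 * m)) (fun z => ψ ((extChartAt (𝓡∂ d) x₀).symm z))
        (extChartAt (𝓡∂ d) x₀).target lam y ![stdVec j] =
        lam (ψ ((extChartAt (𝓡∂ d) x₀).symm y)) ![mfderivWithin 𝓘(ℝ, EuclideanSpace ℝ (Fin d))
          (𝓡 (2 * m)) (fun z => ψ ((extChartAt (𝓡∂ d) x₀).symm z)) (extChartAt (𝓡∂ d) x₀).target y
          (stdVec j)] := by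
      refine congrArg (lam (ψ ((extChartAt (𝓡∂ d) x₀).symm y))) ?_
      ext k
      fin_cases k
      rfl
    rw [h7]
    have h8 := tangent_congr (fun x v => lam x ![v]) hρ0.symm
      (show EuclideanSpace ℝ (Fin (2 * m)) from mfderivWithin 𝓘(ℝ, EuclideanSpace ℝ (Fin d))
          (𝓡 (2 * m)) (fun z => ψ ((extChartAt (𝓡∂ d) x₀).symm z)) (extChartAt (𝓡∂ d) x₀).target y
          (stdVec j))
    refine h8.trans ?_
    rw [h1]
  · intro x₀ y hy
    have hT := uniqueDiffOn_target (I := 𝓡∂ d) x₀ y hy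
    have hcl := extChartAt_target_subset_closure_interior hy
    rw [contract_pullbackOmega_symm KN KM hψ hy, bivectorDeriv]
    have hB : ∀ i j : Fin d, fderivWithin ℝ (oneFormInChart (primitiveForm lam ψ u) x₀)
        (extChartAt (𝓡∂ d) x₀).target y (stdVec i) (stdVec j) =
        fderivWithin ℝ (fun y => pullbackForm (𝓡 (2 * m))
          (fun z => ψ ((extChartAt (𝓡∂ d) x₀).symm z)) (extChartAt (𝓡∂ d) x₀).target lam y
            ![stdVec j]) (extChartAt (𝓡∂ d) x₀).target y (stdVec i) -
        fderivWithin ℝ (fderivWithin ℝ (fun z => u ((extChartAt (𝓡∂ d) x₀).symm z))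
          (extChartAt (𝓡∂ d) x₀).target) (extChartAt (𝓡∂ d) x₀).target y (stdVec i)
          (stdVec j) := by
      intro i j
      rw [fderivWithin_apply_const ((hb x₀).differentiableOn (by simp) y hy) hT,
        fderivWithin_congr (fun z hz => oneFormInChart_primitiveForm hψ hu hz (stdVec j))
          (oneFormInChart_primitiveForm hψ hu hy (stdVec j)),
        fderivWithin_fun_sub hT ((hlc x₀ _).differentiableOn (by simp) y hy)
          (((hduc x₀).clm_apply contDiffOn_const).differentiableOn (by simp) y hy),
        fderivWithin_apply_const ((hduc x₀).differentiableOn (by simp) y hy) hT]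
      rfl
    -- Symmetry of second derivatives up to the boundary, that is `d(du) = 0`: subtracting `du` does
    -- not change the exterior derivative.
    have hsymm := ((huc x₀) y hy).isSymmSndFDerivWithinAt
      (by rw [minSmoothness_of_isRCLikeNormedField]; exact WithTop.coe_le_coe.2 le_top)
      (uniqueDiffOn_target x₀) hcl hy
    have hω : ∀ i j : Fin d, pullbackForm (𝓡 (2 * m))
        (fun z => ψ ((extChartAt (𝓡∂ d) x₀).symm z)) (extChartAt (𝓡∂ d) x₀).target KM.omega y
        ![stdVec i, stdVec j] =
        fderivWithin ℝ (oneFormInChart (primitiveForm lam ψ u) x₀)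
          (extChartAt (𝓡∂ d) x₀).target y (stdVec i) (stdVec j) -
        fderivWithin ℝ (oneFormInChart (primitiveForm lam ψ u) x₀)
          (extChartAt (𝓡∂ d) x₀).target y (stdVec j) (stdVec i) := by
      intro i j
      rw [hB, hB, hsymm (stdVec i) (stdVec j), ← extDerivWithin_pullbackForm hlam hdlam (hψc x₀)
        (uniqueDiffOn_target x₀) hy hcl, extDerivWithin_one_apply
        (differentiableWithinAt_pullbackForm hlam (hψc x₀) (uniqueDiffOn_target x₀) hy) hT]
      ring
    simp only [hω]
    rw [sum_omegaInChart_inv_mul_sub KN x₀ y fun i j =>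
      fderivWithin ℝ (oneFormInChart (primitiveForm lam ψ u) x₀)
        (extChartAt (𝓡∂ d) x₀).target y (stdVec i) (stdVec j)]
    simp only [Finset.mul_sum]
    exact Finset.sum_congr rfl fun i _ => Finset.sum_congr rfl fun j _ => by ring

end Exact

end

/-! ### The theorem. -/

theorem mainTheorem5
    {n m : ℕ} [NeZero (2 * n)]
    -- the compact almost Kähler manifold with boundary `N`
    {N : Type*} [TopologicalSpace N] [T2Space N] [CompactSpace N]
    [MeasurableSpace N] [BorelSpace N]
    [ChartedSpace (EuclideanHalfSpace (2 * n)) N] [IsManifold (𝓡∂ (2 * n)) ∞ N]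
    (KN : AlmostKahler (𝓡∂ (2 * n)) N)
    -- the almost Kähler manifold `M`
    {M : Type*} [TopologicalSpace M] [T2Space M] [SecondCountableTopology M]
    [ChartedSpace (EuclideanSpace ℝ (Fin (2 * m))) M] [IsManifold (𝓡 (2 * m)) ∞ M]
    (KM : AlmostKahler (𝓡 (2 * m)) M)
    -- the Lagrangian submanifold `L` of `M`, with inclusion `ι`
    {L : Type*} [TopologicalSpace L]
    [ChartedSpace (EuclideanSpace ℝ (Fin m)) L] [IsManifold (𝓡 m) ∞ L]
    (ι : L → M) (hL : IsLagrangian KM ι)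
    -- the smooth family of maps
    (φ : ℝ → N → M) (hφ : IsSmoothFamily (𝓡∂ (2 * n)) (𝓡 (2 * m)) (range ι) φ) :
    -- `E' - E''` is constant along the family, and it depends only on the homotopy class
    ((∀ s ∈ Icc (0 : ℝ) 1, ∀ t ∈ Icc (0 : ℝ) 1,
        energy10 KN KM (φ s) - energy01 KN KM (φ s) =
          energy10 KN KM (φ t) - energy01 KN KM (φ t)) ∧
      (∀ ψ : N → M, SmoothlyHomotopic (𝓡∂ (2 * n)) (𝓡 (2 * m)) (range ι) (φ 0) ψ →
        energy10 KN KM ψ - energy01 KN KM ψ =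
          energy10 KN KM (φ 0) - energy01 KN KM (φ 0))) ∧
    -- the case of an exact symplectic form and an exact Lagrangian
    (∀ lam : DiffForm (𝓡 (2 * m)) M 1, lam.IsSmooth → lam.HasExtDeriv KM.omega →
      (∃ f : L → ℝ, ContMDiff (𝓡 m) 𝓘(ℝ, ℝ) ∞ f ∧
        ∀ (p : L) (v : TangentSpace (𝓡 m) p),
          lam (ι p) ![mfderiv (𝓡 m) (𝓡 (2 * m)) ι p v] = mfderiv (𝓡 m) 𝓘(ℝ, ℝ) f p v) →
      ∀ t ∈ Icc (0 : ℝ) 1,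
        energy10 KN KM (φ t) = (1 / 2) * energy KN KM (φ t) ∧
        energy01 KN KM (φ t) = (1 / 2) * energy KN KM (φ t)) := by
  have h01 : (0 : ℝ) ∈ Icc (0 : ℝ) 1 := ⟨le_rfl, zero_le_one⟩
  have h11 : (1 : ℝ) ∈ Icc (0 : ℝ) 1 := ⟨zero_le_one, le_rfl⟩
  refine ⟨⟨fun s hs t ht => energy10_sub_energy01_const KN hL hφ hs ht, ?_⟩, ?_⟩
  · rintro ψ ⟨Φ, hΦ, h0, rfl⟩
    rw [← h0]
    exact energy10_sub_energy01_const KN hL hΦ h11 h01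
  · rintro lam hlam hdlam ⟨f, hf, hlamf⟩ t ht
    have hψ := contMDiff_slice hφ.smooth ht
    have h := integral_contract_pullbackOmega_eq_zero KN hL.isSmoothEmbedding hψ
      (hφ.boundary t ht) hlam hdlam hf hlamf
    -- Without the symplectic term, `E'` and `E''` are each a quarter of the integral of the metric
    -- trace, and `E` is half of it.
    rw [energy10_eq KN KM hψ, energy01_eq KN KM hψ, energy_eq, h]
    constructor <;> ring
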